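/- Let $(X,J)$ be a smooth almost complex manifold (Hausdorff, second countable) of real dimension $2n$, oriented by $J$, with a smooth $J$-Hermitian metric given by its fundamental $(1,1)$-form $\omega$ (so $\omega(\xi,J\xi)>0$ for $\xi\neq 0$); put $\omega_p=\omega^p/p!$. Let $0\le p\le n$ and let $\Theta$ be a current of bidimension $(p,p)$ on $X$, that is, a continuous $\mathbb C$-linear functional on the smooth compactly supported $(p,p)$-forms, regarded also as a functional on compactly supported smooth $2p$-forms which vanishes on the forms of the other types. For vector fields $\xi_1,\dots,\xi_{2(n-p)}$ let $\Theta(\xi_1,\dots,\xi_{2(n-p)})$ be the current of degree $0$ given by $\langle\Theta(\xi_1,\dots,\xi_{2(n-p)}),\varphi\rangle=\langle\Theta,\varphi(\xi_1,\dots,\xi_{2(n-p)},\cdot)\rangle$ on compactly supported smooth $2n$-forms $\varphi$; for a smooth $2n$-form $\psi$, $\Theta(\xi_1,\dots,\xi_{2(n-p)})\cdot\psi$ is the functional $f\mapsto\langle\Theta(\xi_1,\dots,\xi_{2(n-p)}),f\psi\rangle$ on $C_c^\infty(X,\mathbb C)$, and $\Theta\wedge\varphi$ is the functional $f\mapsto\langle\Theta,f\varphi\rangle$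 for a smooth $2p$-form $\varphi$. A $(q,q)$-form $u$ at a point is positive if $u(\xi_1,J\xi_1,\dots,\xi_q,J\xi_q)\ge 0$ for all real tangent vectors $\xi_1,\dots,\xi_q$, and strongly positive if it is a finite sum $\sum_t\lambda_t\, i\alpha_{t,1}\wedge\bar\alpha_{t,1}\wedge\dots\wedge i\alpha_{t,q}\wedge\bar\alpha_{t,q}$ with $\lambda_t\ge 0$ and $\alpha_{t,j}$ of type $(1,0)$. If $\Theta$ has order zero, a mass of $\Theta$ is a positive Radon measure $\mu$ on $X$ such that for every volume form $\psi$ and every relatively compact Borel set $A$ one has $\mu(A)=0$ if and only if $\int_A\Theta(\xi_1,\dots,\xi_{2(n-p)})\cdot\psi=0$ for all smooth real vector fields $\xi_1,\dots,\xi_{2(n-p)}$. Then the following are equivalent. (a) For all smooth real vector fields $\xi_1,\dots,\xi_{n-p}$ on $X$ and every smooth compactly supported positive $2n$-form $\varphi$, $\langle\Theta(\xi_1,J\xi_1,\dots,\xi_{n-p},J\xi_{n-p}),\varphi\rangle\ge 0$. (b) $\Theta$ has order zero; $\Theta\wedge\omega_p$ is given by a positive Radon measure $\|\Theta\|_\omega$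 which is a mass of $\Theta$; and for every representative $\theta$ of the Radon–Nikodym density of $\Theta$ with respect to $\|\Theta\|_\omega$ and $\omega_n$ (a field of $(n-p,n-p)$-forms on $X$, with $\theta(\xi_1,\dots,\xi_{2(n-p)})\in L^1_{loc}(\|\Theta\|_\omega)$ and $\Theta(\xi_1,\dots,\xi_{2(n-p)})\cdot\omega_n=\theta(\xi_1,\dots,\xi_{2(n-p)})\,\|\Theta\|_\omega$ for all smooth vector fields $\xi_j$), the form $\theta(x)$ is positive for $\|\Theta\|_\omega$-almost every $x\in X$. (c) For every smooth $(p,p)$-form $\varphi$ on $X$ that is strongly positive at every point, $\Theta\wedge\varphi$ is given by a positive Radon measure. -/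

import Mathlib

open scoped Manifold ContDiff ComplexOrder
open MeasureTheory Bundle

noncomputable section

namespace AlmostComplex

/-! ### Exterior algebra of a real vector space with a complex structure -/

section LinearAlgebra

variable {V : Type*} [AddCommGroup V] [Module ℝ V]

/-- Alternating `k`-linear forms on a real vector space `V`, with complex values; this is
`Λ^k (V ⊗ ℂ)^*`. -/
abbrev AltForm (V : Type*) [AddCommGroup V] [Module ℝ V] (k : ℕ) : Type _ := V [⋀^Fin k]→ₗ[ℝ] ℂ

/-- The family `(v₁, w₁, v₂, w₂, …, v_p, w_p)`. -/
def interleave {A : Type*} {p : ℕ} (v w : Fin p → A) : Fin (2 * p) → A := fun a =>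
  if a.val % 2 = 0 then v ⟨a.val / 2, by omega⟩ else w ⟨a.val / 2, by omega⟩

/-- The exterior product `γ₁ ∧ … ∧ γ_k` of 1-forms: its value on `(v₁, …, v_k)` is
`det (γ_i (v_j))`. -/
def wedgeOne {k : ℕ} (γ : Fin k → V →ₗ[ℝ] ℂ) : AltForm V k :=
  MultilinearMap.alternatization ((MultilinearMap.mkPiAlgebra ℝ (Fin k) ℂ).compLinearMap γ)

/-- `(γ₁ ∧ … ∧ γ_k) (v₁, …, v_k) = det (γ_i (v_j))`. -/
theorem wedgeOne_apply {k : ℕ} (γ : Fin k → V →ₗ[ℝ] ℂ) (v : Fin k → V) :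
    wedgeOne γ v = (Matrix.of fun i j => γ i (v j)).det := by
  rw [← Matrix.det_transpose, Matrix.det_apply]
  simp [wedgeOne, MultilinearMap.alternatization_apply]

/-- A 1-form of type `(1,0)`, that is, a `ℂ`-linear form on `(V, J)`. -/
def IsType10 (J : V →ₗ[ℝ] V) (α : V →ₗ[ℝ] ℂ) : Prop := ∀ v, α (J v) = Complex.I * α v

/-- The conjugate of a complex valued 1-form. -/
def conjForm (α : V →ₗ[ℝ] ℂ) : V →ₗ[ℝ] ℂ := Complex.conjAe.toLinearMap ∘ₗ α

/-- The space `Λ^{r,s}_J V^*` of `k`-forms of type `(r,s)`, spanned over `ℂ` by the products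
`α₁ ∧ … ∧ α_r ∧ β̄₁ ∧ … ∧ β̄_s` with `α_i`, `β_j` of type `(1,0)` (it is zero unless
`r + s = k`). -/
def formsOfType (J : V →ₗ[ℝ] V) (r s k : ℕ) : Submodule ℂ (AltForm V k) :=
  Submodule.span ℂ {u | r + s = k ∧ ∃ α : Fin k → V →ₗ[ℝ] ℂ, (∀ i, IsType10 J (α i)) ∧
    u = wedgeOne fun i => if i.val < r then α i else conjForm (α i)}

/-- A `(q,q)`-form `u` is positive if `u (ξ₁, J ξ₁, …, ξ_q, J ξ_q) ≥ 0` (a nonnegative real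
number) for all real vectors `ξ₁, …, ξ_q`. -/
def IsPositive (J : V →ₗ[ℝ] V) {q : ℕ} (u : AltForm V (2 * q)) : Prop :=
  u ∈ formsOfType J q q (2 * q) ∧ ∀ ξ : Fin q → V, 0 ≤ u (interleave ξ fun i => J (ξ i))

/-- A `(q,q)`-form is strongly positive if it is of the form
`∑ λ_t iα_{t,1} ∧ ᾱ_{t,1} ∧ … ∧ iα_{t,q} ∧ ᾱ_{t,q}` with `λ_t ≥ 0` and `α_{t,j}` of type
`(1,0)`. -/
def IsStronglyPositive (J : V →ₗ[ℝ] V) {q : ℕ} (u : AltForm V (2 * q)) : Prop :=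
  ∃ (N : ℕ) (c : Fin N → ℝ) (α : Fin N → Fin q → V →ₗ[ℝ] ℂ),
    (∀ t, 0 ≤ c t) ∧ (∀ t j, IsType10 J (α t j)) ∧
    u = ∑ t, ((c t : ℂ) * Complex.I ^ q) •
      wedgeOne (interleave (α t) fun j => conjForm (α t j))

theorem pairProd_factor_ne (g : AltForm V 2) {p : ℕ} [DecidableEq (Fin (2 * p))]
    (v : Fin (2 * p) → V) (a : Fin (2 * p)) (x y : V) {i : Fin p} {h : a.val / 2 < p}
    (hi : i ∈ Finset.univ.erase (⟨a.val / 2, h⟩ : Fin p)) :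
    g ![Function.update v a x ⟨2 * i.val, by omega⟩,
        Function.update v a x ⟨2 * i.val + 1, by omega⟩] =
      g ![Function.update v a y ⟨2 * i.val, by omega⟩,
        Function.update v a y ⟨2 * i.val + 1, by omega⟩] := by
  have h1 : i.val ≠ a.val / 2 := fun e => (Finset.mem_erase.1 hi).1 (Fin.ext e)
  have h2 : (⟨2 * i.val, by omega⟩ : Fin (2 * p)) ≠ a := fun e => by
    have := congrArg Fin.val e
    simp only at this
    omega
  have h3 : (⟨2 * i.val + 1, by omega⟩ : Fin (2 * p)) ≠ a := fun e => by
    have := congrArg Fin.val e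
    simp only at this
    omega
  simp only [Function.update_of_ne h2, Function.update_of_ne h3]

/-- The pair of arguments number `a / 2`, after replacing the argument number `a`. -/
theorem pairProd_pair {V : Type*} [AddCommGroup V] {p : ℕ} [DecidableEq (Fin (2 * p))]
    (v : Fin (2 * p) → V) (a : Fin (2 * p)) (h : a.val / 2 < p) :
    ∃ (e : Fin 2) (w : Fin 2 → V), ∀ x : V,
      ![Function.update v a x ⟨2 * (a.val / 2), by omega⟩,
        Function.update v a x ⟨2 * (a.val / 2) + 1, by omega⟩] = Function.update w e x := by
  rcases Nat.mod_two_eq_zero_or_one a.val with h0 | h0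
  · refine ⟨0, ![0, v ⟨2 * (a.val / 2) + 1, by omega⟩], fun x => ?_⟩
    have h2 : (⟨2 * (a.val / 2), by omega⟩ : Fin (2 * p)) = a := Fin.ext (by simp only; omega)
    have h3 : (⟨2 * (a.val / 2) + 1, by omega⟩ : Fin (2 * p)) ≠ a := fun e => by
      have := congrArg Fin.val e
      simp only at this
      omega
    rw [Function.update_of_ne h3, h2, Function.update_self]
    ext j
    fin_cases j <;> simp
  · refine ⟨1, ![v ⟨2 * (a.val / 2), by omega⟩, 0], fun x => ?_⟩
    have h2 : (⟨2 * (a.val / 2) + 1, by omega⟩ : Fin (2 * p)) = a := Fin.ext (by simp only; omega)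
    have h3 : (⟨2 * (a.val / 2), by omega⟩ : Fin (2 * p)) ≠ a := fun e => by
      have := congrArg Fin.val e
      simp only at this
      omega
    rw [Function.update_of_ne h3, h2, Function.update_self]
    ext j
    fin_cases j <;> simp

/-- The multilinear map `(v₁, …, v_{2p}) ↦ g (v₁, v₂) g (v₃, v₄) ⋯ g (v_{2p-1}, v_{2p})`. -/
def pairProd (g : AltForm V 2) (p : ℕ) : MultilinearMap ℝ (fun _ : Fin (2 * p) => V) ℂ where
  toFun v := ∏ i : Fin p, g ![v ⟨2 * i.val, by omega⟩, v ⟨2 * i.val + 1, by omega⟩]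
  map_update_add' := by
    intro _ v a x y
    have hlt : a.val / 2 < p := by omega
    obtain ⟨e, w, hw⟩ := pairProd_pair v a hlt
    rw [← Finset.mul_prod_erase _ _ (Finset.mem_univ (⟨a.val / 2, hlt⟩ : Fin p)),
      ← Finset.mul_prod_erase _ _ (Finset.mem_univ (⟨a.val / 2, hlt⟩ : Fin p)),
      ← Finset.mul_prod_erase _ _ (Finset.mem_univ (⟨a.val / 2, hlt⟩ : Fin p)),
      hw (x + y), hw x, hw y, g.map_update_add, add_mul]
    congr 1
    · congr 1
      exact Finset.prod_congr rfl fun i hi => pairProd_factor_ne g v a _ _ hi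
    · congr 1
      exact Finset.prod_congr rfl fun i hi => pairProd_factor_ne g v a _ _ hi
  map_update_smul' := by
    intro _ v a c x
    have hlt : a.val / 2 < p := by omega
    obtain ⟨e, w, hw⟩ := pairProd_pair v a hlt
    rw [← Finset.mul_prod_erase _ _ (Finset.mem_univ (⟨a.val / 2, hlt⟩ : Fin p)),
      ← Finset.mul_prod_erase _ _ (Finset.mem_univ (⟨a.val / 2, hlt⟩ : Fin p)),
      hw (c • x), hw x, g.map_update_smul, smul_mul_assoc]
    congr 2
    exact Finset.prod_congr rfl fun i hi => pairProd_factor_ne g v a _ _ hi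

/-- The form `g_p = g^p / p!`, where `g^p = g ∧ … ∧ g`; explicitly
`g_p (v₁, …, v_{2p}) = (1 / (2^p p!)) ∑_σ sgn(σ) g (v_{σ1}, v_{σ2}) ⋯ g (v_{σ(2p-1)}, v_{σ(2p)})`. -/
def dividedPower (g : AltForm V 2) (p : ℕ) : AltForm V (2 * p) :=
  (1 / (2 ^ p * (p.factorial : ℂ))) • MultilinearMap.alternatization (pairProd g p)

theorem append_cast_update {V : Type*} {m k N : ℕ} (h : m + k = N) [DecidableEq (Fin k)] (w : Fin m → V)
    (v : Fin k → V) (i : Fin k) (x : V) :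
    Fin.append w (Function.update v i x) ∘ Fin.cast h.symm =
      Function.update (Fin.append w v ∘ Fin.cast h.symm) (Fin.cast h (Fin.natAdd m i)) x := by
  subst h
  ext b
  refine Fin.addCases (fun c => ?_) (fun c => ?_) b
  · have : Fin.castAdd k c ≠ Fin.natAdd m i := fun e => by
      have := congrArg Fin.val e
      simp at this
      omega
    simp [Function.update_of_ne this]
  · by_cases hc : c = i
    · subst hc
      simp
    · have : Fin.natAdd m c ≠ Fin.natAdd m i := fun e => hc (by simpa [Fin.ext_iff] using e)
      simp [Function.update_of_ne this, Function.update_of_ne hc]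

/-- The form `φ (w₁, …, w_m, ·)`, that is, `(w₁ ∧ … ∧ w_m) ⌟ φ`. -/
def contractForm {m k N : ℕ} (h : m + k = N) (φ : AltForm V N) (w : Fin m → V) : AltForm V k where
  toFun v := φ (Fin.append w v ∘ Fin.cast h.symm)
  map_update_add' := by
    intro _ v i x y
    simp only [append_cast_update h, φ.map_update_add]
  map_update_smul' := by
    intro _ v i c x
    simp only [append_cast_update h, φ.map_update_smul]
  map_eq_zero_of_eq' := by
    intro v i j hij hne
    refine φ.map_eq_zero_of_eq _ (i := Fin.cast h (Fin.natAdd m i))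
      (j := Fin.cast h (Fin.natAdd m j)) ?_ ?_
    · simpa using hij
    · simpa [Fin.ext_iff] using hne

end LinearAlgebra

/-! ### Almost complex manifolds, smooth forms -/

section Manifold

/-- The model space of real manifolds of dimension `d`. -/
abbrev Model (d : ℕ) : Type := EuclideanSpace ℝ (Fin d)

theorem contMDiff_complex_mul {d : ℕ} {X : Type*} [TopologicalSpace X]
    [ChartedSpace (Model d) X] {f g : X → ℂ} (hf : ContMDiff (𝓡 d) 𝓘(ℝ, ℂ) ∞ f)
    (hg : ContMDiff (𝓡 d) 𝓘(ℝ, ℂ) ∞ g) : ContMDiff (𝓡 d) 𝓘(ℝ, ℂ) ∞ fun x => f x * g x :=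
  (contDiff_mul (𝕜 := ℝ) (𝔸 := ℂ)).contMDiff.comp (hf.prodMk_space hg)

theorem contMDiff_prod_complex {d : ℕ} {X : Type*} [TopologicalSpace X]
    [ChartedSpace (Model d) X] {p : ℕ} (f : Fin p → X → ℂ)
    (hf : ∀ i, ContMDiff (𝓡 d) 𝓘(ℝ, ℂ) ∞ (f i)) :
    ContMDiff (𝓡 d) 𝓘(ℝ, ℂ) ∞ fun x => ∏ i, f i x := by
  induction p with
  | zero => simpa using contMDiff_const
  | succ p ih =>
    simp only [Fin.prod_univ_succ]
    exact contMDiff_complex_mul (hf 0) (ih _ fun i => hf i.succ)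

variable (d : ℕ) (X : Type*) [TopologicalSpace X] [ChartedSpace (Model d) X]
  [IsManifold (𝓡 d) ∞ X]

/-- Smooth real vector fields on `X`. -/
abbrev VField : Type _ :=
  ContMDiffSection (𝓡 d) (Model d) ∞ (fun x : X => TangentSpace (𝓡 d) x)

/-- A smooth almost complex structure on `X`. -/
structure ACStructure where
  /-- the endomorphism of each tangent space -/
  toFun : ∀ x : X, TangentSpace (𝓡 d) x →L[ℝ] TangentSpace (𝓡 d) x
  sq_eq : ∀ (x : X) (v : TangentSpace (𝓡 d) x), toFun x (toFun x v) = -v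
  smooth : ContMDiff (𝓡 d) ((𝓡 d).prod 𝓘(ℝ, Model d →L[ℝ] Model d)) ∞
    (fun x => TotalSpace.mk' (Model d →L[ℝ] Model d)
      (E := fun x : X => TangentSpace (𝓡 d) x →L[ℝ] TangentSpace (𝓡 d) x) x (toFun x))

variable {d X}

/-- The endomorphism `J_x` of the tangent space at `x`. -/
def ACStructure.at (J : ACStructure d X) (x : X) :
    TangentSpace (𝓡 d) x →ₗ[ℝ] TangentSpace (𝓡 d) x := (J.toFun x : _ →ₗ[ℝ] _)

/-- The vector field `J ξ`. -/
def ACStructure.field (J : ACStructure d X) (ξ : VField d X) : VField d X where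
  toFun x := J.toFun x (ξ x)
  contMDiff_toFun := J.smooth.clm_bundle_apply ξ.contMDiff_toFun

variable (d X) in
/-- Not necessarily continuous complex `k`-forms on `X`. -/
abbrev RoughForm (k : ℕ) : Type _ := ∀ x : X, AltForm (TangentSpace (𝓡 d) x) k

/-- A `k`-form is smooth if all the functions `u (ξ₁, …, ξ_k)`, with `ξ₁, …, ξ_k` smooth vector
fields, are smooth. -/
def IsSmoothForm {k : ℕ} (u : RoughForm d X k) : Prop :=
  ∀ ξ : Fin k → VField d X, ContMDiff (𝓡 d) 𝓘(ℝ, ℂ) ∞ (fun x => u x fun j => ξ j x)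

/-- The support of a form. -/
def formSupport {k : ℕ} (u : RoughForm d X k) : Set X := closure {x | u x ≠ 0}

variable (d X) in
/-- The space `𝓓^k (X, ℂ)` of smooth compactly supported complex `k`-forms. -/
def TestForm (k : ℕ) : Submodule ℂ (RoughForm d X k) where
  carrier := {u | IsSmoothForm u ∧ IsCompact (formSupport u)}
  zero_mem' := by
    refine ⟨fun ξ => ?_, ?_⟩
    · simpa using contMDiff_const
    · simp [formSupport]
  add_mem' := by
    rintro u v ⟨hu, hu'⟩ ⟨hv, hv'⟩
    refine ⟨fun ξ => (hu ξ).add (hv ξ), ?_⟩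
    refine (hu'.union hv').of_isClosed_subset isClosed_closure ?_
    simp only [formSupport, ← closure_union]
    refine closure_mono fun x hx => ?_
    by_contra hcon
    simp only [Set.mem_union, Set.mem_ofPred_eq, not_or, not_not] at hcon
    exact hx (by simp [hcon.1, hcon.2])
  smul_mem' := by
    rintro c u ⟨hu, hu'⟩
    refine ⟨fun ξ => by simpa using contMDiff_complex_mul contMDiff_const (hu ξ), ?_⟩
    refine hu'.of_isClosed_subset isClosed_closure (closure_mono fun x hx => ?_)
    exact fun h0 => hx (by simp [h0])

variable (d X) in
/-- Smooth compactly supported complex functions. -/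
structure TestFun where
  /-- the underlying function -/
  toFun : X → ℂ
  smooth : ContMDiff (𝓡 d) 𝓘(ℝ, ℂ) ∞ toFun
  compact : HasCompactSupport toFun

/-- The test form `f u`, for a test function `f` and a smooth form `u`. -/
def TestFun.mulForm {k : ℕ} (f : TestFun d X) (u : RoughForm d X k) (hu : IsSmoothForm u) :
    TestForm d X k :=
  ⟨fun x => f.toFun x • u x, by
    refine ⟨fun ξ => by simpa using contMDiff_complex_mul f.smooth (hu ξ), ?_⟩
    refine f.compact.of_isClosed_subset isClosed_closure (closure_mono fun x hx => ?_)
    exact fun h0 => hx (by simp [h0])⟩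

/-- The test form `φ (ξ₁, …, ξ_m, ·)`, for a test form `φ` and smooth vector fields `ξ_j`. -/
def contractTest {m k N : ℕ} (h : m + k = N) (φ : TestForm d X N) (ξ : Fin m → VField d X) :
    TestForm d X k :=
  ⟨fun x => contractForm h (φ.1 x) fun j => ξ j x, by
    refine ⟨fun η => ?_, ?_⟩
    · convert! φ.2.1 (Fin.append ξ η ∘ Fin.cast h.symm) using 2 with x
      refine congrArg (φ.1 x) (funext fun a => ?_)
      subst h
      refine Fin.addCases (fun c => ?_) (fun c => ?_) a <;> simp
    · refine φ.2.2.of_isClosed_subset isClosed_closure (closure_mono fun x hx => ?_)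
      exact fun h0 => hx (by ext v; simp [contractForm, h0])⟩

/-- The form `g_p = g^p / p!`. -/
def powForm (g : RoughForm d X 2) (p : ℕ) : RoughForm d X (2 * p) := fun x => dividedPower (g x) p

theorem isSmoothForm_powForm {g : RoughForm d X 2} (hg : IsSmoothForm g) (p : ℕ) :
    IsSmoothForm (powForm g p) := by
  intro ξ
  simp only [powForm, dividedPower, AlternatingMap.smul_apply,
    MultilinearMap.alternatization_apply, smul_eq_mul]
  refine contMDiff_complex_mul contMDiff_const (contMDiff_finsetSum fun σ _ => ?_)
  simp only [Units.smul_def, zsmul_eq_mul]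
  refine contMDiff_complex_mul contMDiff_const (contMDiff_prod_complex _ fun i => ?_)
  convert! hg ![ξ (σ ⟨2 * i.val, by omega⟩), ξ (σ ⟨2 * i.val + 1, by omega⟩)] using 2 with x
  refine congrArg (g x) (funext fun a => ?_)
  fin_cases a <;> rfl

/-! ### Currents -/

/-- The coefficient of `dx_{i₁} ∧ … ∧ dx_{i_k}` of a form `u` in the chart at `x₀`, as a function
on the target of this chart. -/
def chartCoeff {k : ℕ} (x₀ : X) (u : RoughForm d X k) (i : Fin k → Fin d) (z : Model d) : ℂ :=
  u ((chartAt (Model d) x₀).symm z) fun j =>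
    mfderiv (𝓡 d) (𝓡 d) (chartAt (Model d) x₀).symm z (EuclideanSpace.single (i j) (1 : ℝ))

/-- The functional `T` satisfies, on the test forms supported in the compact set `K` of the domain
of the chart at `x₀`, an estimate by the supremum of the derivatives of order at most `m` of the
coefficients of the form. -/
def HasOrderLE {k : ℕ} (T : TestForm d X k →ₗ[ℂ] ℂ) (m : ℕ) (x₀ : X) (K : Set X) : Prop :=
  ∃ C : ℝ, ∀ u : TestForm d X k, formSupport u.1 ⊆ K → ∀ M : ℝ, 0 ≤ M →
    (∀ j ≤ m, ∀ i : Fin k → Fin d, ∀ z ∈ (chartAt (Model d) x₀).target,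
      ‖iteratedFDeriv ℝ j (chartCoeff x₀ u.1 i) z‖ ≤ M) →
    ‖T u‖ ≤ C * M

variable (d X) in
/-- Currents of dimension `k`: the continuous linear functionals on the space of smooth compactly
supported `k`-forms, for the topology of locally uniform convergence of all derivatives. -/
structure Current (k : ℕ) where
  /-- the underlying functional -/
  toFun : TestForm d X k →ₗ[ℂ] ℂ
  continuous : ∀ (x₀ : X) (K : Set X), IsCompact K → K ⊆ (chartAt (Model d) x₀).source →
    ∃ m : ℕ, HasOrderLE toFun m x₀ K

/-- The current has order zero. -/
def Current.IsOrderZero {k : ℕ} (Θ : Current d X k) : Prop :=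
  ∀ (x₀ : X) (K : Set X), IsCompact K → K ⊆ (chartAt (Model d) x₀).source →
    HasOrderLE Θ.toFun 0 x₀ K

/-- The current has bidimension `(p,p)`: it vanishes on the forms of the other types, so that it is
a functional on the space of test forms of type `(p,p)`. -/
def Current.HasBidimension (J : ACStructure d X) {p : ℕ} (Θ : Current d X (2 * p)) : Prop :=
  ∀ r s : ℕ, (r, s) ≠ (p, p) → ∀ u : TestForm d X (2 * p),
    (∀ x, u.1 x ∈ formsOfType (J.at x) r s (2 * p)) → Θ.toFun u = 0

/-- The current `Θ ∧ φ` of dimension zero, `⟨Θ ∧ φ, f⟩ = ⟨Θ, f φ⟩`, for a smooth form `φ`. -/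
def Current.wedge {k : ℕ} (Θ : Current d X k) (φ : RoughForm d X k) (hφ : IsSmoothForm φ)
    (f : TestFun d X) : ℂ := Θ.toFun (f.mulForm φ hφ)

/-- The current of degree zero `Θ (ξ₁, …, ξ_m)`, for a current `Θ` of degree `m` and dimension `k`,
`m + k = d`. It acts on the test forms `φ` of maximal degree by
`⟨Θ (ξ₁, …, ξ_m), φ⟩ = ⟨Θ, φ (ξ₁, …, ξ_m, ·)⟩`; this comes from the identity
`α (ξ₁, …, ξ_m) φ = α ∧ φ (ξ₁, …, ξ_m, ·)` for `m`-forms `α`. -/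
def Current.eval {m k : ℕ} (h : m + k = d) (Θ : Current d X k) (ξ : Fin m → VField d X)
    (φ : TestForm d X d) : ℂ := Θ.toFun (contractTest h φ ξ)

/-- The current of dimension zero `Θ (ξ₁, …, ξ_m) · ψ`, for a smooth form `ψ` of maximal degree. -/
def Current.evalMul {m k : ℕ} (h : m + k = d) (Θ : Current d X k) (ξ : Fin m → VField d X)
    (ψ : RoughForm d X d) (hψ : IsSmoothForm ψ) (f : TestFun d X) : ℂ :=
  Θ.eval h ξ (f.mulForm ψ hψ)

variable [MeasurableSpace X]

/-- The functional `L` on test functions is given by the complex Radon measure `h · ν`, where `ν` is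
a positive Radon measure and `h` is locally integrable. -/
def IsComplexRadon (L : TestFun d X → ℂ) (ν : Measure X) (h : X → ℂ) : Prop :=
  IsLocallyFiniteMeasure ν ∧ LocallyIntegrable h ν ∧
    ∀ f : TestFun d X, L f = ∫ x, f.toFun x * h x ∂ν

/-- The functional `L` on test functions is given by the positive Radon measure `μ`. -/
def IsPositiveRadon (L : TestFun d X → ℂ) (μ : Measure X) : Prop :=
  IsLocallyFiniteMeasure μ ∧ ∀ f : TestFun d X, L f = ∫ x, f.toFun x ∂μ

/-- A `J`-Hermitian metric on `X`, given by its fundamental form `g`: a smooth form of type `(1,1)`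
with `g (v, J v) > 0` for all tangent vectors `v ≠ 0` (this makes `g` real). -/
structure IsMetric (J : ACStructure d X) (g : RoughForm d X 2) : Prop where
  smooth : IsSmoothForm g
  type : ∀ x, g x ∈ formsOfType (J.at x) 1 1 2
  pos : ∀ (x : X) (v : TangentSpace (𝓡 d) x), v ≠ 0 → 0 < g x ![v, J.at x v]

/-- A volume form for the orientation given by `J`, in real dimension `2n`. -/
def IsVolumeForm {n : ℕ} {X : Type*} [TopologicalSpace X] [ChartedSpace (Model (2 * n)) X]
    [IsManifold (𝓡 (2 * n)) ∞ X] (J : ACStructure (2 * n) X) (ψ : RoughForm (2 * n) X (2 * n)) :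
    Prop :=
  IsSmoothForm ψ ∧ ∀ x, IsPositive (J.at x) (ψ x) ∧ ψ x ≠ 0

/-- The positive Radon measure `μ` is a mass of the current `Θ` (of order zero, degree `m` and
dimension `k`): for every volume form `ψ` and every relatively compact Borel set `A`, one has
`μ A = 0` if and only if `∫_A Θ (ξ₁, …, ξ_m) · ψ = 0` for all smooth vector fields `ξ_j`, where
`Θ (ξ₁, …, ξ_m) · ψ` is seen as a complex Radon measure. -/
def Current.IsMass {n m k : ℕ} {X : Type*} [TopologicalSpace X] [ChartedSpace (Model (2 * n)) X]
    [IsManifold (𝓡 (2 * n)) ∞ X] [MeasurableSpace X] (J : ACStructure (2 * n) X)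
    (h : m + k = 2 * n) (Θ : Current (2 * n) X k) (μ : Measure X) : Prop :=
  IsLocallyFiniteMeasure μ ∧
    ∀ (ψ : RoughForm (2 * n) X (2 * n)) (hψ : IsVolumeForm J ψ) (A : Set X),
      MeasurableSet A → IsCompact (closure A) →
      (μ A = 0 ↔ ∀ ξ : Fin m → VField (2 * n) X, ∃ (ν : Measure X) (c : X → ℂ),
        IsComplexRadon (Θ.evalMul h ξ ψ hψ.1) ν c ∧ ∫ x in A, c x ∂ν = 0)

/-- The `(q,q)`-form `θ`, with coefficients in `L¹_loc (μ)`, is (a representative of) the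
Radon–Nikodym density of the current `Θ` of bidegree `(q,q)` with respect to `μ` and the volume form
`ψ`: for all smooth vector fields `ξ_j`, `Θ (ξ₁, …, ξ_{2q}) · ψ = θ (ξ₁, …, ξ_{2q}) μ`. -/
def Current.IsDensity {q k : ℕ} (J : ACStructure d X) (h : 2 * q + k = d) (Θ : Current d X k)
    (μ : Measure X) (ψ : RoughForm d X d) (hψ : IsSmoothForm ψ) (θ : RoughForm d X (2 * q)) :
    Prop :=
  (∀ x, θ x ∈ formsOfType (J.at x) q q (2 * q)) ∧
    ∀ ξ : Fin (2 * q) → VField d X,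
      IsComplexRadon (Θ.evalMul h ξ ψ hψ) μ fun x => θ x fun j => ξ j x

theorem degree_add {n p : ℕ} (hp : p ≤ n) : 2 * (n - p) + 2 * p = 2 * n := by omega

end Manifold

end AlmostComplex

end

open AlmostComplex

noncomputable section

namespace AlmostComplex


/-! Everything rests on linear algebra at one point. Put q = n - p, fix a volume form ψ, and let β_ξ
= ψ(ξ₁, Jξ₁, …, ξ_q, Jξ_q, ·). In a unitary coframe adapted to ξ, the form β_ξ is a nonnegative
multiple of a single product iα₁∧ᾱ₁∧…∧iα_p∧ᾱ_p (`isStronglyPositive_contract`); conversely each such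
product is a nonnegative multiple of some β_ξ (`exists_contract_eq_wedge`). Thus the β_ξ generate
the cone of strongly positive (p,p)-forms, and by polarization they span all (p,p)-forms. Since
Θ(ξ₁, Jξ₁, …)·ψ = Θ∧β_ξ, condition (a) says that Θ∧β_ξ ≥ 0 for all fields ξ, while (c) asks the same
of every smooth strongly positive φ.

(a) ⇒ (c): the pointwise decomposition of φ into forms β_ξ need not depend smoothly on the point.
Near a given point choose smooth fields whose forms β_j span the (p,p)-forms, and consider φ +
ε∑β_j. Freezing at y the decomposition of φ(y) leaves an error which vanishes at y and is expanded
in the β_j with small real coefficients; near y these are absorbed by ε. So Θ∧(φ + ε∑β_j) ≥ 0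
locally, hence globally by a partition of unity, and ε → 0 gives Θ∧φ ≥ 0 (`wedge_nonneg_of_eval`). A
positive functional on test functions is a measure (`IsLinearTest.exists_measure`).

(c) ⇒ (a): β_ξ built from a positive top form φ is strongly positive, and testing with a cutoff
gives the inequality.

(c) ⇒ (b): by `exists_expansion` every (p,p)-form is a locally finite combination of countably many
β_a, and each Θ∧β_a is a positive measure; this gives order zero. A multiple of ω_p minus β_a is
strongly positive, so these measures are absolutely continuous with respect to μ = Θ∧ω_p, and every
Θ∧φ has a density (`exists_density_of_measure`). If all the integrals over A vanish, the densities
of the Θ∧β_a vanish almost everywhere on A, hence so does the density 1 of Θ∧ω_p, and μ A = 0.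
Positivity of θ(x) for almost every x is obtained by testing countably many fields and passing to
the limit.

(b) ⇒ (a): the mass property and a Radon–Nikodym argument give densities of the Θ∧β_a; the expansion
assembles them into a form θ, which is positive almost everywhere by (b) and whose integrals are the
values of Θ in (a). -/

section Algebra

variable {V : Type*} [AddCommGroup V] [Module ℝ V]

/-! ### Exterior products of 1-forms -/

/-- The bijection sending the two copies of `Fin p` to the even and to the odd indices. -/
def pairEquiv (p : ℕ) : Fin p ⊕ Fin p ≃ Fin (2 * p) where
  toFun := Sum.elim (fun i => ⟨2 * i.val, by omega⟩) fun i => ⟨2 * i.val + 1, by omega⟩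
  invFun a := if a.val % 2 = 0 then Sum.inl ⟨a.val / 2, by omega⟩ else Sum.inr ⟨a.val / 2, by omega⟩
  left_inv := by
    rintro (i | i)
    · simp
    · have : (2 * i.val + 1) / 2 = i.val := by omega
      simp [Nat.add_mod, this]
  right_inv := by
    intro a
    rcases Nat.mod_two_eq_zero_or_one a.val with h | h
    · simp only [h, if_true, Sum.elim_inl]
      exact Fin.ext (by simp only; omega)
    · simp only [h, one_ne_zero, if_false, Sum.elim_inr]
      exact Fin.ext (by simp only; omega)

@[simp] theorem interleave_pairEquiv_inl {A : Type*} {p : ℕ} (v w : Fin p → A) (i : Fin p) :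
    interleave v w (pairEquiv p (Sum.inl i)) = v i := by
  simp [interleave, pairEquiv]

@[simp] theorem interleave_pairEquiv_inr {A : Type*} {p : ℕ} (v w : Fin p → A) (i : Fin p) :
    interleave v w (pairEquiv p (Sum.inr i)) = w i := by
  have : (2 * i.val + 1) / 2 = i.val := by omega
  simp [interleave, pairEquiv, Nat.add_mod, this]

theorem funext_pairEquiv {A : Type*} {p : ℕ} {v w : Fin (2 * p) → A}
    (h1 : ∀ i, v (pairEquiv p (Sum.inl i)) = w (pairEquiv p (Sum.inl i)))
    (h2 : ∀ i, v (pairEquiv p (Sum.inr i)) = w (pairEquiv p (Sum.inr i))) : v = w := by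
  funext a
  obtain ⟨b, rfl⟩ := (pairEquiv p).surjective a
  rcases b with i | i
  · exact h1 i
  · exact h2 i

theorem comp_interleave {A B : Type*} {p : ℕ} (f : A → B) (v w : Fin p → A) :
    (fun a => f (interleave v w a)) = interleave (fun i => f (v i)) fun i => f (w i) :=
  funext_pairEquiv (by simp) (by simp)

theorem interleave_append {A : Type*} {q p n : ℕ} (h : q + p = n) (v v' : Fin q → A)
    (w w' : Fin p → A) :
    interleave (Fin.append v w ∘ Fin.cast h.symm) (Fin.append v' w' ∘ Fin.cast h.symm) =
      Fin.append (interleave v v') (interleave w w') ∘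
        Fin.cast (show 2 * n = 2 * q + 2 * p by omega) := by
  subst h
  funext a
  simp only [interleave, Function.comp_apply, Fin.append, Fin.addCases, Fin.cast_eq_self]
  by_cases ha : a.val / 2 < q
  · have ha' : a.val < 2 * q := by omega
    simp [ha, ha', Fin.castLT]
  · have ha' : ¬ a.val < 2 * q := by omega
    have h1 : (a.val - 2 * q) % 2 = a.val % 2 := by omega
    have h2 : (a.val - 2 * q) / 2 = a.val / 2 - q := by omega
    simp [ha, ha', h1, h2, Fin.subNat]

@[simp] theorem conjForm_apply (α : V →ₗ[ℝ] ℂ) (v : V) :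
    conjForm α v = (starRingEnd ℂ) (α v) := rfl

theorem wedgeOne_update_add {k : ℕ} (γ : Fin k → V →ₗ[ℝ] ℂ) (i : Fin k) (a b : V →ₗ[ℝ] ℂ) :
    wedgeOne (Function.update γ i (a + b)) =
      wedgeOne (Function.update γ i a) + wedgeOne (Function.update γ i b) := by
  ext v
  have key : ∀ c : V →ₗ[ℝ] ℂ, (Matrix.of fun l j => Function.update γ i c l (v j)) =
      (Matrix.of fun l j => γ l (v j)).updateRow i fun j => c (v j) := by
    intro c
    ext l j
    by_cases hl : l = i
    · subst hl; simp
    · simp [hl]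
  rw [AlternatingMap.add_apply, wedgeOne_apply, wedgeOne_apply, wedgeOne_apply, key, key, key,
    ← Matrix.det_updateRow_add]
  rfl

theorem wedgeOne_update_smul {k : ℕ} (γ : Fin k → V →ₗ[ℝ] ℂ) (i : Fin k) (c : ℂ)
    (a : V →ₗ[ℝ] ℂ) :
    wedgeOne (Function.update γ i (c • a)) = c • wedgeOne (Function.update γ i a) := by
  ext v
  have key : ∀ c : V →ₗ[ℝ] ℂ, (Matrix.of fun l j => Function.update γ i c l (v j)) =
      (Matrix.of fun l j => γ l (v j)).updateRow i fun j => c (v j) := by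
    intro c
    ext l j
    by_cases hl : l = i
    · subst hl; simp
    · simp [hl]
  rw [AlternatingMap.smul_apply, wedgeOne_apply, wedgeOne_apply, key, key, smul_eq_mul,
    ← Matrix.det_updateRow_smul]
  rfl

variable (V) in
/-- The exterior product of 1-forms as a multilinear map. -/
def wedgeMap (k : ℕ) : MultilinearMap ℂ (fun _ : Fin k => V →ₗ[ℝ] ℂ) (AltForm V k) where
  toFun γ := wedgeOne γ
  map_update_add' := by
    intro inst γ i a b
    convert wedgeOne_update_add γ i a b
  map_update_smul' := by
    intro inst γ i c a
    convert wedgeOne_update_smul γ i c a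

theorem wedgeOne_perm {k : ℕ} (γ : Fin k → V →ₗ[ℝ] ℂ) (σ : Equiv.Perm (Fin k)) :
    wedgeOne (γ ∘ σ) = ((Equiv.Perm.sign σ : ℤ) : ℂ) • wedgeOne γ := by
  ext v
  rw [AlternatingMap.smul_apply, wedgeOne_apply, wedgeOne_apply, smul_eq_mul,
    ← Matrix.det_permute]
  rfl

theorem wedgeOne_linearComb {k : ℕ} (A : Matrix (Fin k) (Fin k) ℂ) (γ : Fin k → V →ₗ[ℝ] ℂ) :
    wedgeOne (fun i => ∑ j, A i j • γ j) = A.det • wedgeOne γ := by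
  ext v
  rw [AlternatingMap.smul_apply, wedgeOne_apply, wedgeOne_apply, smul_eq_mul, ← Matrix.det_mul]
  congr 1
  ext i j
  simp [Matrix.mul_apply]

theorem conjForm_sum_smul {ι : Type*} (s : Finset ι) (c : ι → ℂ) (γ : ι → V →ₗ[ℝ] ℂ) :
    conjForm (∑ j ∈ s, c j • γ j) = ∑ j ∈ s, (starRingEnd ℂ) (c j) • conjForm (γ j) := by
  ext v
  simp [LinearMap.sum_apply]

/-- Once the 1-forms and their conjugates are separated, the change of coframe has the block
diagonal matrix diag(A, Ā), of determinant |det A|². This nonnegativity makes the strongly positive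
cone insensitive to the choice of coframe. -/
theorem wedgeOne_interleave_linearComb {p : ℕ} (A : Matrix (Fin p) (Fin p) ℂ)
    (α : Fin p → V →ₗ[ℝ] ℂ) :
    wedgeOne (interleave (fun i => ∑ j, A i j • α j) fun i => conjForm (∑ j, A i j • α j)) =
      ((Complex.normSq A.det : ℝ) : ℂ) • wedgeOne (interleave α fun i => conjForm (α i)) := by
  set M : Matrix (Fin (2 * p)) (Fin (2 * p)) ℂ :=
    (Matrix.fromBlocks A 0 0 (A.map (starRingEnd ℂ))).submatrix (pairEquiv p).symm
      (pairEquiv p).symm with hM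
  have hdet : M.det = ((Complex.normSq A.det : ℝ) : ℂ) := by
    rw [hM, Matrix.det_submatrix_equiv_self, Matrix.det_fromBlocks_zero₂₁, Complex.normSq_eq_conj_mul_self,
      mul_comm, ← RingHom.mapMatrix_apply, RingHom.map_det]
  rw [← hdet, ← wedgeOne_linearComb]
  congr 1
  refine funext_pairEquiv (fun i => ?_) fun i => ?_
  · rw [← (pairEquiv p).sum_comp]
    simp [hM]
  · rw [← (pairEquiv p).sum_comp]
    simp [hM, conjForm_sum_smul]

/-- This is the matrix of values of (α, ᾱ) on (ξ, Jξ). It factors as diag(A, Ā) times a constant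
block matrix with rows (1, i) and (1, -i), of determinant (-2i)^p. -/
theorem det_pair_blocks {p : ℕ} (A : Matrix (Fin p) (Fin p) ℂ) :
    (Matrix.fromBlocks A (Complex.I • A) (A.map (starRingEnd ℂ))
      (-Complex.I • A.map (starRingEnd ℂ))).det =
      (-2 * Complex.I) ^ p * ((Complex.normSq A.det : ℝ) : ℂ) := by
  have h : Matrix.fromBlocks A (Complex.I • A) (A.map (starRingEnd ℂ))
      (-Complex.I • A.map (starRingEnd ℂ)) =
      Matrix.fromBlocks A 0 0 (A.map (starRingEnd ℂ)) *
        Matrix.fromBlocks 1 (Complex.I • 1) 1 (-Complex.I • 1) := by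
    simp [Matrix.fromBlocks_multiply]
  rw [h, Matrix.det_mul, Matrix.det_fromBlocks_zero₂₁, Matrix.det_fromBlocks_one₁₁, one_mul,
    ← sub_smul, Matrix.det_smul, Matrix.det_one, Complex.normSq_eq_conj_mul_self,
    ← RingHom.mapMatrix_apply, ← RingHom.map_det, Fintype.card_fin]
  ring

theorem wedgeOne_interleave_apply (J : V →ₗ[ℝ] V) {p : ℕ} (α : Fin p → V →ₗ[ℝ] ℂ)
    (hα : ∀ i, IsType10 J (α i)) (ξ : Fin p → V) :
    wedgeOne (interleave α fun i => conjForm (α i)) (interleave ξ fun i => J (ξ i)) =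
      (-2 * Complex.I) ^ p *
        ((Complex.normSq (Matrix.of fun i j => α i (ξ j)).det : ℝ) : ℂ) := by
  rw [wedgeOne_apply, ← det_pair_blocks, ← Matrix.det_submatrix_equiv_self (pairEquiv p)]
  congr 1
  ext (i | i) (j | j)
  · simp
  · simp [hα i (ξ j)]
  · simp
  · simp [hα i (ξ j)]

/-- Since the forms `γ'` vanish on `w`, the matrix of values is block upper triangular and its
determinant splits. -/
theorem wedgeOne_contract {m k N : ℕ} (h : m + k = N) (γ : Fin m → V →ₗ[ℝ] ℂ)
    (γ' : Fin k → V →ₗ[ℝ] ℂ) (w : Fin m → V) (hw : ∀ i j, γ' i (w j) = 0) :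
    contractForm h (wedgeOne (Fin.append γ γ' ∘ Fin.cast h.symm)) w =
      wedgeOne γ w • wedgeOne γ' := by
  subst h
  ext v
  change wedgeOne (Fin.append γ γ') (Fin.append w v) = wedgeOne γ w * wedgeOne γ' v
  rw [wedgeOne_apply, wedgeOne_apply, wedgeOne_apply, ← Matrix.det_submatrix_equiv_self finSumFinEquiv,
    ← Matrix.det_fromBlocks_zero₂₁ _ (Matrix.of fun i j => γ i (v j)) _]
  congr 1
  ext (i | i) (j | j) <;> simp [hw]

end Algebra


section Hermitian

variable {V : Type*} [AddCommGroup V] [Module ℝ V]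

/-! ### Hermitian forms and unitary frames -/

/-- The form `g` is the fundamental form of a Hermitian metric on `(V, J)`. -/
structure IsHermForm (J : V →ₗ[ℝ] V) (g : AltForm V 2) : Prop where
  sq : ∀ v, J (J v) = -v
  type : g ∈ formsOfType J 1 1 2
  pos : ∀ v, v ≠ 0 → 0 < g ![v, J v]

theorem altForm_two_swap (g : AltForm V 2) (u v : V) : g ![u, v] = -g ![v, u] := by
  have := g.map_swap ![v, u] (i := 0) (j := 1) (by simp)
  rw [← this]
  congr 1
  ext i
  fin_cases i <;> simp

theorem altForm_two_add_left (g : AltForm V 2) (u u' v : V) :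
    g ![u + u', v] = g ![u, v] + g ![u', v] := g.map_vecCons_add _ _ _

theorem altForm_two_smul_left (g : AltForm V 2) (c : ℝ) (u v : V) :
    g ![c • u, v] = c * g ![u, v] := by
  rw [g.map_vecCons_smul, Complex.real_smul]

theorem altForm_two_add_right (g : AltForm V 2) (u v v' : V) :
    g ![u, v + v'] = g ![u, v] + g ![u, v'] := by
  rw [altForm_two_swap, altForm_two_add_left, altForm_two_swap g v, altForm_two_swap g v']
  ring

theorem altForm_two_smul_right (g : AltForm V 2) (c : ℝ) (u v : V) :
    g ![u, c • v] = c * g ![u, v] := by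
  rw [altForm_two_swap, altForm_two_smul_left, altForm_two_swap g v]
  ring

theorem altForm_two_neg_left (g : AltForm V 2) (u v : V) : g ![-u, v] = -g ![u, v] := by
  have := altForm_two_smul_left g (-1) u v
  simpa using this

theorem altForm_two_neg_right (g : AltForm V 2) (u v : V) : g ![u, -v] = -g ![u, v] := by
  have := altForm_two_smul_right g (-1) u v
  simpa using this

theorem altForm_two_self (g : AltForm V 2) (u : V) : g ![u, u] = 0 :=
  g.map_eq_zero_of_eq _ (i := 0) (j := 1) (by simp) (by simp)

variable {J : V →ₗ[ℝ] V} {g : AltForm V 2}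

theorem conjForm_J {α : V →ₗ[ℝ] ℂ} (hα : IsType10 J α) (v : V) :
    conjForm α (J v) = -Complex.I * conjForm α v := by
  simp [hα v]

namespace IsHermForm

theorem map_J (hg : IsHermForm J g) (u v : V) : g ![J u, J v] = g ![u, v] := by
  have h := hg.type
  clear hg
  induction h using Submodule.span_induction with
  | mem x hx =>
    obtain ⟨-, α, hα, rfl⟩ := hx
    rw [wedgeOne_apply, wedgeOne_apply, Matrix.det_fin_two, Matrix.det_fin_two]
    simp only [Matrix.of_apply, Fin.val_zero, Fin.val_one, Matrix.cons_val_zero,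
      Matrix.cons_val_one, zero_lt_one, lt_self_iff_false, if_true, if_false, hα _ _,
      conjForm_J (hα 1)]
    linear_combination (-(α 0 u * conjForm (α 1) v - α 0 v * conjForm (α 1) u)) * Complex.I_mul_I
  | zero => simp
  | add x y _ _ hx hy => simp [hx, hy]
  | smul c x _ hx => simp [hx]

theorem map_J_swap (hg : IsHermForm J g) (u v : V) : g ![u, J v] = g ![v, J u] := by
  rw [← hg.map_J u (J v), hg.sq, altForm_two_neg_right, altForm_two_swap, neg_neg]

theorem nonneg (hg : IsHermForm J g) (v : V) : 0 ≤ g ![v, J v] := by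
  by_cases h : v = 0
  · subst h
    rw [map_zero, altForm_two_self]
  · exact (hg.pos v h).le

/-- Polarization: g(v, Jv) is real by positivity, and g(u, Jv) is symmetric in u and v, so expanding
at u + v isolates twice its imaginary part. -/
theorem im_J (hg : IsHermForm J g) (u v : V) : (g ![u, J v]).im = 0 := by
  have h1 := (Complex.le_def.1 (hg.nonneg (u + v))).2
  have h2 := (Complex.le_def.1 (hg.nonneg u)).2
  have h3 := (Complex.le_def.1 (hg.nonneg v)).2
  rw [map_add, altForm_two_add_left, altForm_two_add_right, altForm_two_add_right,
    hg.map_J_swap v u] at h1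
  simp only [Complex.zero_im, Complex.add_im] at h1 h2 h3
  linarith

theorem im (hg : IsHermForm J g) (u v : V) : (g ![u, v]).im = 0 := by
  have := hg.im_J u (J v)
  rw [hg.sq, altForm_two_neg_right, Complex.neg_im] at this
  linarith

theorem conj (hg : IsHermForm J g) (u v : V) : (starRingEnd ℂ) (g ![u, v]) = g ![u, v] :=
  Complex.conj_eq_iff_im.2 (hg.im u v)

end IsHermForm

/-- The Hermitian product with fundamental form `g`. -/
def hermProd (J : V →ₗ[ℝ] V) (g : AltForm V 2) (u v : V) : ℂ := g ![u, J v] + Complex.I * g ![u, v]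

/-- The frame `e`, with dual coframe `α`, is unitary. -/
structure IsUnitaryFrame (J : V →ₗ[ℝ] V) (g : AltForm V 2) {n : ℕ} (e : Fin n → V)
    (α : Fin n → V →ₗ[ℝ] ℂ) : Prop where
  type : ∀ i, IsType10 J (α i)
  dual : ∀ i j, α i (e j) = if i = j then 1 else 0
  repr : ∀ v, v = ∑ i, ((α i v).re • e i + (α i v).im • J (e i))
  herm : ∀ u v, hermProd J g u v = ∑ i, (starRingEnd ℂ) (α i u) * α i v

/-- The structure of complex vector space given by `J`. -/
@[reducible] def complexModule (J : V →ₗ[ℝ] V) (hJ : ∀ v, J (J v) = -v) : Module ℂ V where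
  smul c v := c.re • v + c.im • J v
  one_smul v := by
    change (1 : ℂ).re • v + (1 : ℂ).im • J v = v
    simp
  mul_smul a b v := by
    change (a * b).re • v + (a * b).im • J v =
      a.re • (b.re • v + b.im • J v) + a.im • J (b.re • v + b.im • J v)
    simp only [Complex.mul_re, Complex.mul_im, map_add, map_smul, hJ]
    module
  smul_zero a := by
    change a.re • (0 : V) + a.im • J 0 = 0
    simp
  smul_add a u v := by
    change a.re • (u + v) + a.im • J (u + v) = (a.re • u + a.im • J u) + (a.re • v + a.im • J v)
    rw [map_add]
    module
  add_smul a b v := by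
    change (a + b).re • v + (a + b).im • J v = (a.re • v + a.im • J v) + (b.re • v + b.im • J v)
    rw [Complex.add_re, Complex.add_im]
    module
  zero_smul v := by
    change (0 : ℂ).re • v + (0 : ℂ).im • J v = 0
    simp

/-- `hermProd` makes V a complex inner product space of complex dimension n, and the frame comes
from Gram–Schmidt applied to `f`. The triangularity in the conclusion is what later adapts a frame
to a prescribed family of vectors. -/
theorem exists_unitaryFrame (hg : IsHermForm J g) [FiniteDimensional ℝ V] {n : ℕ}
    (hn : Module.finrank ℝ V = 2 * n) (f : Fin n → V) :
    ∃ (e : Fin n → V) (α : Fin n → V →ₗ[ℝ] ℂ), IsUnitaryFrame J g e α ∧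
      ∀ i j, j < i → α i (f j) = 0 := by
  let mC : Module ℂ V := complexModule J hg.sq
  have hsmul : ∀ (c : ℂ) (v : V), c • v = c.re • v + c.im • J v := fun _ _ => rfl
  have : IsScalarTower ℝ ℂ V := ⟨fun r c v => by simp [hsmul, smul_add, smul_smul]⟩
  let core : InnerProductSpace.Core ℂ V :=
    { inner := hermProd J g
      conj_inner_symm := fun x y => by
        rw [hermProd, hermProd, map_add, map_mul, Complex.conj_I, hg.conj, hg.conj, hg.map_J_swap y x,
          altForm_two_swap g y x]
        ring
      re_inner_nonneg := fun x => by
        have h := (Complex.le_def.1 (hg.nonneg x)).1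
        simpa [hermProd, altForm_two_self] using h
      add_left := fun x y z => by
        simp only [hermProd, altForm_two_add_left]
        ring
      smul_left := fun x y r => by
        have h : g ![J x, J y] = g ![x, y] := hg.map_J x y
        have h' : g ![J x, y] = -g ![x, J y] := by
          rw [← hg.map_J, hg.sq, altForm_two_neg_left]
        simp only [hermProd, hsmul, altForm_two_add_left, altForm_two_smul_left, h, h']
        have hr : (starRingEnd ℂ) r = r.re - r.im * Complex.I := by apply Complex.ext <;> simp
        rw [hr]
        linear_combination (r.im * g ![x, y]) * Complex.I_mul_I
      definite := fun x hx => by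
        by_contra h
        have h1 := hg.pos x h
        simp only [hermProd, altForm_two_self, mul_zero, add_zero] at hx
        exact h1.ne' hx }
  let : NormedAddCommGroup V := core.toNormedAddCommGroup
  let : InnerProductSpace ℂ V := InnerProductSpace.ofCore core.toCore
  have hinner : ∀ u v : V, inner ℂ u v = hermProd J g u v := fun _ _ => rfl
  have : FiniteDimensional ℂ V := Module.Finite.of_restrictScalars_finite ℝ ℂ V
  have hfin : Module.finrank ℂ V = Fintype.card (Fin n) := by
    have := Module.finrank_mul_finrank ℝ ℂ V
    rw [hn, Complex.finrank_real_complex] at this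
    rw [Fintype.card_fin]
    omega
  let b := InnerProductSpace.gramSchmidtOrthonormalBasis hfin f
  have hJ : ∀ v : V, J v = Complex.I • v := fun v => by simp [hsmul]
  have hr : ∀ (c : ℝ) (v : V), c • v = (c : ℂ) • v := fun c v => by simp [hsmul]
  let α : Fin n → V →ₗ[ℝ] ℂ := fun i =>
    { toFun := fun v => inner ℂ (b i) v
      map_add' := fun u v => inner_add_right _ _ _
      map_smul' := fun c v => by
        rw [hr, inner_smul_right]
        simp }
  have hα : ∀ i v, α i v = inner ℂ (b i) v := fun _ _ => rfl
  refine ⟨b, α, ⟨fun i v => ?_, fun i j => ?_, fun v => ?_, fun u v => ?_⟩, fun i j hij => ?_⟩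
  · rw [hα, hα, hJ, inner_smul_right]
  · rw [hα]
    exact orthonormal_iff_ite.1 b.orthonormal i j
  · conv_lhs => rw [← b.sum_repr' v]
    exact Finset.sum_congr rfl fun i _ => hsmul _ _
  · rw [← hinner, ← b.sum_inner_mul_inner]
    refine Finset.sum_congr rfl fun i _ => ?_
    rw [hα, hα, inner_conj_symm]
  · exact InnerProductSpace.gramSchmidtOrthonormalBasis_inv_triangular hfin f hij

end Hermitian


section StronglyPositive

variable {V : Type*} [AddCommGroup V] [Module ℝ V] {J : V →ₗ[ℝ] V} {g : AltForm V 2}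

theorem altForm_sum_apply {k : ℕ} {ι : Type*} (s : Finset ι) (u : ι → AltForm V k)
    (v : Fin k → V) : (∑ i ∈ s, u i) v = ∑ i ∈ s, u i v := by
  classical
  induction s using Finset.induction_on with
  | empty => simp
  | insert a s ha ih => rw [Finset.sum_insert ha, Finset.sum_insert ha, AlternatingMap.add_apply, ih]

/-! ### Strongly positive forms -/

namespace IsStronglyPositive

theorem zero {q : ℕ} : IsStronglyPositive J (0 : AltForm V (2 * q)) :=
  ⟨0, fun _ => 0, fun t => t.elim0, fun t => t.elim0, fun t => t.elim0, by simp⟩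

theorem add {q : ℕ} {u v : AltForm V (2 * q)} (hu : IsStronglyPositive J u)
    (hv : IsStronglyPositive J v) : IsStronglyPositive J (u + v) := by
  obtain ⟨N, c, α, hc, hα, rfl⟩ := hu
  obtain ⟨M, d, β, hd, hβ, rfl⟩ := hv
  refine ⟨N + M, Fin.append c d, Fin.append α β, fun t => ?_, fun t j => ?_, ?_⟩
  · refine Fin.addCases (fun i => ?_) (fun i => ?_) t
    · simpa using hc i
    · simpa using hd i
  · refine Fin.addCases (fun i => ?_) (fun i => ?_) t
    · simpa using hα i j
    · simpa using hβ i j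
  · simp [Fin.sum_univ_add]

theorem smul {q : ℕ} {u : AltForm V (2 * q)} (hu : IsStronglyPositive J u) {r : ℝ} (hr : 0 ≤ r) :
    IsStronglyPositive J ((r : ℂ) • u) := by
  obtain ⟨N, c, α, hc, hα, rfl⟩ := hu
  refine ⟨N, fun t => r * c t, α, fun t => mul_nonneg hr (hc t), hα, ?_⟩
  rw [Finset.smul_sum]
  refine Finset.sum_congr rfl fun t _ => ?_
  rw [smul_smul]
  push_cast
  ring_nf

theorem sum {q : ℕ} {ι : Type*} (s : Finset ι) {u : ι → AltForm V (2 * q)}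
    (hu : ∀ i ∈ s, IsStronglyPositive J (u i)) : IsStronglyPositive J (∑ i ∈ s, u i) := by
  classical
  induction s using Finset.induction_on with
  | empty => simpa using zero
  | insert a s ha ih =>
    rw [Finset.sum_insert ha]
    exact (hu a (Finset.mem_insert_self a s)).add
      (ih fun i hi => hu i (Finset.mem_insert_of_mem hi))

theorem of_wedge {q : ℕ} {r : ℝ} (hr : 0 ≤ r) {α : Fin q → V →ₗ[ℝ] ℂ}
    (hα : ∀ i, IsType10 J (α i)) :
    IsStronglyPositive J (((r : ℂ) * Complex.I ^ q) •
      wedgeOne (interleave α fun j => conjForm (α j))) :=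
  ⟨1, fun _ => r, fun _ => α, fun _ => hr, fun _ => hα, by simp⟩

theorem apply_nonneg {q : ℕ} {u : AltForm V (2 * q)} (hu : IsStronglyPositive J u)
    (ξ : Fin q → V) : 0 ≤ u (interleave ξ fun i => J (ξ i)) := by
  obtain ⟨N, c, α, hc, hα, rfl⟩ := hu
  rw [altForm_sum_apply]
  refine Finset.sum_nonneg fun t _ => ?_
  rw [AlternatingMap.smul_apply, wedgeOne_interleave_apply J _ (hα t), smul_eq_mul]
  have h : (c t : ℂ) * Complex.I ^ q * ((-2 * Complex.I) ^ q *
      ((Complex.normSq (Matrix.of fun i j => α t i (ξ j)).det : ℝ) : ℂ)) =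
      ((c t * 2 ^ q * Complex.normSq (Matrix.of fun i j => α t i (ξ j)).det : ℝ) : ℂ) := by
    have : Complex.I ^ q * (-2 * Complex.I) ^ q = 2 ^ q := by
      rw [← mul_pow]
      congr 1
      linear_combination -2 * Complex.I_mul_I
    push_cast
    linear_combination ((c t : ℂ) *
      ((Complex.normSq (Matrix.of fun i j => α t i (ξ j)).det : ℝ) : ℂ)) * this
  rw [h]
  exact_mod_cast mul_nonneg (mul_nonneg (hc t) (by positivity)) (Complex.normSq_nonneg _)

end IsStronglyPositive

/-! ### Divided powers of a Hermitian form -/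

/-- Composing σ with the transposition of the two arguments of factor `j` reverses the sign and
exchanges the two halves of the antisymmetrized factor, so both halves contribute equally. -/
theorem sum_sign_prod_antisymm {A : Type*} {p : ℕ} (F : Fin p → A → A → ℂ) (j : Fin p)
    (v : Fin (2 * p) → A) :
    ∑ σ : Equiv.Perm (Fin (2 * p)), ((Equiv.Perm.sign σ : ℤ) : ℂ) *
        ∏ i, Function.update F j (fun x y => F j x y - F j y x) i
          (v (σ (pairEquiv p (Sum.inl i)))) (v (σ (pairEquiv p (Sum.inr i)))) =
      2 * ∑ σ : Equiv.Perm (Fin (2 * p)), ((Equiv.Perm.sign σ : ℤ) : ℂ) *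
        ∏ i, F i (v (σ (pairEquiv p (Sum.inl i)))) (v (σ (pairEquiv p (Sum.inr i)))) := by
  set τ : Equiv.Perm (Fin (2 * p)) :=
    Equiv.swap (pairEquiv p (Sum.inl j)) (pairEquiv p (Sum.inr j)) with hτ
  have hne : pairEquiv p (Sum.inl j) ≠ pairEquiv p (Sum.inr j) :=
    fun h => Sum.inl_ne_inr ((pairEquiv p).injective h)
  have key : ∀ σ : Equiv.Perm (Fin (2 * p)),
      ∏ i, Function.update F j (fun x y => F j x y - F j y x) i
          (v (σ (pairEquiv p (Sum.inl i)))) (v (σ (pairEquiv p (Sum.inr i)))) =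
      (∏ i, F i (v (σ (pairEquiv p (Sum.inl i)))) (v (σ (pairEquiv p (Sum.inr i))))) -
      ∏ i, F i (v ((σ * τ) (pairEquiv p (Sum.inl i)))) (v ((σ * τ) (pairEquiv p (Sum.inr i)))) := by
    intro σ
    rw [← Finset.mul_prod_erase _ _ (Finset.mem_univ j),
      ← Finset.mul_prod_erase _ _ (Finset.mem_univ j),
      ← Finset.mul_prod_erase _ _ (Finset.mem_univ j)]
    have h1 : ∏ i ∈ Finset.univ.erase j, Function.update F j (fun x y => F j x y - F j y x) i
          (v (σ (pairEquiv p (Sum.inl i)))) (v (σ (pairEquiv p (Sum.inr i)))) =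
        ∏ i ∈ Finset.univ.erase j,
          F i (v (σ (pairEquiv p (Sum.inl i)))) (v (σ (pairEquiv p (Sum.inr i)))) :=
      Finset.prod_congr rfl fun i hi => by
        rw [Function.update_of_ne (Finset.ne_of_mem_erase hi)]
    have h2 : ∏ i ∈ Finset.univ.erase j,
        F i (v ((σ * τ) (pairEquiv p (Sum.inl i)))) (v ((σ * τ) (pairEquiv p (Sum.inr i)))) =
        ∏ i ∈ Finset.univ.erase j,
          F i (v (σ (pairEquiv p (Sum.inl i)))) (v (σ (pairEquiv p (Sum.inr i)))) :=
      Finset.prod_congr rfl fun i hi => by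
        have hij := Finset.ne_of_mem_erase hi
        rw [Equiv.Perm.mul_apply, Equiv.Perm.mul_apply, hτ, Equiv.swap_apply_of_ne_of_ne,
          Equiv.swap_apply_of_ne_of_ne] <;>
        · intro h
          have := (pairEquiv p).injective h
          simp_all
    rw [h1, h2, Function.update_self, Equiv.Perm.mul_apply, Equiv.Perm.mul_apply, hτ,
      Equiv.swap_apply_left, Equiv.swap_apply_right, sub_mul]
  simp_rw [key, mul_sub, Finset.sum_sub_distrib]
  suffices hneg : ∑ σ : Equiv.Perm (Fin (2 * p)), ((Equiv.Perm.sign σ : ℤ) : ℂ) *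
        ∏ i, F i (v ((σ * τ) (pairEquiv p (Sum.inl i)))) (v ((σ * τ) (pairEquiv p (Sum.inr i)))) =
      -∑ σ : Equiv.Perm (Fin (2 * p)), ((Equiv.Perm.sign σ : ℤ) : ℂ) *
        ∏ i, F i (v (σ (pairEquiv p (Sum.inl i)))) (v (σ (pairEquiv p (Sum.inr i)))) by
    rw [hneg]
    ring
  rw [← Equiv.sum_comp (Equiv.mulRight τ), ← Finset.sum_neg_distrib]
  refine Finset.sum_congr rfl fun σ _ => ?_
  have hs : Equiv.Perm.sign (σ * τ) = -Equiv.Perm.sign σ := by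
    rw [Equiv.Perm.sign_mul, hτ, Equiv.Perm.sign_swap hne, mul_neg_one]
  have h3 : (σ * τ * τ) = σ := by
    rw [mul_assoc, hτ, Equiv.swap_mul_self, mul_one]
  simp only [Equiv.coe_mulRight, hs, h3]
  push_cast
  ring

/-- The factors are antisymmetrized one at a time, each costing a factor 2; the set `T` records
those already treated. For empty `T` the sum is the Leibniz expansion of the determinant. -/
theorem sum_sign_prod_wedge {p : ℕ} (a : Fin p → V →ₗ[ℝ] ℂ) (v : Fin (2 * p) → V) :
    ∑ σ : Equiv.Perm (Fin (2 * p)), ((Equiv.Perm.sign σ : ℤ) : ℂ) *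
        ∏ i, (a i (v (σ (pairEquiv p (Sum.inl i)))) *
          conjForm (a i) (v (σ (pairEquiv p (Sum.inr i)))) -
          a i (v (σ (pairEquiv p (Sum.inr i)))) *
          conjForm (a i) (v (σ (pairEquiv p (Sum.inl i))))) =
      2 ^ p * wedgeOne (interleave a fun i => conjForm (a i)) v := by
  let F : Finset (Fin p) → Fin p → V → V → ℂ := fun T i x y =>
    if i ∈ T then a i x * conjForm (a i) y - a i y * conjForm (a i) x
      else a i x * conjForm (a i) y
  have main : ∀ T : Finset (Fin p),
      ∑ σ : Equiv.Perm (Fin (2 * p)), ((Equiv.Perm.sign σ : ℤ) : ℂ) *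
        ∏ i, F T i (v (σ (pairEquiv p (Sum.inl i)))) (v (σ (pairEquiv p (Sum.inr i)))) =
      2 ^ T.card * wedgeOne (interleave a fun i => conjForm (a i)) v := by
    intro T
    induction T using Finset.induction_on with
    | empty =>
      rw [wedgeOne_apply, Finset.card_empty, pow_zero, one_mul, ← Matrix.det_transpose,
        Matrix.det_apply']
      refine Finset.sum_congr rfl fun σ _ => ?_
      rw [← (pairEquiv p).prod_comp, Fintype.prod_sum_type]
      simp [F, Finset.prod_mul_distrib]
    | insert j T hj ih =>
      rw [Finset.card_insert_of_notMem hj, pow_succ', mul_assoc, ← ih, ← sum_sign_prod_antisymm (F T) j v]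
      refine Finset.sum_congr rfl fun σ _ => ?_
      congr 1
      refine Finset.prod_congr rfl fun i _ => ?_
      by_cases hij : i = j
      · subst hij
        simp [F, hj]
      · simp [F, Finset.mem_insert, hij]
  have := main Finset.univ
  simpa [F] using this

namespace IsUnitaryFrame

variable {n : ℕ} {e : Fin n → V} {α : Fin n → V →ₗ[ℝ] ℂ}

/-- As g is real, it is the imaginary part of the Hermitian product, which the coframe diagonalizes.
-/
theorem form_apply (hg : IsHermForm J g) (h : IsUnitaryFrame J g e α) (u v : V) :
    g ![u, v] = ∑ k, (Complex.I / 2) * (α k u * conjForm (α k) v - α k v * conjForm (α k) u) := by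
  have h1 := h.herm u v
  have h2 : (starRingEnd ℂ) (hermProd J g u v) = ∑ k, α k u * (starRingEnd ℂ) (α k v) := by
    rw [h1, map_sum]
    refine Finset.sum_congr rfl fun k _ => ?_
    rw [map_mul, Complex.conj_conj]
  rw [hermProd, map_add, map_mul, Complex.conj_I, hg.conj, hg.conj] at h2
  rw [hermProd] at h1
  simp only [mul_sub, Finset.sum_sub_distrib, ← Finset.mul_sum, conjForm_apply]
  rw [← h2]
  have h3 : ∑ k, α k v * (starRingEnd ℂ) (α k u) = g ![u, J v] + Complex.I * g ![u, v] := by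
    rw [h1]
    exact Finset.sum_congr rfl fun k _ => mul_comm _ _
  rw [h3]
  linear_combination g ![u, v] * Complex.I_mul_I

/-- Expanding g = ∑ (i/2) α_k∧ᾱ_k inside the product of p factors gives one term per map `s`.
Summing over all maps rather than over increasing ones is why 1/p! remains. -/
theorem dividedPower_eq (hg : IsHermForm J g) (h : IsUnitaryFrame J g e α) (p : ℕ) :
    dividedPower g p = ∑ s : Fin p → Fin n,
      (((1 / (p.factorial * 2 ^ p) : ℝ) : ℂ) * Complex.I ^ p) •
        wedgeOne (interleave (fun i => α (s i)) fun i => conjForm (α (s i))) := by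
  ext v
  rw [dividedPower, AlternatingMap.smul_apply, MultilinearMap.alternatization_apply,
    altForm_sum_apply]
  have key : ∀ σ : Equiv.Perm (Fin (2 * p)), (pairProd g p).domDomCongr σ v =
      ∑ s : Fin p → Fin n, (Complex.I / 2) ^ p *
        ∏ i, (α (s i) (v (σ (pairEquiv p (Sum.inl i)))) *
          conjForm (α (s i)) (v (σ (pairEquiv p (Sum.inr i)))) -
          α (s i) (v (σ (pairEquiv p (Sum.inr i)))) *
          conjForm (α (s i)) (v (σ (pairEquiv p (Sum.inl i))))) := by
    intro σ
    change ∏ i : Fin p, g ![v (σ (pairEquiv p (Sum.inl i))), v (σ (pairEquiv p (Sum.inr i)))] = _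
    simp_rw [h.form_apply hg, Finset.prod_univ_sum, Fintype.piFinset_univ, Finset.prod_mul_distrib]
    simp [div_pow]
  simp_rw [key, Units.smul_def, zsmul_eq_mul, Finset.mul_sum]
  rw [Finset.sum_comm, Finset.smul_sum]
  refine Finset.sum_congr rfl fun s _ => ?_
  rw [AlternatingMap.smul_apply, smul_eq_mul, smul_eq_mul]
  have := sum_sign_prod_wedge (fun i => α (s i)) v
  simp_rw [mul_left_comm _ ((Complex.I / 2) ^ p)]
  rw [← Finset.mul_sum, this, div_pow]
  push_cast
  have h2 : (2 : ℂ) ^ p ≠ 0 := by positivity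
  field_simp

theorem isStronglyPositive_dividedPower (hg : IsHermForm J g) (h : IsUnitaryFrame J g e α) (p : ℕ) :
    IsStronglyPositive J (dividedPower g p) := by
  rw [h.dividedPower_eq hg]
  exact .sum _ fun s _ => .of_wedge (by positivity) fun i => h.type _

end IsUnitaryFrame

end StronglyPositive


section TopForms

variable {V : Type*} [AddCommGroup V] [Module ℝ V] {J : V →ₗ[ℝ] V} {g : AltForm V 2}

/-! ### Contractions of forms of maximal degree -/

theorem altForm_top_ext {N : ℕ} (b : Module.Basis (Fin N) ℝ V) {φ ψ : AltForm V N}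
    (h : φ b = ψ b) : φ = ψ := by
  refine b.ext_alternating fun v hv => ?_
  have hσ := Finite.injective_iff_bijective.1 hv
  have key : ∀ χ : AltForm V N, (χ fun i => b (v i)) =
      Equiv.Perm.sign (Equiv.ofBijective v hσ) • χ b := fun χ =>
    χ.map_perm b (Equiv.ofBijective v hσ)
  rw [key, key, h]

/-- The sum `∑_s |det (δ_{s i, j})|² / n!` over the maps `s` of `{1, …, n}` to itself. -/
def topConst (n : ℕ) : ℝ := ∑ s : Fin n → Fin n, 1 / n.factorial *
  Complex.normSq (Matrix.of fun i j => if s i = j then (1 : ℂ) else 0).det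

/-- The identity map already contributes 1/n!. Only positivity of this constant, the value of g_n on
a unitary frame, matters below. -/
theorem topConst_pos (n : ℕ) : 0 < topConst n := by
  refine Finset.sum_pos' (fun s _ => mul_nonneg (by positivity) (Complex.normSq_nonneg _))
    ⟨id, Finset.mem_univ _, ?_⟩
  have h : (Matrix.of fun i j : Fin n => if id i = j then (1 : ℂ) else 0) = 1 := by
    ext i j
    simp [Matrix.one_apply]
  rw [h]
  simp
  positivity

namespace IsUnitaryFrame

variable {n : ℕ} {e : Fin n → V} {α : Fin n → V →ₗ[ℝ] ℂ}

theorem exists_basis (h : IsUnitaryFrame J g e α) (hn : Module.finrank ℝ V = 2 * n) :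
    ∃ b : Module.Basis (Fin (2 * n)) ℝ V, ⇑b = interleave e fun i => J (e i) := by
  have hspan : ⊤ ≤ Submodule.span ℝ (Set.range (interleave e fun i => J (e i))) := by
    intro v _
    rw [h.repr v]
    refine Submodule.sum_mem _ fun i _ => Submodule.add_mem _ (Submodule.smul_mem _ _ ?_)
      (Submodule.smul_mem _ _ ?_)
    · exact Submodule.subset_span ⟨pairEquiv n (Sum.inl i), by simp⟩
    · exact Submodule.subset_span ⟨pairEquiv n (Sum.inr i), by simp⟩
  exact ⟨basisOfTopLeSpanOfCardEqFinrank _ hspan (by simp [hn]),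
    coe_basisOfTopLeSpanOfCardEqFinrank _ _ _⟩

theorem wedge_apply_frame (h : IsUnitaryFrame J g e α) :
    wedgeOne (interleave α fun i => conjForm (α i)) (interleave e fun i => J (e i)) =
      (-2 * Complex.I) ^ n := by
  rw [wedgeOne_interleave_apply J _ h.type]
  have : (Matrix.of fun i j => α i (e j)) = 1 := by
    ext i j
    simp [h.dual, Matrix.one_apply]
  rw [this]
  simp

theorem top_eq (h : IsUnitaryFrame J g e α) (hn : Module.finrank ℝ V = 2 * n)
    (φ : AltForm V (2 * n)) :
    φ = (φ (interleave e fun i => J (e i)) * (Complex.I / 2) ^ n) •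
      wedgeOne (interleave α fun i => conjForm (α i)) := by
  obtain ⟨b, hb⟩ := h.exists_basis hn
  refine altForm_top_ext b ?_
  rw [hb, AlternatingMap.smul_apply, h.wedge_apply_frame, smul_eq_mul, mul_assoc, ← mul_pow]
  have : Complex.I / 2 * (-2 * Complex.I) = 1 := by
    linear_combination -Complex.I_mul_I
  rw [this, one_pow, mul_one]

theorem dividedPower_apply_frame (hg : IsHermForm J g) (h : IsUnitaryFrame J g e α) :
    dividedPower g n (interleave e fun i => J (e i)) = topConst n := by
  rw [h.dividedPower_eq hg, altForm_sum_apply, topConst]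
  push_cast
  refine Finset.sum_congr rfl fun s _ => ?_
  rw [AlternatingMap.smul_apply, wedgeOne_interleave_apply J _ fun i => h.type _, smul_eq_mul]
  simp only [h.dual]
  have h1 : Complex.I ^ n * (-2 * Complex.I) ^ n = 2 ^ n := by
    rw [← mul_pow]
    congr 1
    linear_combination -2 * Complex.I_mul_I
  have h2 : (2 : ℂ) ^ n ≠ 0 := by positivity
  have h3 : (n.factorial : ℂ) ≠ 0 := by exact_mod_cast n.factorial_ne_zero
  generalize (Matrix.of fun i j : Fin n => if s i = j then (1 : ℂ) else 0).det = D
  calc _ = 1 / (n.factorial * 2 ^ n : ℂ) * (Complex.I ^ n * (-2 * Complex.I) ^ n) *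
        (Complex.normSq D : ℂ) := by
        ring
    _ = _ := by
      rw [h1]
      field_simp

/-- A top form is a multiple of the product of the whole coframe. The last p coframe elements kill
all ξ_j and Jξ_j, so the contraction consumes exactly the first q pairs. The constant comes from
(i/2)^n (-2i)^q = (i/2)^p. -/
theorem contract_top (h : IsUnitaryFrame J g e α) (hn : Module.finrank ℝ V = 2 * n) {q p : ℕ}
    (hqp : q + p = n) (hN : 2 * q + 2 * p = 2 * n) (φ : AltForm V (2 * n)) (ξ : Fin q → V)
    (hξ : ∀ (i : Fin p) (j : Fin q), α (Fin.cast hqp (Fin.natAdd q i)) (ξ j) = 0) :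
    contractForm hN φ (interleave ξ fun i => J (ξ i)) =
      (φ (interleave e fun i => J (e i)) * ((Complex.normSq
        (Matrix.of fun i j : Fin q => α (Fin.cast hqp (Fin.castAdd p i)) (ξ j)).det / 2 ^ p : ℝ) : ℂ)
        * Complex.I ^ p) •
      wedgeOne (interleave (fun i => α (Fin.cast hqp (Fin.natAdd q i)))
        fun i => conjForm (α (Fin.cast hqp (Fin.natAdd q i)))) := by
  set α₁ : Fin q → V →ₗ[ℝ] ℂ := fun i => α (Fin.cast hqp (Fin.castAdd p i)) with hα₁
  set α₂ : Fin p → V →ₗ[ℝ] ℂ := fun i => α (Fin.cast hqp (Fin.natAdd q i)) with hα₂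
  have happ : ∀ β : Fin n → V →ₗ[ℝ] ℂ, β = Fin.append (fun i => β (Fin.cast hqp (Fin.castAdd p i)))
      (fun i => β (Fin.cast hqp (Fin.natAdd q i))) ∘ Fin.cast hqp.symm := by
    subst hqp
    intro β
    funext i
    refine Fin.addCases (fun c => ?_) (fun c => ?_) i <;> simp
  have hα : interleave α (fun i => conjForm (α i)) =
      Fin.append (interleave α₁ fun i => conjForm (α₁ i)) (interleave α₂ fun i => conjForm (α₂ i)) ∘
        Fin.cast hN.symm := by
    conv_lhs => rw [happ α, happ fun i => conjForm _]
    rw [interleave_append hqp]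
    congr <;>
    · funext i
      simp [hα₁, hα₂]
  have hcontr : ∀ (c : ℂ) (u : AltForm V (2 * n)) (w : Fin (2 * q) → V),
      contractForm hN (c • u) w = c • contractForm hN u w := fun c u w => rfl
  conv_lhs => rw [h.top_eq hn φ]
  rw [hcontr, hα, wedgeOne_contract, wedgeOne_interleave_apply J _ (fun i => h.type _), smul_smul]
  · congr 1
    have h1 : (Complex.I / 2) ^ n * (-2 * Complex.I) ^ q = (Complex.I / 2) ^ p := by
      rw [← hqp, pow_add, mul_right_comm, ← mul_pow]
      have : Complex.I / 2 * (-2 * Complex.I) = 1 := by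
        linear_combination -Complex.I_mul_I
      rw [this, one_pow, one_mul]
    rw [div_pow, div_pow] at h1
    rw [div_pow]
    push_cast
    linear_combination (φ (interleave e fun i => J (e i)) *
      (Complex.normSq (Matrix.of fun i j => α₁ i (ξ j)).det : ℂ)) * h1
  · intro a b
    obtain ⟨a, rfl⟩ := (pairEquiv p).surjective a
    obtain ⟨b, rfl⟩ := (pairEquiv q).surjective b
    rcases a with i | i <;> rcases b with j | j <;> simp [hα₂, hξ, h.type _ (ξ j)]

end IsUnitaryFrame

/-- A form of maximal degree which is nonnegative on the vectors `(ξ₁, J ξ₁, …, ξ_n, J ξ_n)`. -/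
def IsNonnegTop (J : V →ₗ[ℝ] V) {n : ℕ} (φ : AltForm V (2 * n)) : Prop :=
  ∀ ξ : Fin n → V, 0 ≤ φ (interleave ξ fun i => J (ξ i))

/-- The family `f`, extended by `0`. -/
def padZero {q n : ℕ} (f : Fin q → V) : Fin n → V := fun i => if h : i.val < q then f ⟨i.val, h⟩ else 0

/-- Gram–Schmidt is applied to ξ padded by zeros to length n; coframe elements of index at least q
then kill the first q vectors. -/
theorem contract_adapted (hg : IsHermForm J g) [FiniteDimensional ℝ V] {n q p : ℕ}
    (hn : Module.finrank ℝ V = 2 * n) (hqp : q + p = n) (ξ : Fin q → V) :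
    ∃ (e : Fin n → V) (α : Fin n → V →ₗ[ℝ] ℂ), IsUnitaryFrame J g e α ∧
      ∀ (i : Fin p) (j : Fin q), α (Fin.cast hqp (Fin.natAdd q i)) (ξ j) = 0 := by
  obtain ⟨e, α, h, h'⟩ := exists_unitaryFrame hg hn (padZero ξ)
  refine ⟨e, α, h, fun i j => ?_⟩
  have := h' (Fin.cast hqp (Fin.natAdd q i)) ⟨j, by omega⟩ (Fin.lt_def.2 (by simp; omega))
  simpa [padZero] using this

theorem isStronglyPositive_contract (hg : IsHermForm J g) [FiniteDimensional ℝ V] {n q p : ℕ}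
    (hn : Module.finrank ℝ V = 2 * n) (hqp : q + p = n) (hN : 2 * q + 2 * p = 2 * n)
    {φ : AltForm V (2 * n)} (hφ : IsNonnegTop J φ) (ξ : Fin q → V) :
    IsStronglyPositive J (contractForm hN φ (interleave ξ fun i => J (ξ i))) := by
  obtain ⟨e, α, h, hξ⟩ := contract_adapted hg hn hqp ξ
  rw [h.contract_top hn hqp hN φ ξ hξ]
  have h1 := Complex.le_def.1 (hφ e)
  have h2 : φ (interleave e fun i => J (e i)) = ((φ (interleave e fun i => J (e i))).re : ℂ) :=
    Complex.ext rfl (by simpa using h1.2.symm)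
  rw [h2, ← Complex.ofReal_mul]
  exact .of_wedge (mul_nonneg h1.1 (div_nonneg (Complex.normSq_nonneg _) (by positivity)))
    fun i => h.type _

/-- The Gram determinant of a family of vectors. -/
def gramDet (J : V →ₗ[ℝ] V) (g : AltForm V 2) {q : ℕ} (ξ : Fin q → V) : ℝ :=
  (Matrix.of fun i j => hermProd J g (ξ i) (ξ j)).det.re

/-- In an adapted frame only the first q coordinates of ξ survive, so the Gram matrix is A*A with A
square. -/
theorem IsUnitaryFrame.gramDet_eq {n q p : ℕ} {e : Fin n → V} {α : Fin n → V →ₗ[ℝ] ℂ}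
    (h : IsUnitaryFrame J g e α) (hqp : q + p = n) {ξ : Fin q → V}
    (hξ : ∀ (i : Fin p) (j : Fin q), α (Fin.cast hqp (Fin.natAdd q i)) (ξ j) = 0) :
    gramDet J g ξ = Complex.normSq
      (Matrix.of fun i j : Fin q => α (Fin.cast hqp (Fin.castAdd p i)) (ξ j)).det := by
  set A := Matrix.of fun i j : Fin q => α (Fin.cast hqp (Fin.castAdd p i)) (ξ j)
  have : (Matrix.of fun i j => hermProd J g (ξ i) (ξ j)) = A.conjTranspose * A := by
    ext i j
    rw [Matrix.mul_apply, Matrix.of_apply, h.herm]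
    subst hqp
    rw [Fin.sum_univ_add]
    simp only [Fin.cast_eq_self] at hξ
    simp [hξ, A]
  rw [gramDet, this, Matrix.det_mul, Matrix.det_conjTranspose, Complex.star_def,
    ← Complex.normSq_eq_conj_mul_self, Complex.ofReal_re]

/-- In an adapted frame the contraction equals the single term `s₀` of the expansion of the multiple
of g_p; the other terms are nonnegative products. The bound lets the measure of Θ∧ω_p control those
of the contractions, with a factor (the Gram determinant) depending smoothly on ξ. -/
theorem isStronglyPositive_dominate (hg : IsHermForm J g) [FiniteDimensional ℝ V] {n q p : ℕ}
    (hn : Module.finrank ℝ V = 2 * n) (hqp : q + p = n) (hN : 2 * q + 2 * p = 2 * n)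
    (ξ : Fin q → V) :
    IsStronglyPositive J (((p.factorial * topConst n * gramDet J g ξ : ℝ) : ℂ) • dividedPower g p -
      contractForm hN (dividedPower g n) (interleave ξ fun i => J (ξ i))) := by
  obtain ⟨e, α, h, hξ⟩ := contract_adapted hg hn hqp ξ
  rw [h.contract_top hn hqp hN _ ξ hξ, h.dividedPower_apply_frame hg, h.gramDet_eq hqp hξ,
    h.dividedPower_eq hg p]
  set D := Complex.normSq
    (Matrix.of fun i j : Fin q => α (Fin.cast hqp (Fin.castAdd p i)) (ξ j)).det with hD
  have hD0 : 0 ≤ D := Complex.normSq_nonneg _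
  have hκ := topConst_pos n
  set s₀ : Fin p → Fin n := fun i => Fin.cast hqp (Fin.natAdd q i) with hs₀
  rw [← Finset.add_sum_erase _ _ (Finset.mem_univ s₀), smul_add, smul_smul, add_sub_right_comm,
    ← sub_smul]
  have h0 : ((p.factorial * topConst n * D : ℝ) : ℂ) *
      (((1 / (p.factorial * 2 ^ p) : ℝ) : ℂ) * Complex.I ^ p) -
      (topConst n : ℂ) * ((D / 2 ^ p : ℝ) : ℂ) * Complex.I ^ p = 0 := by
    have h3 : (p.factorial : ℂ) ≠ 0 := by exact_mod_cast p.factorial_ne_zero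
    push_cast
    field_simp
    ring
  rw [h0, zero_smul, zero_add]
  exact (IsStronglyPositive.sum _ fun s _ => .of_wedge (by positivity) fun i => h.type _).smul
    (by positivity)

theorem IsUnitaryFrame.comp_perm {n : ℕ} {e : Fin n → V} {α : Fin n → V →ₗ[ℝ] ℂ}
    (h : IsUnitaryFrame J g e α) (σ : Equiv.Perm (Fin n)) : IsUnitaryFrame J g (e ∘ σ) (α ∘ σ) where
  type i := h.type _
  dual i j := by simp [h.dual]
  repr v := by
    conv_lhs => rw [h.repr v, ← Equiv.sum_comp σ]
    rfl
  herm u v := by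
    rw [h.herm, ← Equiv.sum_comp σ]
    rfl

theorem IsUnitaryFrame.exists_hermProd_eq {n : ℕ} {e : Fin n → V} {α : Fin n → V →ₗ[ℝ] ℂ}
    (h : IsUnitaryFrame J g e α) {a : V →ₗ[ℝ] ℂ} (ha : IsType10 J a) :
    ∃ f : V, ∀ v, a v = hermProd J g f v := by
  -- This is the sum of conj(a(e_i))·e_i for the complex structure J; the conjugate appears because
  -- the Hermitian product is conjugate linear in its first variable.
  refine ⟨∑ i, ((a (e i)).re • e i - (a (e i)).im • J (e i)), fun v => ?_⟩
  rw [h.herm]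
  conv_lhs => rw [h.repr v]
  rw [map_sum]
  refine Finset.sum_congr rfl fun i _ => ?_
  have h1 : α i (∑ i, ((a (e i)).re • e i - (a (e i)).im • J (e i))) =
      (starRingEnd ℂ) (a (e i)) := by
    simp only [map_sum, map_sub, map_smul, h.type i _, h.dual]
    rw [Finset.sum_eq_single i]
    · apply Complex.ext <;> simp
    · intro j _ hj
      simp [hj.symm]
    · simp
  rw [h1, Complex.conj_conj, map_add, map_smul, map_smul, ha (e i)]
  apply Complex.ext <;> simp <;> ring

/-- Represent the a_i by vectors f_i and adapt a unitary frame to f. The a_i are then combinations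
of the first p coframe elements, and contracting φ with the remaining q frame vectors leaves the
product of exactly those p elements. -/
theorem exists_contract_eq_wedge (hg : IsHermForm J g) [FiniteDimensional ℝ V] {n q p : ℕ}
    (hn : Module.finrank ℝ V = 2 * n) (hqp : q + p = n) (hN : 2 * q + 2 * p = 2 * n)
    {φ : AltForm V (2 * n)} (hφ : IsNonnegTop J φ) (hφ0 : φ ≠ 0) {a : Fin p → V →ₗ[ℝ] ℂ}
    (ha : ∀ i, IsType10 J (a i)) :
    ∃ (c : ℝ) (ξ : Fin q → V), 0 ≤ c ∧
      Complex.I ^ p • wedgeOne (interleave a fun i => conjForm (a i)) =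
        (c : ℂ) • contractForm hN φ (interleave ξ fun i => J (ξ i)) := by
  obtain ⟨e₀, α₀, h₀, -⟩ := exists_unitaryFrame hg hn (fun _ => 0)
  choose f hf using fun i => h₀.exists_hermProd_eq (ha i)
  have hpq : p + q = n := by omega
  obtain ⟨e₁, α₁, h₁, h₁'⟩ := contract_adapted hg hn hpq f
  -- `contract_top` keeps the last p coframe elements, whereas Gram–Schmidt put the relevant ones
  -- first; the frame is rotated accordingly.
  let σ : Equiv.Perm (Fin n) := (finCongr hqp.symm).trans (finAddFlip.trans (finCongr hpq))
  have hσ₁ : ∀ i : Fin p, σ (Fin.cast hqp (Fin.natAdd q i)) = Fin.cast hpq (Fin.castAdd q i) := by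
    intro i
    simp [σ]
  have hσ₂ : ∀ i : Fin q, σ (Fin.cast hqp (Fin.castAdd p i)) = Fin.cast hpq (Fin.natAdd p i) := by
    intro i
    simp [σ]
  have h := h₁.comp_perm σ
  set e := e₁ ∘ σ
  set α := α₁ ∘ σ with hα
  let ξ : Fin q → V := fun i => e (Fin.cast hqp (Fin.castAdd p i))
  have hξ : ∀ (i : Fin p) (j : Fin q), α (Fin.cast hqp (Fin.natAdd q i)) (ξ j) = 0 := by
    intro i j
    rw [h.dual, if_neg]
    simp [Fin.ext_iff]
    omega
  have hc := h.contract_top hn hqp hN φ ξ hξ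
  have hdet : (Matrix.of fun i j : Fin q => α (Fin.cast hqp (Fin.castAdd p i)) (ξ j)) = 1 := by
    ext i j
    simp [ξ, h.dual, Matrix.one_apply, Fin.ext_iff]
  rw [hdet, Matrix.det_one, map_one] at hc
  set α₂ : Fin p → V →ₗ[ℝ] ℂ := fun i => α (Fin.cast hqp (Fin.natAdd q i)) with hα₂
  let A : Matrix (Fin p) (Fin p) ℂ := Matrix.of fun i j => (starRingEnd ℂ) (α₂ j (f i))
  have hA : a = fun i => ∑ j, A i j • α₂ j := by
    funext i
    ext v
    rw [hf, h₁.herm]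
    subst hpq
    rw [Fin.sum_univ_add, LinearMap.sum_apply]
    simp only [Fin.cast_eq_self] at h₁'
    have h2 : ∀ j, α₂ j = α₁ (Fin.castAdd q j) := fun j => by
      simp only [hα₂, hα, Function.comp_apply, hσ₁, Fin.cast_eq_self]
    simp [h₁', A, h2]
  have hw := wedgeOne_interleave_linearComb A α₂
  have ha' : wedgeOne (interleave a fun i => conjForm (a i)) =
      ((Complex.normSq A.det : ℝ) : ℂ) • wedgeOne (interleave α₂ fun i => conjForm (α₂ i)) := by
    rw [← hw]
    conv_lhs => rw [hA]
  have h1 := Complex.le_def.1 (hφ e)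
  have h2 : φ (interleave e fun i => J (e i)) = ((φ (interleave e fun i => J (e i))).re : ℂ) :=
    Complex.ext rfl (by simpa using h1.2.symm)
  set K : ℝ := (φ (interleave e fun i => J (e i))).re
  have hK : K ≠ 0 := by
    intro h0
    apply hφ0
    rw [h.top_eq hn φ, h2, h0]
    simp
  -- The factor |det A|² passes from `a` to the coframe, and 2^p / K inverts the constant of the
  -- contraction.
  refine ⟨Complex.normSq A.det * 2 ^ p / K, ξ,
    div_nonneg (mul_nonneg (Complex.normSq_nonneg _) (by positivity)) h1.1, ?_⟩
  rw [hc, ha', smul_smul, smul_smul, h2]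
  congr 1
  have hKc : (K : ℂ) ≠ 0 := by exact_mod_cast hK
  push_cast
  field_simp

theorem IsStronglyPositive.exists_eq_sum_contract {n q p : ℕ} (hg : IsHermForm J g)
    [FiniteDimensional ℝ V] (hn : Module.finrank ℝ V = 2 * n) (hqp : q + p = n)
    (hN : 2 * q + 2 * p = 2 * n) {φ : AltForm V (2 * n)} (hφ : IsNonnegTop J φ) (hφ0 : φ ≠ 0)
    {u : AltForm V (2 * p)} (hu : IsStronglyPositive J u) :
    ∃ (N : ℕ) (c : Fin N → ℝ) (ξ : Fin N → Fin q → V), (∀ t, 0 ≤ c t) ∧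
      u = ∑ t, (c t : ℂ) • contractForm hN φ (interleave (ξ t) fun i => J (ξ t i)) := by
  obtain ⟨N, c, α, hc, hα, rfl⟩ := hu
  choose d ξ hd h using fun t => exists_contract_eq_wedge hg hn hqp hN hφ hφ0 (hα t)
  refine ⟨N, fun t => c t * d t, ξ, fun t => mul_nonneg (hc t) (hd t), ?_⟩
  refine Finset.sum_congr rfl fun t _ => ?_
  rw [mul_smul, h, smul_smul, Complex.ofReal_mul]

end TopForms


section Types

variable {V : Type*} [AddCommGroup V] [Module ℝ V] {J : V →ₗ[ℝ] V}

/-! ### Decomposition of forms into types -/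

/-- The pull-back of forms by a linear map. -/
def pullForm {W : Type*} [AddCommGroup W] [Module ℝ W] (L : V →ₗ[ℝ] W) (k : ℕ) :
    AltForm W k →ₗ[ℂ] AltForm V k where
  toFun u := u.compLinearMap L
  map_add' _ _ := rfl
  map_smul' _ _ := rfl

@[simp] theorem pullForm_apply {W : Type*} [AddCommGroup W] [Module ℝ W] (L : V →ₗ[ℝ] W) {k : ℕ}
    (u : AltForm W k) (v : Fin k → V) : pullForm L k u v = u fun i => L (v i) := rfl

theorem pullForm_wedgeOne {W : Type*} [AddCommGroup W] [Module ℝ W] (L : V →ₗ[ℝ] W) {k : ℕ}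
    (γ : Fin k → W →ₗ[ℝ] ℂ) : pullForm L k (wedgeOne γ) = wedgeOne fun i => γ i ∘ₗ L := by
  ext v
  rw [pullForm_apply, wedgeOne_apply, wedgeOne_apply]
  rfl

/-- Multiplication by the complex number `z` on `(V, J)`. -/
def rotate (J : V →ₗ[ℝ] V) (z : ℂ) : V →ₗ[ℝ] V := z.re • LinearMap.id + z.im • J

theorem rotate_apply (J : V →ₗ[ℝ] V) (z : ℂ) (v : V) : rotate J z v = z.re • v + z.im • J v := rfl

theorem IsType10.rotate {α : V →ₗ[ℝ] ℂ} (hα : IsType10 J α) (z : ℂ) (v : V) :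
    α (rotate J z v) = z * α v := by
  rw [rotate_apply, map_add, map_smul, map_smul, hα]
  apply Complex.ext
  all_goals
    simp
    try ring

theorem pullForm_rotate_of_mem {r s k : ℕ} {u : AltForm V k} (hu : u ∈ formsOfType J r s k) (z : ℂ) :
    pullForm (rotate J z) k u = (z ^ r * (starRingEnd ℂ) z ^ s) • u := by
  induction hu using Submodule.span_induction with
  | mem x hx =>
    obtain ⟨hk, α, hα, rfl⟩ := hx
    rw [pullForm_wedgeOne]
    have h1 : (fun i : Fin k => (if i.val < r then α i else conjForm (α i)) ∘ₗ rotate J z) =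
        fun i => (if i.val < r then z else (starRingEnd ℂ) z) •
          (if i.val < r then α i else conjForm (α i)) := by
      funext i
      ext v
      by_cases hi : i.val < r <;> simp [hi, (hα i).rotate]
    have h2 : ∏ i : Fin k, (if i.val < r then z else (starRingEnd ℂ) z) =
        z ^ r * (starRingEnd ℂ) z ^ s := by
      subst hk
      rw [Fin.prod_univ_add]
      simp
    rw [h1, ← h2]
    exact (wedgeMap V k).map_smul_univ _ _
  | zero => simp
  | add x y _ _ hx hy => rw [map_add, hx, hy, smul_add]
  | smul c x _ hx => rw [map_smul, hx, smul_comm]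

variable (J) in
/-- The span of the forms of all types. -/
def typeSpan (k : ℕ) : Submodule ℂ (AltForm V k) :=
  Submodule.span ℂ {u | ∃ r s, r + s = k ∧ u ∈ formsOfType J r s k}

theorem wedgeOne_eq_sign_smul {k : ℕ} (γ : Fin k → V →ₗ[ℝ] ℂ) (σ : Equiv.Perm (Fin k)) :
    wedgeOne γ = ((Equiv.Perm.sign σ : ℤ) : ℂ) • wedgeOne (γ ∘ σ) := by
  rw [wedgeOne_perm, smul_smul]
  have : ((Equiv.Perm.sign σ : ℤ) : ℂ) * ((Equiv.Perm.sign σ : ℤ) : ℂ) = 1 := by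
    rcases Int.units_eq_one_or (Equiv.Perm.sign σ) with h | h <;> simp [h]
  rw [this, one_smul]

theorem exists_perm_lt_iff {k : ℕ} (P : Fin k → Prop) :
    ∃ (r : ℕ) (σ : Equiv.Perm (Fin k)), r ≤ k ∧ ∀ i, i.val < r ↔ P (σ i) := by
  classical
  have hr : Fintype.card {i // P i} ≤ k := by
    simpa using Fintype.card_subtype_le P
  have hcard : Fintype.card {i : Fin k // i.val < Fintype.card {i // P i}} =
      Fintype.card {i // P i} := by
    rw [Fintype.card_subtype]
    simp [Fin.card_filter_val_lt, hr]
  let e := Fintype.equivOfCardEq hcard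
  refine ⟨Fintype.card {i // P i}, e.extendSubtype, hr, fun i => ⟨fun hi => ?_, fun hi => ?_⟩⟩
  · exact e.extendSubtype_mem i hi
  · by_contra h
    exact e.extendSubtype_not_mem i h hi

theorem wedgeOne_mem_typeSpan_of_pure {k : ℕ} {γ : Fin k → V →ₗ[ℝ] ℂ}
    (hγ : ∀ i, IsType10 J (γ i) ∨ ∃ α, IsType10 J α ∧ γ i = conjForm α) :
    wedgeOne γ ∈ typeSpan J k := by
  classical
  obtain ⟨r, σ, hr, hσ⟩ := exists_perm_lt_iff fun i => IsType10 J (γ i)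
  have hex : ∀ i, ∃ α, IsType10 J α ∧
      (γ ∘ σ) i = if i.val < r then α else conjForm α := by
    intro i
    by_cases hi : i.val < r
    · exact ⟨γ (σ i), (hσ i).1 hi, by simp [hi]⟩
    · obtain ⟨α, hα, h⟩ := (hγ (σ i)).resolve_left fun h => hi ((hσ i).2 h)
      exact ⟨α, hα, by simp [hi, h]⟩
  choose α hα hα' using hex
  rw [wedgeOne_eq_sign_smul γ σ]
  refine Submodule.smul_mem _ _ (Submodule.subset_span ⟨r, k - r, by omega, ?_⟩)
  exact Submodule.subset_span ⟨by omega, α, hα, congrArg _ (funext hα')⟩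

theorem exists_eq_add_conjForm (hJ : ∀ v, J (J v) = -v) (γ : V →ₗ[ℝ] ℂ) :
    ∃ a b : V →ₗ[ℝ] ℂ, IsType10 J a ∧ IsType10 J b ∧ γ = a + conjForm b := by
  refine ⟨(1 / 2 : ℂ) • γ - (Complex.I / 2) • (γ ∘ₗ J),
    (1 / 2 : ℂ) • conjForm γ - (Complex.I / 2) • (conjForm γ ∘ₗ J), fun v => ?_, fun v => ?_, ?_⟩
  · simp only [LinearMap.sub_apply, LinearMap.smul_apply, LinearMap.comp_apply, hJ, map_neg,
      smul_eq_mul]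
    linear_combination (1 / 2 * γ (J v)) * Complex.I_mul_I
  · simp only [LinearMap.sub_apply, LinearMap.smul_apply, LinearMap.comp_apply, hJ, map_neg,
      smul_eq_mul]
    linear_combination (1 / 2 * conjForm γ (J v)) * Complex.I_mul_I
  · ext v
    have h2 : (starRingEnd ℂ) 2 = 2 := map_ofNat _ 2
    simp [h2]
    ring

/-- Each factor is split into a (1,0) and a (0,1) part by multilinearity; `T` is the set of factors
still to be split. -/
theorem wedgeOne_mem_typeSpan (hJ : ∀ v, J (J v) = -v) {k : ℕ} (γ : Fin k → V →ₗ[ℝ] ℂ) :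
    wedgeOne γ ∈ typeSpan J k := by
  classical
  have main : ∀ (T : Finset (Fin k)) (γ : Fin k → V →ₗ[ℝ] ℂ),
      (∀ i ∉ T, IsType10 J (γ i) ∨ ∃ α, IsType10 J α ∧ γ i = conjForm α) →
      wedgeOne γ ∈ typeSpan J k := by
    intro T
    induction T using Finset.induction_on with
    | empty => exact fun γ hγ => wedgeOne_mem_typeSpan_of_pure fun i => hγ i (by simp)
    | insert j T hj ih =>
      intro γ hγ
      obtain ⟨a, b, ha, hb, hab⟩ := exists_eq_add_conjForm hJ (γ j)
      rw [← Function.update_eq_self j γ, hab, wedgeOne_update_add]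
      refine Submodule.add_mem _ (ih _ fun i hi => ?_) (ih _ fun i hi => ?_)
      · by_cases hij : i = j
        · subst hij
          simpa using Or.inl ha
        · simpa [hij] using hγ i (by simp [hi, hij])
      · by_cases hij : i = j
        · subst hij
          rw [Function.update_self]
          exact Or.inr ⟨b, hb, rfl⟩
        · simpa [hij] using hγ i (by simp [hi, hij])
  exact main Finset.univ γ (by simp)

/-- The complex valued coordinates of a basis. -/
def coordForm {d : ℕ} (b : Module.Basis (Fin d) ℝ V) (i : Fin d) : V →ₗ[ℝ] ℂ :=
  Complex.ofRealCLM.toLinearMap ∘ₗ b.coord i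

/-- Antisymmetrizing the multilinear expansion of `u` yields k!·u on one side and determinants on
the other. The sum runs over all multi-indices, hence the division by k!. -/
theorem altForm_eq_sum {d k : ℕ} (b : Module.Basis (Fin d) ℝ V) (u : AltForm V k) :
    u = ∑ s : Fin k → Fin d, (u (fun i => b (s i)) / k.factorial) •
      wedgeOne fun i => coordForm b (s i) := by
  ext v
  have hexp : ∀ w : Fin k → V, u w = ∑ s : Fin k → Fin d,
      (∏ i, coordForm b (s i) (w i)) * u fun i => b (s i) := by
    intro w
    conv_lhs => rw [show w = fun i => ∑ j, b.coord j (w i) • b j from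
      funext fun i => (b.sum_repr (w i)).symm]
    have := u.toMultilinearMap.map_sum (fun (i : Fin k) (j : Fin d) => b.coord j (w i) • b j)
    refine this.trans (Finset.sum_congr rfl fun s _ => ?_)
    have := u.toMultilinearMap.map_smul_univ (fun i => b.coord (s i) (w i)) fun i => b (s i)
    refine this.trans ?_
    rw [Complex.real_smul]
    simp [coordForm]
  have halt : (k.factorial : ℂ) * u v = ∑ s : Fin k → Fin d, (u fun i => b (s i)) *
      wedgeOne (fun i => coordForm b (s i)) v := by
    have h1 := congrArg (fun a : AltForm V k => a v) (AlternatingMap.coe_alternatization u)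
    simp only [MultilinearMap.alternatization_apply, Fintype.card_fin, AlternatingMap.smul_apply,
      nsmul_eq_mul] at h1
    rw [← h1]
    simp only [MultilinearMap.domDomCongr_apply, AlternatingMap.coe_multilinearMap, hexp (fun i => v _),
      Units.smul_def, zsmul_eq_mul, Finset.mul_sum]
    rw [Finset.sum_comm]
    refine Finset.sum_congr rfl fun s _ => ?_
    rw [wedgeOne_apply, ← Matrix.det_transpose, Matrix.det_apply', Finset.mul_sum]
    refine Finset.sum_congr rfl fun σ _ => ?_
    simp only [Matrix.transpose_apply, Matrix.of_apply]
    ring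
  rw [altForm_sum_apply]
  have h0 : (k.factorial : ℂ) ≠ 0 := by exact_mod_cast k.factorial_ne_zero
  apply mul_left_cancel₀ h0
  rw [halt, Finset.mul_sum]
  refine Finset.sum_congr rfl fun s _ => ?_
  rw [AlternatingMap.smul_apply, smul_eq_mul]
  field_simp

theorem typeSpan_eq_top (hJ : ∀ v, J (J v) = -v) [FiniteDimensional ℝ V] (k : ℕ) :
    typeSpan J k = ⊤ := by
  refine eq_top_iff.2 fun u _ => ?_
  rw [altForm_eq_sum (Module.finBasis ℝ V) u]
  exact Submodule.sum_mem _ fun s _ => Submodule.smul_mem _ _ (wedgeOne_mem_typeSpan hJ _)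

/-- The unit complex number `exp (π i / (2p + 1))`. -/
def unitRoot (p : ℕ) : ℂ := Complex.exp (Real.pi * Complex.I / (2 * p + 1 : ℕ))

theorem unitRoot_mul_conj (p : ℕ) : unitRoot p * (starRingEnd ℂ) (unitRoot p) = 1 := by
  have h2 : (starRingEnd ℂ) 2 = 2 := map_ofNat _ 2
  rw [unitRoot, ← Complex.exp_conj, ← Complex.exp_add]
  simp [neg_div, h2]

theorem unitRoot_sq (p : ℕ) : IsPrimitiveRoot (unitRoot p ^ 2) (2 * p + 1) := by
  have := Complex.isPrimitiveRoot_exp (2 * p + 1) (by omega)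
  convert this using 1
  rw [unitRoot, ← Complex.exp_nat_mul]
  congr 1
  push_cast
  ring

/-- The projection of the `2p`-forms onto the forms of type `(r, 2p - r)`, as an average over a
finite group of rotations. -/
def typeProj (J : V →ₗ[ℝ] V) (p r : ℕ) : AltForm V (2 * p) →ₗ[ℂ] AltForm V (2 * p) :=
  (1 / (2 * p + 1 : ℕ) : ℂ) • ∑ k : Fin (2 * p + 1),
    ((starRingEnd ℂ) (unitRoot p ^ k.val) ^ r * (unitRoot p ^ k.val) ^ (2 * p - r)) •
      pullForm (rotate J (unitRoot p ^ k.val)) (2 * p)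

theorem typeProj_apply (p r : ℕ) (u : AltForm V (2 * p)) :
    typeProj J p r u = (1 / (2 * p + 1 : ℕ) : ℂ) • ∑ k : Fin (2 * p + 1),
    ((starRingEnd ℂ) (unitRoot p ^ k.val) ^ r * (unitRoot p ^ k.val) ^ (2 * p - r)) •
      pullForm (rotate J (unitRoot p ^ k.val)) (2 * p) u := by
  simp [typeProj, LinearMap.sum_apply]

/-- With ζ = `unitRoot p`, the k-th summand multiplies a form of type (r', 2p - r') by ζ^(2k(r' -
r)). As ζ² is a primitive root of order 2p + 1 and |r' - r| ≤ 2p, the geometric sum vanishes unless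
r = r'. The square accounts for the half angle in ζ. -/
theorem typeProj_of_mem {p r r' s' : ℕ} (hr : r ≤ 2 * p) (h' : r' + s' = 2 * p)
    {u : AltForm V (2 * p)} (hu : u ∈ formsOfType J r' s' (2 * p)) :
    typeProj J p r u = if r = r' then u else 0 := by
  rw [typeProj_apply]
  simp_rw [pullForm_rotate_of_mem hu, smul_smul]
  rw [← Finset.sum_smul, smul_smul]
  set z := unitRoot p with hz
  have hz0 : z ≠ 0 := Complex.exp_ne_zero _
  have hconj : (starRingEnd ℂ) z = z⁻¹ := eq_inv_of_mul_eq_one_right (unitRoot_mul_conj p)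
  have hterm : ∀ k : Fin (2 * p + 1), (starRingEnd ℂ) (z ^ k.val) ^ r * (z ^ k.val) ^ (2 * p - r) *
      ((z ^ k.val) ^ r' * (starRingEnd ℂ) (z ^ k.val) ^ s') =
      ((z ^ 2) ^ ((r' : ℤ) - r)) ^ k.val := by
    intro k
    rw [map_pow, hconj]
    have e1 : (((2 * p - r : ℕ) : ℕ) : ℤ) = 2 * p - r := by
      rw [Nat.cast_sub hr]
      push_cast
      ring
    have e2 : (r' : ℤ) + s' = 2 * p := by exact_mod_cast h'
    simp only [← zpow_natCast, ← zpow_mul, ← zpow_neg_one, ← zpow_add₀ hz0]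
    congr 1
    rw [e1]
    push_cast
    linear_combination -(k : ℤ) * e2
  simp_rw [hterm]
  rw [Fin.sum_univ_eq_sum_range (fun k => ((z ^ 2) ^ ((r' : ℤ) - r)) ^ k)]
  have hN : ((2 * p + 1 : ℕ) : ℂ) ≠ 0 := by exact_mod_cast Nat.succ_ne_zero (2 * p)
  by_cases hrr : r = r'
  · subst hrr
    simp only [sub_self, zpow_zero, one_pow, Finset.sum_const, Finset.card_range, nsmul_eq_mul,
      mul_one, if_true]
    rw [one_div, inv_mul_cancel₀ hN, one_smul]
  · rw [if_neg hrr]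
    have hw : (z ^ 2) ^ ((r' : ℤ) - r) ≠ 1 := by
      intro h
      rw [(unitRoot_sq p).zpow_eq_one_iff_dvd] at h
      have h1 : ((r' : ℤ) - r) = 0 := by
        refine Int.eq_zero_of_abs_lt_dvd h ?_
        rw [abs_lt]
        constructor <;> push_cast <;> omega
      omega
    rw [geom_sum_eq hw]
    have : ((z ^ 2) ^ ((r' : ℤ) - r)) ^ (2 * p + 1) = 1 := by
      rw [← zpow_natCast, ← zpow_mul, mul_comm, zpow_mul, zpow_natCast, (unitRoot_sq p).pow_eq_one,
        one_zpow]
    rw [this, sub_self, zero_div, mul_zero, zero_smul]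

theorem altForm_type_induction (hJ : ∀ v, J (J v) = -v) [FiniteDimensional ℝ V] {k : ℕ}
    {P : AltForm V k → Prop} (h0 : P 0) (hadd : ∀ u v, P u → P v → P (u + v))
    (htype : ∀ r s u, r + s = k → u ∈ formsOfType J r s k → P u) (u : AltForm V k) : P u := by
  have hu : u ∈ typeSpan J k := by
    rw [typeSpan_eq_top hJ]
    exact Submodule.mem_top
  suffices h : ∀ c : ℂ, P (c • u) by simpa using h 1
  induction hu using Submodule.span_induction with
  | mem x hx =>
    obtain ⟨r, s, hrs, hx⟩ := hx
    exact fun c => htype r s _ hrs (Submodule.smul_mem _ _ hx)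
  | zero => simpa using h0
  | add x y _ _ hx hy => exact fun c => by simpa using hadd _ _ (hx c) (hy c)
  | smul a x _ hx => exact fun c => by simpa [smul_smul] using hx (c * a)

theorem sum_typeProj (hJ : ∀ v, J (J v) = -v) [FiniteDimensional ℝ V] {p : ℕ}
    (u : AltForm V (2 * p)) : ∑ r ∈ Finset.range (2 * p + 1), typeProj J p r u = u := by
  induction u using altForm_type_induction hJ with
  | h0 => simp
  | hadd u v hu hv =>
    conv_rhs => rw [← hu, ← hv]
    simp [Finset.sum_add_distrib]
  | htype r s u hrs hu =>
    rw [Finset.sum_congr rfl fun r' hr' => typeProj_of_mem (by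
      have := Finset.mem_range.1 hr'
      omega) hrs hu, Finset.sum_ite_eq', if_pos (Finset.mem_range.2 (by omega))]

theorem typeProj_mem (hJ : ∀ v, J (J v) = -v) [FiniteDimensional ℝ V] {p r : ℕ} (hr : r ≤ 2 * p)
    (u : AltForm V (2 * p)) : typeProj J p r u ∈ formsOfType J r (2 * p - r) (2 * p) := by
  induction u using altForm_type_induction hJ with
  | h0 => simp
  | hadd u v hu hv =>
    rw [map_add]
    exact Submodule.add_mem _ hu hv
  | htype r' s' u hrs hu =>
    rw [typeProj_of_mem hr hrs hu]
    split_ifs with h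
    · obtain rfl : s' = 2 * p - r := by omega
      exact h ▸ hu
    · exact Submodule.zero_mem _

/-- The projection of the `2p`-forms onto the forms of type `(p, p)`. -/
def midProj (J : V →ₗ[ℝ] V) (p : ℕ) : AltForm V (2 * p) →ₗ[ℂ] AltForm V (2 * p) := typeProj J p p

theorem midProj_mem (hJ : ∀ v, J (J v) = -v) [FiniteDimensional ℝ V] {p : ℕ}
    (u : AltForm V (2 * p)) : midProj J p u ∈ formsOfType J p p (2 * p) := by
  have := typeProj_mem hJ (show p ≤ 2 * p by omega) u
  rwa [show 2 * p - p = p by omega] at this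

theorem midProj_of_mem {p : ℕ} {u : AltForm V (2 * p)} (hu : u ∈ formsOfType J p p (2 * p)) :
    midProj J p u = u := by
  rw [midProj, typeProj_of_mem (by omega) (by omega) hu, if_pos rfl]

theorem midProj_eq (p : ℕ) (u : AltForm V (2 * p)) :
    midProj J p u = (1 / (2 * p + 1 : ℕ) : ℂ) • ∑ k : Fin (2 * p + 1),
      pullForm (rotate J (unitRoot p ^ k.val)) (2 * p) u := by
  rw [midProj, typeProj_apply]
  congr 1
  refine Finset.sum_congr rfl fun k _ => ?_
  rw [show 2 * p - p = p by omega, ← mul_pow, map_pow, ← mul_pow, mul_comm ((starRingEnd ℂ) _), unitRoot_mul_conj,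
    one_pow, one_pow, one_smul]

theorem midProj_rotate (hJ : ∀ v, J (J v) = -v) [FiniteDimensional ℝ V] {p : ℕ} {z : ℂ}
    (hz : z * (starRingEnd ℂ) z = 1) (u : AltForm V (2 * p)) :
    midProj J p (pullForm (rotate J z) (2 * p) u) = midProj J p u := by
  induction u using altForm_type_induction hJ with
  | h0 => simp
  | hadd u v hu hv => rw [map_add, map_add, map_add, hu, hv]
  | htype r s u hrs hu =>
    rw [pullForm_rotate_of_mem hu, map_smul, midProj, typeProj_of_mem (by omega) hrs hu]
    split_ifs with h
    · obtain rfl : s = p := by omega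
      rw [← h, ← mul_pow, hz, one_pow, one_smul]
    · simp

/-- An invariant form equals its own average `midProj`. This is the practical test for being of type
(p,p). -/
theorem mem_formsOfType_of_rotate (hJ : ∀ v, J (J v) = -v) [FiniteDimensional ℝ V] {p : ℕ}
    {u : AltForm V (2 * p)}
    (hu : ∀ z : ℂ, z * (starRingEnd ℂ) z = 1 → pullForm (rotate J z) (2 * p) u = u) :
    u ∈ formsOfType J p p (2 * p) := by
  have h : midProj J p u = u := by
    have hk : ∀ k : Fin (2 * p + 1), pullForm (rotate J (unitRoot p ^ k.val)) (2 * p) u = u :=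
      fun k => hu _ (by rw [map_pow, ← mul_pow, unitRoot_mul_conj, one_pow])
    rw [midProj_eq]
    simp_rw [hk]
    rw [Finset.sum_const, Finset.card_univ, Fintype.card_fin, ← Nat.cast_smul_eq_nsmul ℂ, smul_smul,
      one_div, inv_mul_cancel₀, one_smul]
    exact_mod_cast Nat.succ_ne_zero (2 * p)
  rw [← h]
  exact midProj_mem hJ u

theorem pullForm_rotate_of_mid {p : ℕ} {u : AltForm V (2 * p)} (hu : u ∈ formsOfType J p p (2 * p))
    {z : ℂ} (hz : z * (starRingEnd ℂ) z = 1) : pullForm (rotate J z) (2 * p) u = u := by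
  rw [pullForm_rotate_of_mem hu, ← mul_pow, hz, one_pow, one_smul]

/-- The span of the products `α₁ ∧ ᾱ₁ ∧ … ∧ α_p ∧ ᾱ_p`. -/
def pairSpan (J : V →ₗ[ℝ] V) (p : ℕ) : Submodule ℂ (AltForm V (2 * p)) :=
  Submodule.span ℂ {u | ∃ a : Fin p → V →ₗ[ℝ] ℂ, (∀ i, IsType10 J (a i)) ∧
    u = wedgeOne (interleave a fun i => conjForm (a i))}

theorem IsType10.add_smul {a b : V →ₗ[ℝ] ℂ} (ha : IsType10 J a) (hb : IsType10 J b) (c : ℂ) :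
    IsType10 J (a + c • b) := fun v => by
  rw [LinearMap.add_apply, LinearMap.smul_apply, LinearMap.add_apply, LinearMap.smul_apply, ha, hb]
  simp only [smul_eq_mul]
  ring

theorem interleave_update {A : Type*} {p : ℕ} (f h : Fin p → A) (j : Fin p) (x y : A) :
    interleave (Function.update f j x) (Function.update h j y) =
      Function.update (Function.update (interleave f h) (pairEquiv p (Sum.inl j)) x)
        (pairEquiv p (Sum.inr j)) y := by
  refine funext_pairEquiv (fun i => ?_) fun i => ?_
  · rw [interleave_pairEquiv_inl,
      Function.update_of_ne (fun h => Sum.inl_ne_inr ((pairEquiv p).injective h))]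
    by_cases hij : i = j
    · subst hij
      simp
    · rw [Function.update_of_ne hij, Function.update_of_ne fun h =>
        hij (Sum.inl_injective ((pairEquiv p).injective h)), interleave_pairEquiv_inl]
  · rw [interleave_pairEquiv_inr]
    by_cases hij : i = j
    · subst hij
      simp
    · rw [Function.update_of_ne hij, Function.update_of_ne fun h =>
        hij (Sum.inr_injective ((pairEquiv p).injective h)),
        Function.update_of_ne (fun h => Sum.inr_ne_inl ((pairEquiv p).injective h)),
        interleave_pairEquiv_inr]

/-- The product is linear in x and conjugate linear in y, so the identity 4B(x, y) = ∑ i^k B(x + i^k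
y, x + i^k y) applies. Used slot by slot, it reduces all (p,p)-forms to products a∧ā. -/
theorem wedgeOne_polarization {p : ℕ} (f h : Fin p → V →ₗ[ℝ] ℂ) (j : Fin p) (x y : V →ₗ[ℝ] ℂ) :
    wedgeOne (interleave (Function.update f j x) (Function.update h j (conjForm y))) =
      ∑ k : Fin 4, (Complex.I ^ k.val / 4) •
        wedgeOne (interleave (Function.update f j (x + Complex.I ^ k.val • y))
          (Function.update h j (conjForm (x + Complex.I ^ k.val • y)))) := by
  set B : (V →ₗ[ℝ] ℂ) → (V →ₗ[ℝ] ℂ) → AltForm V (2 * p) := fun a b =>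
    wedgeOne (interleave (Function.update f j a) (Function.update h j b)) with hB
  have hne : pairEquiv p (Sum.inl j) ≠ pairEquiv p (Sum.inr j) :=
    fun h => Sum.inl_ne_inr ((pairEquiv p).injective h)
  have hBr : ∀ a b b' (c : ℂ), B a (b + c • b') = B a b + c • B a b' := by
    intro a b b' c
    simp only [hB, interleave_update, wedgeOne_update_add, wedgeOne_update_smul]
  have hBl : ∀ a a' b (c : ℂ), B (a + c • a') b = B a b + c • B a' b := by
    intro a a' b c
    simp only [hB, interleave_update, Function.update_comm hne, wedgeOne_update_add,
      wedgeOne_update_smul]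
  have hconj : ∀ c : ℂ, conjForm (x + c • y) = conjForm x + (starRingEnd ℂ) c • conjForm y := by
    intro c
    ext v
    simp
  change B x (conjForm y) = ∑ k : Fin 4, (Complex.I ^ k.val / 4) •
    B (x + Complex.I ^ k.val • y) (conjForm (x + Complex.I ^ k.val • y))
  simp only [hconj, hBr, hBl, Fin.sum_univ_four, map_pow, Complex.conj_I, smul_add, smul_smul]
  have h2 : Complex.I ^ 2 = -1 := Complex.I_sq
  have h3 : Complex.I ^ 3 = -Complex.I := by rw [pow_succ, h2]; ring
  have h2' : (-Complex.I) ^ 2 = -1 := by rw [neg_sq, h2]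
  have h3' : (-Complex.I) ^ 3 = Complex.I := by rw [pow_succ, h2']; ring
  simp only [Fin.val_zero, Fin.val_one, Fin.val_two, show (3 : Fin 4).val = 3 from rfl, pow_zero,
    pow_one, h2, h3, h2', h3']
  match_scalars <;> ring_nf <;> simp only [Complex.I_sq] <;> ring

theorem wedgeOne_interleave_mem_pairSpan {p : ℕ} {β γ : Fin p → V →ₗ[ℝ] ℂ}
    (hβ : ∀ i, IsType10 J (β i)) (hγ : ∀ i, IsType10 J (γ i)) :
    wedgeOne (interleave β fun i => conjForm (γ i)) ∈ pairSpan J p := by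
  classical
  have main : ∀ (T : Finset (Fin p)) (β γ : Fin p → V →ₗ[ℝ] ℂ), (∀ i, IsType10 J (β i)) →
      (∀ i, IsType10 J (γ i)) → (∀ i ∉ T, β i = γ i) →
      wedgeOne (interleave β fun i => conjForm (γ i)) ∈ pairSpan J p := by
    intro T
    induction T using Finset.induction_on with
    | empty =>
      intro β γ hβ _ h
      obtain rfl : β = γ := funext fun i => h i (by simp)
      exact Submodule.subset_span ⟨β, hβ, rfl⟩
    | insert j T hj ih =>
      intro β γ hβ hγ h
      have h1 := wedgeOne_polarization β (fun i => conjForm (γ i)) j (β j) (γ j)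
      rw [Function.update_eq_self, Function.update_eq_self j (fun i => conjForm (γ i))] at h1
      rw [h1]
      refine Submodule.sum_mem _ fun k _ => Submodule.smul_mem _ _ ?_
      have h2 := ih (Function.update β j (β j + Complex.I ^ k.val • γ j))
        (Function.update γ j (β j + Complex.I ^ k.val • γ j)) (fun i => ?_) (fun i => ?_)
        fun i hi => ?_
      · convert h2 using 3
        funext i
        by_cases hij : i = j
        · subst hij; simp
        · simp [hij]
      · by_cases hij : i = j
        · subst hij
          simpa using (hβ i).add_smul (hγ i) _
        · simpa [hij] using hβ i
      · by_cases hij : i = j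
        · subst hij
          simpa using (hβ i).add_smul (hγ i) _
        · simpa [hij] using hγ i
      · by_cases hij : i = j
        · subst hij
          simp
        · simpa [hij] using h i (by simp [hij, hi])
  exact main Finset.univ β γ hβ hγ (by simp)

theorem formsOfType_le_pairSpan (p : ℕ) : formsOfType J p p (2 * p) ≤ pairSpan J p := by
  refine Submodule.span_le.2 ?_
  rintro _ ⟨-, α, hα, rfl⟩
  let σ : Equiv.Perm (Fin (2 * p)) :=
    (pairEquiv p).symm.trans (finSumFinEquiv.trans (finCongr (two_mul p).symm))
  rw [wedgeOne_eq_sign_smul _ σ]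
  refine Submodule.smul_mem _ _ ?_
  convert wedgeOne_interleave_mem_pairSpan (fun i => hα (σ (pairEquiv p (Sum.inl i))))
    (fun i => hα (σ (pairEquiv p (Sum.inr i)))) using 2
  refine funext_pairEquiv (fun i => ?_) fun i => ?_
  · simp [σ]
  · simp [σ]

end Types


section Coordinates

variable {V : Type*} [AddCommGroup V] [Module ℝ V] {J : V →ₗ[ℝ] V} {g : AltForm V 2}

/-! ### Contractions and coordinates of the forms of type `(p, p)` -/

/-- Rotation by a unit z replaces each a_i by z a_i, which scales the product by |z^p|² = 1. -/
theorem wedgeOne_interleave_mem (hJ : ∀ v, J (J v) = -v) [FiniteDimensional ℝ V] {p : ℕ}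
    {a : Fin p → V →ₗ[ℝ] ℂ} (ha : ∀ i, IsType10 J (a i)) :
    wedgeOne (interleave a fun i => conjForm (a i)) ∈ formsOfType J p p (2 * p) := by
  refine mem_formsOfType_of_rotate hJ fun z hz => ?_
  have h1 : ∀ i, a i ∘ₗ rotate J z = ∑ j, (z • (1 : Matrix (Fin p) (Fin p) ℂ)) i j • a j := by
    intro i
    ext v
    simp [(ha i).rotate, Matrix.one_apply]
  have h2 : (fun i => interleave a (fun i => conjForm (a i)) i ∘ₗ rotate J z) =
      interleave (fun i => a i ∘ₗ rotate J z) fun i => conjForm (a i ∘ₗ rotate J z) :=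
    comp_interleave (fun γ : V →ₗ[ℝ] ℂ => γ ∘ₗ rotate J z) _ _
  rw [pullForm_wedgeOne, h2]
  simp_rw [h1]
  have h3 : Complex.normSq z = 1 := by
    rw [← Complex.ofReal_inj, Complex.normSq_eq_conj_mul_self, mul_comm, hz, Complex.ofReal_one]
  rw [wedgeOne_interleave_linearComb, Matrix.det_smul, Matrix.det_one, mul_one, map_pow, h3]
  simp

theorem IsStronglyPositive.mem (hJ : ∀ v, J (J v) = -v) [FiniteDimensional ℝ V] {p : ℕ}
    {u : AltForm V (2 * p)} (hu : IsStronglyPositive J u) : u ∈ formsOfType J p p (2 * p) := by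
  obtain ⟨N, c, α, hc, hα, rfl⟩ := hu
  exact Submodule.sum_mem _ fun t _ => Submodule.smul_mem _ _ (wedgeOne_interleave_mem hJ (hα t))

/-- The form takes real values. -/
def IsRealForm {k : ℕ} (u : AltForm V k) : Prop := ∀ v, (u v).im = 0

/-- The conjugate of a form. -/
def conjAlt {k : ℕ} (u : AltForm V k) : AltForm V k :=
  Complex.conjAe.toLinearMap.compAlternatingMap u

@[simp] theorem conjAlt_apply {k : ℕ} (u : AltForm V k) (v : Fin k → V) :
    conjAlt u v = (starRingEnd ℂ) (u v) := rfl

theorem isRealForm_iff {k : ℕ} (u : AltForm V k) : IsRealForm u ↔ conjAlt u = u := by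
  refine ⟨fun h => ?_, fun h v => ?_⟩
  · ext v
    exact Complex.conj_eq_iff_im.2 (h v)
  · exact Complex.conj_eq_iff_im.1 (congrArg (fun a : AltForm V k => a v) h)

theorem IsNonnegTop.isRealForm (hg : IsHermForm J g) [FiniteDimensional ℝ V] {n : ℕ}
    (hn : Module.finrank ℝ V = 2 * n) {φ : AltForm V (2 * n)} (hφ : IsNonnegTop J φ) :
    IsRealForm φ := by
  obtain ⟨e, α, h, -⟩ := exists_unitaryFrame hg hn (fun _ => 0)
  obtain ⟨b, hb⟩ := h.exists_basis hn
  rw [isRealForm_iff]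
  refine altForm_top_ext b ?_
  rw [hb, conjAlt_apply]
  exact Complex.conj_eq_iff_im.2 (Complex.le_def.1 (hφ e)).2.symm

theorem IsRealForm.contract {m k N : ℕ} (h : m + k = N) {φ : AltForm V N} (hφ : IsRealForm φ)
    (w : Fin m → V) : IsRealForm (contractForm h φ w) := fun _ => hφ _

theorem IsRealForm.midProj {p : ℕ} {u : AltForm V (2 * p)} (hu : IsRealForm u) :
    IsRealForm (midProj J p u) := by
  intro v
  rw [midProj_eq, AlternatingMap.smul_apply, altForm_sum_apply, smul_eq_mul]
  have h1 : (1 / (2 * p + 1 : ℕ) : ℂ) = ((1 / (2 * p + 1 : ℕ) : ℝ) : ℂ) := by push_cast; rfl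
  rw [h1, Complex.im_ofReal_mul, Complex.im_sum]
  refine mul_eq_zero_of_right _ (Finset.sum_eq_zero fun k _ => hu _)

instance finite_altForm [FiniteDimensional ℝ V] (k : ℕ) : Module.Finite ℂ (AltForm V k) := by
  refine ⟨Submodule.fg_def.2 ⟨Set.range fun s : Fin k → Fin (Module.finrank ℝ V) =>
    wedgeOne fun i => coordForm (Module.finBasis ℝ V) (s i), Set.finite_range _, ?_⟩⟩
  refine eq_top_iff.2 fun u _ => ?_
  rw [altForm_eq_sum (Module.finBasis ℝ V) u]
  exact Submodule.sum_mem _ fun s _ => Submodule.smul_mem _ _ (Submodule.subset_span ⟨s, rfl⟩)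

/-- The contractions of φ span the (p,p)-forms, so a basis can be extracted from them; the `l j` are
its coordinates composed with `midProj`, whence their invariance under rotations. The basis consists
of real forms, so conjugating an expansion and using uniqueness shows that real forms have real
coordinates. -/
theorem exists_coordinates {n q p : ℕ} (hg : IsHermForm J g)
    [FiniteDimensional ℝ V] (hn : Module.finrank ℝ V = 2 * n) (hqp : q + p = n)
    (hN : 2 * q + 2 * p = 2 * n) {φ : AltForm V (2 * n)} (hφ : IsNonnegTop J φ) (hφ0 : φ ≠ 0) :
    ∃ (N : ℕ) (ξ : Fin N → Fin q → V) (l : Fin N → AltForm V (2 * p) →ₗ[ℂ] ℂ),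
      (∀ u, midProj J p u =
        ∑ j, l j u • contractForm hN φ (interleave (ξ j) fun i => J (ξ j i))) ∧
      (∀ j u, IsRealForm u → (l j u).im = 0) ∧
      ∀ (z : ℂ), z * (starRingEnd ℂ) z = 1 → ∀ j u, l j (pullForm (rotate J z) (2 * p) u) = l j u := by
  set β : (Fin q → V) → AltForm V (2 * p) := fun ξ =>
    contractForm hN φ (interleave ξ fun i => J (ξ i)) with hβ
  have hle : formsOfType J p p (2 * p) ≤ Submodule.span ℂ (Set.range β) := by
    refine (formsOfType_le_pairSpan p).trans (Submodule.span_le.2 ?_)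
    rintro _ ⟨a, ha, rfl⟩
    obtain ⟨c, ξ, -, h⟩ := exists_contract_eq_wedge hg hn hqp hN hφ hφ0 ha
    have hI : Complex.I ^ p ≠ 0 := pow_ne_zero _ Complex.I_ne_zero
    have := congrArg (fun x => (Complex.I ^ p)⁻¹ • x) h
    simp only [smul_smul, inv_mul_cancel₀ hI, one_smul] at this
    rw [this]
    exact Submodule.smul_mem _ _ (Submodule.subset_span ⟨ξ, rfl⟩)
  obtain ⟨b, hbs, hbspan, hli⟩ := exists_linearIndependent ℂ (Set.range β)
  have hfin : b.Finite := hli.setFinite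
  have := hfin.to_subtype
  let e := Finite.equivFin b
  choose ξ hξ using fun j : Fin (Nat.card b) => hbs (e.symm j).2
  have hli' : LinearIndependent ℂ fun j => β (ξ j) := by
    simp only [hξ]
    exact hli.comp _ e.symm.injective
  have hspan' : Submodule.span ℂ (Set.range fun j => β (ξ j)) = Submodule.span ℂ (Set.range β) := by
    rw [← hbspan]
    congr 1
    simp only [hξ]
    ext x
    constructor
    · rintro ⟨j, rfl⟩
      exact (e.symm j).2
    · exact fun hx => ⟨e ⟨x, hx⟩, congrArg Subtype.val (e.symm_apply_apply ⟨x, hx⟩)⟩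
  have hmem : ∀ u, midProj J p u ∈ Submodule.span ℂ (Set.range fun j => β (ξ j)) := fun u =>
    hspan' ▸ hle (midProj_mem hg.sq u)
  let B := Module.Basis.span hli'
  let l : Fin (Nat.card b) → AltForm V (2 * p) →ₗ[ℂ] ℂ := fun j =>
    B.coord j ∘ₗ (midProj J p).codRestrict _ hmem
  have hl : ∀ u, midProj J p u = ∑ j, l j u • β (ξ j) := by
    intro u
    have h1 := congrArg Subtype.val (B.sum_repr ⟨midProj J p u, hmem u⟩)
    simp only [Submodule.coe_sum, Submodule.coe_smul] at h1
    rw [← h1]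
    refine Finset.sum_congr rfl fun j _ => ?_
    congr 1
    exact congrArg Subtype.val (Module.Basis.span_apply hli' j)
  refine ⟨Nat.card b, ξ, l, hl, fun j u hu => ?_, fun z hz j u => ?_⟩
  · have hreal : ∀ ξ, conjAlt (β ξ) = β ξ := fun ξ =>
      (isRealForm_iff _).1 ((hφ.isRealForm hg hn).contract hN _)
    have h1 : ∑ j, (starRingEnd ℂ) (l j u) • β (ξ j) = ∑ j, l j u • β (ξ j) := by
      rw [← hl, ← (isRealForm_iff _).1 hu.midProj, hl]
      ext v
      rw [conjAlt_apply, altForm_sum_apply, altForm_sum_apply, map_sum]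
      refine Finset.sum_congr rfl fun j _ => ?_
      rw [AlternatingMap.smul_apply, AlternatingMap.smul_apply, smul_eq_mul, smul_eq_mul, map_mul,
        ← conjAlt_apply, hreal]
    have h2 : ∑ j, ((starRingEnd ℂ) (l j u) - l j u) • β (ξ j) = 0 := by
      simp only [sub_smul, Finset.sum_sub_distrib, h1, sub_self]
    exact Complex.conj_eq_iff_im.1 (sub_eq_zero.1 (Fintype.linearIndependent_iff.1 hli' _ h2 j))
  · simp only [l, LinearMap.comp_apply]
    congr 1
    exact Subtype.ext (midProj_rotate hg.sq hz u)

theorem append_cast_update_left {A : Type*} {m k N : ℕ} (h : m + k = N) [DecidableEq (Fin m)]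
    (w : Fin m → A) (v : Fin k → A) (i : Fin m) (x : A) :
    Fin.append (Function.update w i x) v ∘ Fin.cast h.symm =
      Function.update (Fin.append w v ∘ Fin.cast h.symm) (Fin.cast h (Fin.castAdd k i)) x := by
  subst h
  ext b
  refine Fin.addCases (fun c => ?_) (fun c => ?_) b
  · by_cases hc : c = i
    · subst hc
      simp
    · have : Fin.castAdd k c ≠ Fin.castAdd k i := fun e => hc (by simpa [Fin.ext_iff] using e)
      simp [Function.update_of_ne this, Function.update_of_ne hc]
  · have : Fin.natAdd m c ≠ Fin.castAdd k i := fun e => by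
      have := congrArg Fin.val e
      simp at this
      omega
    simp [Function.update_of_ne this]

/-- The form `v ↦ T (φ (v, ·))`, for a linear functional `T` on forms. -/
def dualContract {m k N : ℕ} (h : m + k = N) (φ : AltForm V N) (T : AltForm V k →ₗ[ℂ] ℂ) :
    AltForm V m where
  toFun w := T (contractForm h φ w)
  map_update_add' := by
    intro _ w i x y
    rw [← map_add]
    congr 1
    ext v
    change φ _ = φ _ + φ _
    simp only [append_cast_update_left h, φ.map_update_add]
  map_update_smul' := by
    intro _ w i c x
    rw [Complex.real_smul, ← smul_eq_mul, ← map_smul]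
    congr 1
    ext v
    change φ _ = (c : ℂ) * φ _
    simp only [append_cast_update_left h, φ.map_update_smul, Complex.real_smul]
  map_eq_zero_of_eq' := by
    intro w i j hij hne
    have : contractForm h φ w = 0 := by
      ext v
      refine φ.map_eq_zero_of_eq _ (i := Fin.cast h (Fin.castAdd k i))
        (j := Fin.cast h (Fin.castAdd k j)) ?_ ?_
      · simpa using hij
      · simpa [Fin.ext_iff] using hne
    rw [this, map_zero]

@[simp] theorem dualContract_apply {m k N : ℕ} (h : m + k = N) (φ : AltForm V N)
    (T : AltForm V k →ₗ[ℂ] ℂ) (w : Fin m → V) :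
    dualContract h φ T w = T (contractForm h φ w) := rfl

theorem contractForm_pullForm {W : Type*} [AddCommGroup W] [Module ℝ W] (L : V →ₗ[ℝ] W) {m k N : ℕ}
    (h : m + k = N) (φ : AltForm W N) (w : Fin m → V) :
    contractForm h (pullForm L N φ) w = pullForm L k (contractForm h φ fun i => L (w i)) := by
  subst h
  ext v
  change φ _ = φ _
  congr 1
  funext i
  refine Fin.addCases (fun c => ?_) (fun c => ?_) i <;> simp

/-- Rotation invariance of φ and of `T` makes the resulting form invariant. This gives the type of
the density constructed for (b) ⇒ (a). -/
theorem dualContract_mem (hJ : ∀ v, J (J v) = -v) [FiniteDimensional ℝ V] {n q p : ℕ}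
    (hN : 2 * q + 2 * p = 2 * n) {φ : AltForm V (2 * n)} (hφ : φ ∈ formsOfType J n n (2 * n))
    {T : AltForm V (2 * p) →ₗ[ℂ] ℂ}
    (hT : ∀ z : ℂ, z * (starRingEnd ℂ) z = 1 → ∀ u, T (pullForm (rotate J z) (2 * p) u) = T u) :
    dualContract hN φ T ∈ formsOfType J q q (2 * q) := by
  refine mem_formsOfType_of_rotate hJ fun z hz => ?_
  ext w
  rw [pullForm_apply, dualContract_apply, dualContract_apply, ← hT z hz, ← contractForm_pullForm,
    pullForm_rotate_of_mid hφ hz]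

theorem pullForm_midProj {W : Type*} [AddCommGroup W] [Module ℝ W] {J' : W →ₗ[ℝ] W}
    (L : V →ₗ[ℝ] W) (hL : ∀ v, L (J v) = J' (L v)) {p : ℕ} (u : AltForm W (2 * p)) :
    pullForm L (2 * p) (midProj J' p u) = midProj J p (pullForm L (2 * p) u) := by
  rw [midProj_eq, midProj_eq, map_smul, map_sum]
  congr 1
  refine Finset.sum_congr rfl fun k _ => ?_
  ext v
  simp only [pullForm_apply, rotate_apply, map_add, map_smul, hL]

end Coordinates


section Frames

open Topology

/-! ### Vector fields and cut-off functions -/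

theorem sigmaCompactSpace_manifold (d : ℕ) (X : Type*) [TopologicalSpace X]
    [ChartedSpace (Model d) X] [SecondCountableTopology X] :
    LocallyCompactSpace X ∧ SigmaCompactSpace X := by
  have := ChartedSpace.locallyCompactSpace (Model d) X
  exact ⟨this, inferInstance⟩

variable {d : ℕ} {X : Type*} [TopologicalSpace X] [ChartedSpace (Model d) X]

instance finiteDimensional_tangentSpace (x : X) :
    FiniteDimensional ℝ (TangentSpace (𝓡 d) x) :=
  inferInstanceAs (FiniteDimensional ℝ (Model d))

theorem finrank_tangentSpace (x : X) : Module.finrank ℝ (TangentSpace (𝓡 d) x) = d :=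
  (finrank_euclideanSpace_fin : Module.finrank ℝ (Model d) = d)

theorem contMDiff_ofReal {f : X → ℝ} (hf : ContMDiff (𝓡 d) 𝓘(ℝ) ∞ f) :
    ContMDiff (𝓡 d) 𝓘(ℝ, ℂ) ∞ fun x => (f x : ℂ) :=
  Complex.ofRealCLM.contMDiff.comp hf

theorem contMDiff_re {f : X → ℂ} (hf : ContMDiff (𝓡 d) 𝓘(ℝ, ℂ) ∞ f) :
    ContMDiff (𝓡 d) 𝓘(ℝ) ∞ fun x => (f x).re :=
  Complex.reCLM.contMDiff.comp hf

theorem contMDiff_im {f : X → ℂ} (hf : ContMDiff (𝓡 d) 𝓘(ℝ, ℂ) ∞ f) :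
    ContMDiff (𝓡 d) 𝓘(ℝ) ∞ fun x => (f x).im :=
  Complex.imCLM.contMDiff.comp hf

variable [IsManifold (𝓡 d) ∞ X]

theorem ACStructure.at_at (J : ACStructure d X) (x : X) (v : TangentSpace (𝓡 d) x) :
    J.at x (J.at x v) = -v := J.sq_eq x v

/-- The map `ξ ↦ J ξ` on vector fields. -/
def ACStructure.fieldL (J : ACStructure d X) : VField d X →ₗ[ℝ] VField d X where
  toFun := J.field
  map_add' ξ η := by
    ext x
    exact map_add (J.at x) (ξ x) (η x)
  map_smul' c ξ := by
    ext x
    exact map_smul (J.at x) c (ξ x)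

/-- The evaluation of vector fields at a point. -/
def evalField (x : X) : VField d X →ₗ[ℝ] TangentSpace (𝓡 d) x where
  toFun ξ := ξ x
  map_add' _ _ := rfl
  map_smul' _ _ := rfl

variable [T2Space X] [SecondCountableTopology X]

theorem exists_cutoff {K W : Set X} (hK : IsClosed K) (hW : IsOpen W) (hKW : K ⊆ W) :
    ∃ χ : X → ℝ, ContMDiff (𝓡 d) 𝓘(ℝ) ∞ χ ∧ (∀ᶠ x in 𝓝ˢ K, χ x = 1) ∧ (∀ x ∉ W, χ x = 0) ∧
      ∀ x, χ x ∈ Set.Icc 0 1 := by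
  obtain ⟨_, _⟩ := sigmaCompactSpace_manifold d X
  obtain ⟨f, h1, h2, h3⟩ := exists_contMDiffMap_one_nhds_of_subset_interior (n := ⊤) (𝓡 d) hK
    (t := W) (by rwa [hW.interior_eq])
  exact ⟨f, f.contMDiff, h1, h2, h3⟩

theorem exists_cutoff_compact {K W : Set X} (hK : IsCompact K) (hW : IsOpen W) (hKW : K ⊆ W) :
    ∃ χ : X → ℝ, ContMDiff (𝓡 d) 𝓘(ℝ) ∞ χ ∧ (∀ᶠ x in 𝓝ˢ K, χ x = 1) ∧ HasCompactSupport χ ∧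
      tsupport χ ⊆ W ∧ ∀ x, χ x ∈ Set.Icc 0 1 := by
  obtain ⟨_, _⟩ := sigmaCompactSpace_manifold d X
  obtain ⟨W', hW', hKW', hW'W, hc⟩ := exists_open_between_and_isCompact_closure hK hW hKW
  obtain ⟨χ, h1, h2, h3, h4⟩ := exists_cutoff (d := d) hK.isClosed hW' hKW'
  have hsub : tsupport χ ⊆ closure W' := closure_mono fun x hx => by
    by_contra h
    exact hx (h3 x h)
  exact ⟨χ, h1, h2, hc.of_isClosed_subset (isClosed_tsupport _) hsub, hsub.trans hW'W, h4⟩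

/-- The condition constrains only the fibre at x₀ and is convex, so local solutions glue: a local
extension of `v` near x₀, the zero field away from x₀. -/
theorem exists_field_eq (x₀ : X) (v : TangentSpace (𝓡 d) x₀) : ∃ ξ : VField d X, ξ x₀ = v := by
  obtain ⟨_, _⟩ := sigmaCompactSpace_manifold d X
  suffices h : ∃ ξ : VField d X, ∀ x, ξ x ∈ {w : TangentSpace (𝓡 d) x |
      x = x₀ → w = FiberBundle.extend (Model d) v x} by
    obtain ⟨ξ, hξ⟩ := h
    exact ⟨ξ, (hξ x₀ rfl).trans (FiberBundle.extend_apply_self _ _)⟩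
  refine exists_contMDiffSection_forall_mem_convex_of_local (n := ⊤) (𝓡 d)
    (F_fiber := Model d) (fun x : X => TangentSpace (𝓡 d) x) _ (fun x => ?_) (fun x => ?_)
  · intro a ha b hb s t _ _ hst hx
    rw [ha hx, hb hx, ← add_smul, hst, one_smul]
  · by_cases h : x = x₀
    · subst h
      obtain ⟨s, hs, hs'⟩ := FiberBundle.exists_contMDiffOn_extend (k := ∞) (𝓡 d) (Model d) v
      exact ⟨s, hs, _, hs', fun y _ _ => rfl⟩
    · refine ⟨{x₀}ᶜ, isOpen_compl_singleton.mem_nhds h, fun _ => 0, ?_, fun y hy hy' => (hy hy').elim⟩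
      exact (contMDiff_zeroSection ℝ (fun x : X => TangentSpace (𝓡 d) x)).contMDiffOn

/-- Extension of the tangent vectors at a point to vector fields, compatible with `J`. -/
theorem exists_complex_extension (J : ACStructure d X) (x₀ : X) :
    ∃ E : TangentSpace (𝓡 d) x₀ →ₗ[ℝ] VField d X,
      (∀ v, E v x₀ = v) ∧ ∀ v, J.field (E v) = E (J.at x₀ v) := by
  let b := Module.finBasis ℝ (TangentSpace (𝓡 d) x₀)
  choose ξ hξ using fun i => exists_field_eq x₀ (b i)
  let E' : TangentSpace (𝓡 d) x₀ →ₗ[ℝ] VField d X := b.constr ℝ ξ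
  have hE' : ∀ v, evalField x₀ (E' v) = v := by
    have : evalField x₀ ∘ₗ E' = LinearMap.id := b.ext fun i => by
      rw [LinearMap.comp_apply, Module.Basis.constr_basis]
      exact hξ i
    exact fun v => LinearMap.congr_fun this v
  have hJJ : ∀ ξ, J.fieldL (J.fieldL ξ) = -ξ := by
    intro ξ
    ext x
    exact J.at_at x (ξ x)
  have hJ0 : ∀ ξ, evalField x₀ (J.fieldL ξ) = J.at x₀ (evalField x₀ ξ) := fun _ => rfl
  -- The complex linear part of E'. Since E' evaluates to the identity at x₀, which is complex
  -- linear, taking this part does not change the value there.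
  refine ⟨(1 / 2 : ℝ) • (E' - J.fieldL ∘ₗ E' ∘ₗ J.at x₀), fun v => ?_, fun v => ?_⟩
  · change evalField x₀ ((1 / 2 : ℝ) • (E' v - J.fieldL (E' (J.at x₀ v)))) = v
    rw [map_smul, map_sub, hJ0, hE', hE', J.at_at]
    module
  · change J.fieldL ((1 / 2 : ℝ) • (E' v - J.fieldL (E' (J.at x₀ v)))) =
      (1 / 2 : ℝ) • (E' (J.at x₀ v) - J.fieldL (E' (J.at x₀ (J.at x₀ v))))
    rw [map_smul, map_sub, hJJ, J.at_at, map_neg, map_neg]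
    module

end Frames

/-! ### Local expansions of (p,p)-forms by contractions of a volume form. -/

section LocalExpansion

open Topology

variable {n : ℕ} {X : Type*} [TopologicalSpace X] [ChartedSpace (Model (2 * n)) X]
  [IsManifold (𝓡 (2 * n)) ∞ X]

theorem IsMetric.isHermForm {J : ACStructure (2 * n) X} {g : RoughForm (2 * n) X 2}
    (hg : IsMetric J g) (x : X) : IsHermForm (J.at x) (g x) :=
  ⟨J.at_at x, hg.type x, hg.pos x⟩

/-- The form `ψ (ξ₁, J ξ₁, …, ξ_q, J ξ_q, ·)`. -/
def contractField (J : ACStructure (2 * n) X) {q p : ℕ} (hN : 2 * q + 2 * p = 2 * n)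
    (ψ : RoughForm (2 * n) X (2 * n)) (ξ : Fin q → VField (2 * n) X) :
    RoughForm (2 * n) X (2 * p) := fun x =>
  contractForm hN (ψ x) (interleave (fun i => ξ i x) fun i => J.at x (ξ i x))

/-- A local expansion of the forms of type `(p, p)` near `x₀` by contractions of `ψ`. -/
structure LocalExpansion (J : ACStructure (2 * n) X) {q p : ℕ} (hN : 2 * q + 2 * p = 2 * n)
    (ψ : RoughForm (2 * n) X (2 * n)) (x₀ : X) where
  /-- the domain of the expansion -/
  U : Set X
  isOpen : IsOpen U
  mem : x₀ ∈ U
  /-- the number of terms -/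
  N : ℕ
  /-- the vector fields -/
  field : Fin N → Fin q → VField (2 * n) X
  /-- the frame in which the coefficients are computed -/
  frame : Fin (2 * n) → VField (2 * n) X
  /-- the weights of the coefficients -/
  weight : Fin N → (Fin (2 * p) → Fin (2 * n)) → X → ℂ
  weight_smooth : ∀ j s, ContMDiff (𝓡 (2 * n)) 𝓘(ℝ, ℂ) ∞ (weight j s)
  /-- the coefficients -/
  coef : Fin N → ∀ x : X, AltForm (TangentSpace (𝓡 (2 * n)) x) (2 * p) →ₗ[ℂ] ℂ
  coef_eq : ∀ j x u, coef j x u = ∑ s, weight j s x * u fun i => frame (s i) x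
  midProj_eq : ∀ x ∈ U, ∀ u, midProj (J.at x) p u =
    ∑ j, coef j x u • contractField J hN ψ (field j) x
  coef_real : ∀ x j u, IsRealForm u → (coef j x u).im = 0
  coef_rotate : ∀ x j (z : ℂ), z * (starRingEnd ℂ) z = 1 → ∀ u,
    coef j x (pullForm (rotate (J.at x) z) (2 * p) u) = coef j x u

theorem LocalExpansion.coef_smooth {J : ACStructure (2 * n) X} {q p : ℕ}
    {hN : 2 * q + 2 * p = 2 * n} {ψ : RoughForm (2 * n) X (2 * n)} {x₀ : X}
    (F : LocalExpansion J hN ψ x₀) (j : Fin F.N) {φ : RoughForm (2 * n) X (2 * p)}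
    (hφ : IsSmoothForm φ) : ContMDiff (𝓡 (2 * n)) 𝓘(ℝ, ℂ) ∞ fun x => F.coef j x (φ x) := by
  simp only [F.coef_eq]
  exact contMDiff_finsetSum fun s _ => contMDiff_complex_mul (F.weight_smooth j s) (hφ _)

theorem IsVolumeForm.isNonnegTop {J : ACStructure (2 * n) X} {ψ : RoughForm (2 * n) X (2 * n)}
    (hψ : IsVolumeForm J ψ) (x : X) : IsNonnegTop (J.at x) (ψ x) := (hψ.2 x).1.2

variable [T2Space X] [SecondCountableTopology X]

/-- The coordinates at x₀ are transported by maps `L x` from the tangent space at x₀ which commute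
with J and are bijective near x₀. Top forms being one-dimensional, `L x` pulls ψ(x) back to (κ x / κ
x₀) ψ(x₀), so contractions at x and at x₀ differ only by this scalar. -/
theorem exists_localExpansion {J : ACStructure (2 * n) X} {g : RoughForm (2 * n) X 2}
    (hg : IsMetric J g) {q p : ℕ} (hqp : q + p = n) (hN : 2 * q + 2 * p = 2 * n)
    {ψ : RoughForm (2 * n) X (2 * n)} (hψ : IsVolumeForm J ψ) (x₀ : X) :
    Nonempty (LocalExpansion J hN ψ x₀) := by
  obtain ⟨E, hE0, hEJ⟩ := exists_complex_extension J x₀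
  let b : Module.Basis (Fin (2 * n)) ℝ (TangentSpace (𝓡 (2 * n)) x₀) :=
    Module.finBasisOfFinrankEq ℝ _ (finrank_tangentSpace x₀)
  let L : ∀ x : X, TangentSpace (𝓡 (2 * n)) x₀ →ₗ[ℝ] TangentSpace (𝓡 (2 * n)) x :=
    fun x => evalField x ∘ₗ E
  have hL0 : ∀ v, L x₀ v = v := hE0
  have hLJ : ∀ x v, L x (J.at x₀ v) = J.at x (L x v) := by
    intro x v
    change E (J.at x₀ v) x = _
    rw [← hEJ]
    rfl
  have hreal : ∀ x, IsRealForm (ψ x) := fun x =>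
    (hψ.isNonnegTop x).isRealForm (hg.isHermForm x) (finrank_tangentSpace x)
  set κ : X → ℝ := fun x => (ψ x fun i => E (b i) x).re with hκ
  have hκc : ∀ x, (ψ x fun i => E (b i) x) = κ x := fun x =>
    Complex.ext rfl (by simpa using hreal x _)
  have hκs : ContMDiff (𝓡 (2 * n)) 𝓘(ℝ) ∞ κ := contMDiff_re (hψ.1 fun i => E (b i))
  have hκ0 : κ x₀ ≠ 0 := by
    intro h
    refine (hψ.2 x₀).2 (altForm_top_ext b ?_)
    have h1 := hκc x₀
    rw [h, Complex.ofReal_zero] at h1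
    rw [AlternatingMap.zero_apply, ← h1]
    exact congrArg _ (funext fun i => (hE0 _).symm)
  have hW : IsOpen {x | κ x ≠ 0} := isOpen_ne_fun hκs.continuous continuous_const
  obtain ⟨χ, hχs, hχ1, hχ0, hχ⟩ := exists_cutoff (d := 2 * n) (isClosed_singleton (x := x₀)) hW
    (Set.singleton_subset_iff.2 hκ0)
  rw [nhdsSet_singleton] at hχ1
  obtain ⟨U, hU1, hU, hx₀⟩ := eventually_nhds_iff.1
    (hχ1.and (hW.mem_nhds hκ0))
  have hden : ∀ x, κ x * κ x + (1 - χ x) ≠ 0 := by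
    intro x
    by_cases h : κ x = 0
    · rw [h, hχ0 x (by simpa using h)]
      simp
    · have := (hχ x).2
      have : 0 < κ x * κ x := mul_self_pos.2 h
      linarith
  -- A globally smooth substitute for κ x₀ / κ x: they agree where χ = 1 and κ ≠ 0, and where κ
  -- vanishes so does χ, which makes the denominator 1.
  set ρ : X → ℝ := fun x => κ x₀ * κ x / (κ x * κ x + (1 - χ x)) with hρ
  have hρs : ContMDiff (𝓡 (2 * n)) 𝓘(ℝ) ∞ ρ := by
    refine ContMDiff.div₀ (contMDiff_const.mul hκs) ((hκs.mul hκs).add ?_) hden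
    exact contMDiff_const.sub hχs
  have hρU : ∀ x ∈ U, κ x ≠ 0 ∧ ρ x = κ x₀ / κ x := by
    intro x hx
    obtain ⟨h1, h2⟩ := hU1 x hx
    have h2 : κ x ≠ 0 := h2
    refine ⟨h2, ?_⟩
    rw [hρ]
    simp only [h1, sub_self, add_zero]
    field_simp
  have hpull : ∀ x, κ x₀ • pullForm (L x) (2 * n) (ψ x) = κ x • ψ x₀ := by
    intro x
    refine altForm_top_ext b ?_
    have h1 : ψ x₀ b = κ x₀ := by
      rw [← hκc]
      exact congrArg _ (funext fun i => (hE0 _).symm)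
    have h2 : pullForm (L x) (2 * n) (ψ x) b = κ x := by
      rw [← hκc]
      rfl
    rw [AlternatingMap.smul_apply, AlternatingMap.smul_apply, h1, h2, Complex.real_smul,
      Complex.real_smul, mul_comm]
  have hsurj : ∀ x, κ x ≠ 0 → Function.Surjective (L x) := by
    intro x hx
    have hli : LinearIndependent ℝ fun i => L x (b i) := by
      by_contra h
      apply hx
      have := (ψ x).map_linearDependent _ h
      have h1 := hκc x
      rw [← Complex.ofReal_inj, ← h1, Complex.ofReal_zero]
      exact this
    have hinj : Function.Injective (L x) := by
      refine LinearMap.ker_eq_bot.1 (LinearMap.ker_eq_bot'.2 fun v hv => ?_)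
      rw [← b.sum_repr v, map_sum] at hv
      simp only [map_smul] at hv
      have := Fintype.linearIndependent_iff.1 hli _ hv
      rw [← b.sum_repr v]
      exact Finset.sum_eq_zero fun i _ => by rw [this i, zero_smul]
    exact (LinearMap.injective_iff_surjective_of_finrank_eq_finrank
      (by rw [finrank_tangentSpace, finrank_tangentSpace])).1 hinj
  obtain ⟨N, ξ, l, hl1, hl2, hl3⟩ := exists_coordinates (hg.isHermForm x₀)
    (finrank_tangentSpace x₀) hqp hN (hψ.isNonnegTop x₀) (hψ.2 x₀).2
  refine ⟨{
    U := U
    isOpen := hU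
    mem := hx₀
    N := N
    field := fun j i => E (ξ j i)
    frame := fun i => E (b i)
    weight := fun j s x => (ρ x : ℂ) * (l j (wedgeOne fun i => coordForm b (s i)) /
      (2 * p).factorial)
    weight_smooth := fun j s => contMDiff_complex_mul (contMDiff_ofReal hρs) contMDiff_const
    coef := fun j x => (ρ x : ℂ) • l j ∘ₗ pullForm (L x) (2 * p)
    coef_eq := fun j x u => ?_
    midProj_eq := fun x hx u => ?_
    coef_real := fun x j u hu => ?_
    coef_rotate := fun x j z hz u => ?_ }⟩
  · rw [LinearMap.smul_apply, LinearMap.comp_apply, altForm_eq_sum b (pullForm (L x) (2 * p) u),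
      map_sum, Finset.smul_sum]
    refine Finset.sum_congr rfl fun s _ => ?_
    rw [map_smul, smul_eq_mul, smul_eq_mul, pullForm_apply]
    change _ * (u (fun i => E (b (s i)) x) / _ * _) = _
    ring
  · obtain ⟨hκx, hρx⟩ := hρU x hx
    -- As `L x` is surjective on `U`, the identity at x may be checked after pulling back to x₀.
    have hpinj : Function.Injective (pullForm (L x) (2 * p)) := by
      intro u v huv
      ext w
      choose w' hw' using fun i => hsurj x hκx (w i)
      obtain rfl : (fun i => L x (w' i)) = w := funext hw'
      exact congrArg (fun a : AltForm _ _ => a w') huv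
    apply hpinj
    rw [pullForm_midProj (J := J.at x₀) (L x) (hLJ x), hl1, map_sum]
    refine Finset.sum_congr rfl fun j _ => ?_
    rw [map_smul, LinearMap.smul_apply, LinearMap.comp_apply, smul_eq_mul, mul_comm (ρ x : ℂ), mul_smul]
    congr 1
    have h1 : contractField J hN ψ (fun i => E (ξ j i)) x = contractForm hN (ψ x)
        fun a => L x (interleave (ξ j) (fun i => J.at x₀ (ξ j i)) a) := by
      rw [comp_interleave, contractField]
      congr 2
      funext i
      exact (hLJ x _).symm
    rw [h1, ← contractForm_pullForm]
    have h2 : pullForm (L x) (2 * n) (ψ x) = (κ x / κ x₀) • ψ x₀ := by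
      have := congrArg (fun a => (κ x₀)⁻¹ • a) (hpull x)
      simp only [smul_smul, inv_mul_cancel₀ hκ0, one_smul] at this
      rw [this, div_eq_inv_mul]
    rw [h2]
    ext w
    change _ = (ρ x : ℂ) * ((κ x / κ x₀) • contractForm hN (ψ x₀) _ w)
    rw [hρx, Complex.real_smul, ← mul_assoc, ← Complex.ofReal_mul]
    have : κ x₀ / κ x * (κ x / κ x₀) = 1 := by field_simp
    rw [this, Complex.ofReal_one, one_mul]
  · rw [LinearMap.smul_apply, LinearMap.comp_apply, smul_eq_mul, Complex.im_ofReal_mul]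
    exact mul_eq_zero_of_right _ (hl2 j _ fun v => hu _)
  · rw [LinearMap.smul_apply, LinearMap.smul_apply, LinearMap.comp_apply, LinearMap.comp_apply]
    congr 1
    have : pullForm (L x) (2 * p) (pullForm (rotate (J.at x) z) (2 * p) u) =
        pullForm (rotate (J.at x₀) z) (2 * p) (pullForm (L x) (2 * p) u) := by
      ext w
      simp only [pullForm_apply, rotate_apply, map_add, map_smul, hLJ]
    rw [this, hl3 z hz]

end LocalExpansion


section SmoothForms

open Topology

/-! ### Smooth forms and test functions -/

variable {d : ℕ} {X : Type*} [TopologicalSpace X] [ChartedSpace (Model d) X]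

/-- The test function with given real values. -/
def TestFun.ofReal (f : X → ℝ) (hf : ContMDiff (𝓡 d) 𝓘(ℝ) ∞ f) (hc : HasCompactSupport f) :
    TestFun d X :=
  ⟨fun x => (f x : ℂ), contMDiff_ofReal hf, hc.comp_left (g := ((↑) : ℝ → ℂ)) Complex.ofReal_zero⟩

/-- The product of a test function and a smooth function. -/
def TestFun.mul (f : TestFun d X) (h : X → ℂ) (hh : ContMDiff (𝓡 d) 𝓘(ℝ, ℂ) ∞ h) : TestFun d X :=
  ⟨fun x => f.toFun x * h x, contMDiff_complex_mul f.smooth hh, f.compact.mul_right⟩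

@[simp] theorem TestFun.mul_toFun (f : TestFun d X) (h : X → ℂ)
    (hh : ContMDiff (𝓡 d) 𝓘(ℝ, ℂ) ∞ h) (x : X) : (f.mul h hh).toFun x = f.toFun x * h x := rfl

theorem TestFun.tsupport_mul_subset (f : TestFun d X) (h : X → ℂ)
    (hh : ContMDiff (𝓡 d) 𝓘(ℝ, ℂ) ∞ h) : tsupport (f.mul h hh).toFun ⊆ tsupport h :=
  closure_mono fun x hx h0 => hx (by simp [h0])

theorem TestFun.tsupport_mul_subset_left (f : TestFun d X) (h : X → ℂ)
    (hh : ContMDiff (𝓡 d) 𝓘(ℝ, ℂ) ∞ h) : tsupport (f.mul h hh).toFun ⊆ tsupport f.toFun :=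
  closure_mono fun x hx h0 => hx (by simp [h0])

variable [IsManifold (𝓡 d) ∞ X]

theorem IsSmoothForm.add {k : ℕ} {u v : RoughForm d X k} (hu : IsSmoothForm u)
    (hv : IsSmoothForm v) : IsSmoothForm fun x => u x + v x := fun ξ => (hu ξ).add (hv ξ)

theorem IsSmoothForm.smul {k : ℕ} {u : RoughForm d X k} (hu : IsSmoothForm u) {f : X → ℂ}
    (hf : ContMDiff (𝓡 d) 𝓘(ℝ, ℂ) ∞ f) : IsSmoothForm fun x => f x • u x :=
  fun ξ => contMDiff_complex_mul hf (hu ξ)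

theorem IsSmoothForm.sub {k : ℕ} {u v : RoughForm d X k} (hu : IsSmoothForm u)
    (hv : IsSmoothForm v) : IsSmoothForm fun x => u x - v x := fun ξ => (hu ξ).sub (hv ξ)

theorem IsSmoothForm.sum {k : ℕ} {ι : Type*} {s : Finset ι} {u : ι → RoughForm d X k}
    (hu : ∀ i, IsSmoothForm (u i)) : IsSmoothForm fun x => ∑ i ∈ s, u i x := fun ξ => by
  simp only [altForm_sum_apply]
  exact contMDiff_finsetSum fun i _ => hu i ξ

theorem IsSmoothForm.contract {m k N : ℕ} (h : m + k = N) {u : RoughForm d X N}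
    (hu : IsSmoothForm u) (ξ : Fin m → VField d X) :
    IsSmoothForm fun x => contractForm h (u x) fun j => ξ j x := fun η => by
  convert! hu (Fin.append ξ η ∘ Fin.cast h.symm) using 2 with x
  refine congrArg (u x) (funext fun a => ?_)
  subst h
  refine Fin.addCases (fun c => ?_) (fun c => ?_) a <;> simp

theorem IsSmoothForm.typeProj {J : ACStructure d X} {p : ℕ} {u : RoughForm d X (2 * p)}
    (hu : IsSmoothForm u) (r : ℕ) : IsSmoothForm fun x => typeProj (J.at x) p r (u x) := by
  simp only [typeProj_apply]
  refine IsSmoothForm.smul (.sum fun k => IsSmoothForm.smul ?_ contMDiff_const) contMDiff_const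
  intro ξ
  set z := unitRoot p ^ k.val
  exact hu fun i => z.re • ξ i + z.im • J.field (ξ i)

theorem IsSmoothForm.midProj {J : ACStructure d X} {p : ℕ} {u : RoughForm d X (2 * p)}
    (hu : IsSmoothForm u) : IsSmoothForm fun x => midProj (J.at x) p (u x) := hu.typeProj p

/-! ### Pairing with a current of bidimension `(p, p)` -/

variable {J : ACStructure d X} {p : ℕ} {Θ : Current d X (2 * p)}

/-- The type projections preserve smoothness and compact support, so a test form is the sum of its
typed parts as test forms; Θ kills all of them but the middle one. -/
theorem Current.HasBidimension.eq_midProj (hΘ : Θ.HasBidimension J) {u v : TestForm d X (2 * p)}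
    (h : ∀ x, v.1 x = AlmostComplex.midProj (J.at x) p (u.1 x)) : Θ.toFun u = Θ.toFun v := by
  have hmem : ∀ r : ℕ, (fun x => AlmostComplex.typeProj (J.at x) p r (u.1 x)) ∈ TestForm d X (2 * p) := by
    refine fun r => ⟨u.2.1.typeProj r, u.2.2.of_isClosed_subset isClosed_closure
      (closure_mono fun x hx h0 => hx ?_)⟩
    simp [h0]
  have hsum : u = ∑ r ∈ Finset.range (2 * p + 1), (⟨_, hmem r⟩ : TestForm d X (2 * p)) := by
    refine Subtype.ext (funext fun x => ?_)
    rw [AddSubmonoidClass.coe_finsetSum, Finset.sum_apply]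
    exact (sum_typeProj (J.at_at x) (u.1 x)).symm
  rw [hsum, map_sum, Finset.sum_eq_single p]
  · exact congrArg _ (Subtype.ext (funext fun x => (h x).symm))
  · intro r hr hrp
    refine hΘ r (2 * p - r) (fun e => hrp (Prod.ext_iff.1 e).1) _ fun x => ?_
    exact typeProj_mem (J.at_at x) (by simpa [Nat.lt_succ_iff] using hr) _
  · intro h
    exact absurd (Finset.mem_range.2 (by omega)) h

theorem Current.wedge_eq_sum_of_midProj (hΘ : Θ.HasBidimension J) {φ : RoughForm d X (2 * p)}
    (hφ : IsSmoothForm φ) (f : TestFun d X) {ι : Type*} (s : Finset ι)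
    {β : ι → RoughForm d X (2 * p)} (hβ : ∀ i, IsSmoothForm (β i)) (k : ι → TestFun d X)
    (h : ∀ x, f.toFun x • AlmostComplex.midProj (J.at x) p (φ x) =
      ∑ i ∈ s, (k i).toFun x • AlmostComplex.midProj (J.at x) p (β i x)) :
    Θ.wedge φ hφ f = ∑ i ∈ s, Θ.wedge (β i) (hβ i) (k i) := by
  simp only [Current.wedge, ← map_sum]
  have h1 : (f.mulForm (fun x => AlmostComplex.midProj (J.at x) p (φ x)) hφ.midProj) =
      ∑ i ∈ s, (k i).mulForm (fun x => AlmostComplex.midProj (J.at x) p (β i x)) (hβ i).midProj := by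
    refine Subtype.ext (funext fun x => ?_)
    rw [AddSubmonoidClass.coe_finsetSum, Finset.sum_apply]
    exact h x
  rw [hΘ.eq_midProj (v := f.mulForm _ hφ.midProj) fun x => ?_,
    hΘ.eq_midProj (u := ∑ i ∈ s, (k i).mulForm (β i) (hβ i))
      (v := ∑ i ∈ s, (k i).mulForm _ (hβ i).midProj) fun x => ?_, h1]
  · rw [AddSubmonoidClass.coe_finsetSum, AddSubmonoidClass.coe_finsetSum, Finset.sum_apply,
      Finset.sum_apply, map_sum]
    exact Finset.sum_congr rfl fun i _ => (map_smul (AlmostComplex.midProj (J.at x) p) _ _).symm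
  · exact (map_smul (AlmostComplex.midProj (J.at x) p) _ _).symm

theorem Current.wedge_eq_sum {k : ℕ} (Θ : Current d X k) {φ : RoughForm d X k}
    (hφ : IsSmoothForm φ) (f : TestFun d X) {ι : Type*} (s : Finset ι)
    {β : ι → RoughForm d X k} (hβ : ∀ i, IsSmoothForm (β i)) (t : ι → TestFun d X)
    (h : ∀ x, f.toFun x • φ x = ∑ i ∈ s, (t i).toFun x • β i x) :
    Θ.wedge φ hφ f = ∑ i ∈ s, Θ.wedge (β i) (hβ i) (t i) := by
  simp only [Current.wedge, ← map_sum]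
  refine congrArg _ (Subtype.ext (funext fun x => ?_))
  rw [AddSubmonoidClass.coe_finsetSum, Finset.sum_apply]
  exact h x

theorem Current.evalMul_eq_wedge {m k : ℕ} (h : m + k = d) (Θ : Current d X k)
    (ξ : Fin m → VField d X) (ψ : RoughForm d X d) (hψ : IsSmoothForm ψ) :
    Θ.evalMul h ξ ψ hψ = Θ.wedge _ (hψ.contract h ξ) := by
  funext f
  exact congrArg Θ.toFun (Subtype.ext (funext fun x => by ext v; rfl))

end SmoothForms

/-! ### Powers of the metric and contractions by smooth fields. -/

section Metric

variable {n : ℕ} {X : Type*} [TopologicalSpace X] [ChartedSpace (Model (2 * n)) X]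
  [IsManifold (𝓡 (2 * n)) ∞ X] {J : ACStructure (2 * n) X} {g : RoughForm (2 * n) X 2}

theorem interleave_field {q : ℕ} (ξ : Fin q → VField (2 * n) X) (x : X) :
    (fun a => interleave ξ (fun i => J.field (ξ i)) a x) =
      interleave (fun i => ξ i x) fun i => J.at x (ξ i x) :=
  comp_interleave (fun η : VField (2 * n) X => η x) _ _

theorem contractField_eq {q p : ℕ} (hN : 2 * q + 2 * p = 2 * n) (ψ : RoughForm (2 * n) X (2 * n))
    (ξ : Fin q → VField (2 * n) X) : contractField J hN ψ ξ = fun x => contractForm hN (ψ x)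
      fun a => interleave ξ (fun i => J.field (ξ i)) a x := by
  funext x
  rw [interleave_field]
  rfl

theorem isSmoothForm_contractField {q p : ℕ} (hN : 2 * q + 2 * p = 2 * n)
    {ψ : RoughForm (2 * n) X (2 * n)} (hψ : IsSmoothForm ψ) (ξ : Fin q → VField (2 * n) X) :
    IsSmoothForm (contractField J hN ψ ξ) := by
  rw [contractField_eq]
  exact hψ.contract hN _

/-- The bridge between the evaluations of Θ on fields in (a) and (b) and the wedge products in (c).
-/
theorem Current.evalMul_interleave {q p : ℕ} (hN : 2 * q + 2 * p = 2 * n)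
    (Θ : Current (2 * n) X (2 * p)) (ξ : Fin q → VField (2 * n) X)
    (ψ : RoughForm (2 * n) X (2 * n)) (hψ : IsSmoothForm ψ) :
    Θ.evalMul hN (interleave ξ fun i => J.field (ξ i)) ψ hψ =
      Θ.wedge (contractField J hN ψ ξ) (isSmoothForm_contractField hN hψ ξ) := by
  rw [Current.evalMul_eq_wedge]
  congr 1
  exact (contractField_eq hN ψ ξ).symm

theorem IsMetric.isStronglyPositive_powForm (hg : IsMetric J g) (p : ℕ) (x : X) :
    IsStronglyPositive (J.at x) (powForm g p x) := by
  obtain ⟨e, α, h, -⟩ := exists_unitaryFrame (hg.isHermForm x) (finrank_tangentSpace x) fun _ => 0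
  exact h.isStronglyPositive_dividedPower (hg.isHermForm x) p

theorem IsMetric.isVolumeForm (hg : IsMetric J g) : IsVolumeForm J (powForm g n) := by
  refine ⟨isSmoothForm_powForm hg.smooth n, fun x => ⟨⟨?_, ?_⟩, fun h0 => ?_⟩⟩
  · exact (hg.isStronglyPositive_powForm n x).mem (J.at_at x)
  · exact (hg.isStronglyPositive_powForm n x).apply_nonneg
  · obtain ⟨e, α, h, -⟩ := exists_unitaryFrame (hg.isHermForm x) (finrank_tangentSpace x) fun _ => 0
    have h1 := h.dividedPower_apply_frame (hg.isHermForm x)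
    rw [show dividedPower (g x) n = 0 from h0] at h1
    exact (Complex.ofReal_ne_zero.2 (topConst_pos n).ne') h1.symm

theorem IsMetric.isStronglyPositive_contractField (hg : IsMetric J g) {q p : ℕ} (hqp : q + p = n)
    (hN : 2 * q + 2 * p = 2 * n) {ψ : RoughForm (2 * n) X (2 * n)}
    (hψ : ∀ x, IsNonnegTop (J.at x) (ψ x)) (ξ : Fin q → VField (2 * n) X) (x : X) :
    IsStronglyPositive (J.at x) (contractField J hN ψ ξ x) :=
  isStronglyPositive_contract (hg.isHermForm x) (finrank_tangentSpace x) hqp hN (hψ x) _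

/-- The function `x ↦ det (h_x (ξ_i, ξ_j))`. -/
def gramField (J : ACStructure (2 * n) X) (g : RoughForm (2 * n) X 2) {q : ℕ}
    (ξ : Fin q → VField (2 * n) X) (x : X) : ℝ := gramDet (J.at x) (g x) fun i => ξ i x

theorem contMDiff_gramField (hg : IsSmoothForm g) {q : ℕ} (ξ : Fin q → VField (2 * n) X) :
    ContMDiff (𝓡 (2 * n)) 𝓘(ℝ) ∞ (gramField J g ξ) := by
  refine contMDiff_re (f := fun x => _) ?_
  simp only [Matrix.det_apply]
  refine contMDiff_finsetSum fun σ _ => ?_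
  simp only [Units.smul_def, zsmul_eq_mul]
  refine contMDiff_complex_mul contMDiff_const (contMDiff_prod_complex _ fun i => ?_)
  have h2 : ∀ a b : VField (2 * n) X, ContMDiff (𝓡 (2 * n)) 𝓘(ℝ, ℂ) ∞ fun x => g x ![a x, b x] := by
    intro a b
    convert! hg ![a, b] using 2 with x
    refine congrArg (g x) (funext fun a => ?_)
    fin_cases a <;> rfl
  exact (h2 _ (J.field _)).add (contMDiff_complex_mul contMDiff_const (h2 _ _))

theorem IsMetric.isStronglyPositive_dominate (hg : IsMetric J g) {q p : ℕ} (hqp : q + p = n)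
    (hN : 2 * q + 2 * p = 2 * n) (ξ : Fin q → VField (2 * n) X) (x : X) :
    IsStronglyPositive (J.at x) (((p.factorial * topConst n * gramField J g ξ x : ℝ) : ℂ) •
      powForm g p x - contractField J hN (powForm g n) ξ x) :=
  AlmostComplex.isStronglyPositive_dominate (hg.isHermForm x) (finrank_tangentSpace x) hqp hN _

end Metric


section Functionals

open Topology

/-! ### Positive functionals on test functions -/

variable {d : ℕ} {X : Type*} [TopologicalSpace X] [ChartedSpace (Model d) X]

/-- Linearity of a functional on test functions. -/
structure IsLinearTest (L : TestFun d X → ℂ) : Prop where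
  add : ∀ f g h : TestFun d X, (∀ x, h.toFun x = f.toFun x + g.toFun x) → L h = L f + L g
  smul : ∀ (c : ℂ) (f h : TestFun d X), (∀ x, h.toFun x = c * f.toFun x) → L h = c * L f

theorem IsLinearTest.zero {L : TestFun d X → ℂ} (hL : IsLinearTest L) (f : TestFun d X)
    (hf : ∀ x, f.toFun x = 0) : L f = 0 := by
  simpa using hL.smul 0 f f fun x => by simp [hf]

theorem IsLinearTest.sum {L : TestFun d X → ℂ} (hL : IsLinearTest L) {ι : Type*} (s : Finset ι)
    (k : ι → TestFun d X) (f : TestFun d X) (hf : ∀ x, f.toFun x = ∑ i ∈ s, (k i).toFun x) :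
    L f = ∑ i ∈ s, L (k i) := by
  classical
  induction s using Finset.induction_on generalizing f with
  | empty => exact hL.zero f fun x => by simp [hf]
  | insert i s hi ih =>
    have hs : ContMDiff (𝓡 d) 𝓘(ℝ, ℂ) ∞ fun x => f.toFun x - (k i).toFun x :=
      f.smooth.sub (k i).smooth
    have hc : HasCompactSupport fun x => f.toFun x - (k i).toFun x := f.compact.sub (k i).compact
    rw [Finset.sum_insert hi, hL.add (k i) ⟨_, hs, hc⟩ f fun x => by simp,
      ih ⟨_, hs, hc⟩ fun x => by simp [hf, Finset.sum_insert hi]]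

theorem Current.isLinearTest_wedge [IsManifold (𝓡 d) ∞ X] {k : ℕ} (Θ : Current d X k)
    {φ : RoughForm d X k} (hφ : IsSmoothForm φ) : IsLinearTest (Θ.wedge φ hφ) := by
  constructor
  · intro f g h e
    refine (Θ.wedge_eq_sum hφ h (Finset.univ : Finset (Fin 2)) (β := fun _ => φ) (fun _ => hφ)
      ![f, g] fun x => ?_).trans (by simp)
    simp [e, add_smul]
  · intro c f h e
    refine (congrArg Θ.toFun (Subtype.ext (funext fun x => ?_))).trans
      ((Θ.toFun.map_smul c (f.mulForm φ hφ)).trans rfl)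
    change h.toFun x • φ x = c • f.toFun x • φ x
    rw [e, mul_smul]

variable [T2Space X] [SecondCountableTopology X]

theorem exists_finite_partition [IsManifold (𝓡 d) ∞ X] {K : Set X} (hK : IsCompact K) {ι : Type*}
    (U : ι → Set X) (hU : ∀ i, IsOpen (U i)) (hKU : K ⊆ ⋃ i, U i) :
    ∃ (t : Finset ι) (ρ : ι → X → ℝ), (∀ i, ContMDiff (𝓡 d) 𝓘(ℝ) ∞ (ρ i)) ∧ (∀ i x, 0 ≤ ρ i x) ∧
      (∀ i ∈ t, tsupport (ρ i) ⊆ U i) ∧ ∀ x ∈ K, ∑ i ∈ t, ρ i x = 1 := by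
  classical
  obtain ⟨_, _⟩ := sigmaCompactSpace_manifold d X
  obtain ⟨t, ht⟩ := hK.elim_finite_subcover U hU hKU
  obtain ⟨ρ, hρ⟩ := SmoothPartitionOfUnity.exists_isSubordinate (𝓡 d) hK.isClosed
    (fun i : t => U i) (fun i => hU i) (ht.trans (Set.iUnion₂_subset fun i hi =>
      Set.subset_iUnion (fun i : t => U i) ⟨i, hi⟩))
  refine ⟨t, fun i => if h : i ∈ t then ρ ⟨i, h⟩ else fun _ => 0, fun i => ?_, fun i x => ?_,
    fun i hi => ?_, fun x hx => ?_⟩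
  · by_cases h : i ∈ t
    · simp only [dif_pos h]
      exact (ρ ⟨i, h⟩).contMDiff
    · simp only [dif_neg h]
      exact contMDiff_const
  · by_cases h : i ∈ t
    · simp only [dif_pos h]
      exact ρ.nonneg _ x
    · simp only [dif_neg h]
      exact le_rfl
  · simp only [dif_pos hi]
    exact hρ ⟨i, hi⟩
  · rw [← ρ.sum_eq_one hx, finsum_eq_sum_of_fintype, ← Finset.sum_coe_sort t]
    exact Finset.sum_congr rfl fun i _ => by simp

/-- Cut `f` by a finite smooth partition of unity on its support. Recording that the pieces are
supported inside the support of `f` allows two successive localizations. -/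
theorem IsLinearTest.nonneg_of_local [IsManifold (𝓡 d) ∞ X] {L : TestFun d X → ℂ} (hL : IsLinearTest L)
    {f : TestFun d X} (hf : ∀ x, 0 ≤ f.toFun x)
    (h : ∀ y ∈ tsupport f.toFun, ∃ U, IsOpen U ∧ y ∈ U ∧ ∀ k : TestFun d X, (∀ x, 0 ≤ k.toFun x) →
      tsupport k.toFun ⊆ U → tsupport k.toFun ⊆ tsupport f.toFun → 0 ≤ L k) : 0 ≤ L f := by
  choose U hU hyU hk using fun y : tsupport f.toFun => h y y.2
  obtain ⟨t, ρ, h1, h2, h3, h4⟩ := exists_finite_partition (d := d) f.compact.isCompact U hU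
    fun y hy => Set.mem_iUnion.2 ⟨⟨y, hy⟩, hyU _⟩
  rw [hL.sum t (fun i => f.mul (fun x => (ρ i x : ℂ)) (contMDiff_ofReal (h1 i))) f fun x => ?_]
  · refine Finset.sum_nonneg fun i hi => hk i _ (fun x => ?_) ?_ (f.tsupport_mul_subset_left _ _)
    · exact mul_nonneg (hf x) (Complex.zero_le_real.2 (h2 i x))
    · refine (f.tsupport_mul_subset _ _).trans (closure_mono ?_ |>.trans (h3 i hi))
      exact fun x hx h0 => hx (by simp [h0])
  · simp only [TestFun.mul_toFun]
    rw [← Finset.mul_sum, ← Complex.ofReal_sum]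
    by_cases hx : x ∈ tsupport f.toFun
    · rw [h4 x hx, Complex.ofReal_one, mul_one]
    · rw [image_eq_zero_of_notMem_tsupport hx, zero_mul]

-- M. Riesz extension carries the functional from smooth to continuous compactly supported real
-- functions, preserving positivity; it applies because each continuous function is dominated by a
-- multiple of a smooth cutoff. The measure is then that of Riesz–Markov–Kakutani. Continuity of `L`
-- is not needed.
open CompactlySupported in
theorem IsLinearTest.exists_measure [IsManifold (𝓡 d) ∞ X] [MeasurableSpace X] [BorelSpace X]
    {L : TestFun d X → ℂ} (hL : IsLinearTest L)
    (hpos : ∀ f : TestFun d X, (∀ x, 0 ≤ f.toFun x) → 0 ≤ L f) :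
    ∃ μ : Measure X, IsPositiveRadon L μ := by
  obtain ⟨_, _⟩ := sigmaCompactSpace_manifold d X
  let S : Submodule ℝ C_c(X, ℝ) :=
    { carrier := {f | ContMDiff (𝓡 d) 𝓘(ℝ) ∞ f}
      zero_mem' := contMDiff_const
      add_mem' := fun ha hb => ha.add hb
      smul_mem' := fun c a (ha : ContMDiff (𝓡 d) 𝓘(ℝ) ∞ a) =>
        ContMDiff.mul (f := fun _ => c) contMDiff_const ha }
  let T : S → TestFun d X := fun f => .ofReal f.1 f.2 f.1.hasCompactSupport
  let Λ₀ : C_c(X, ℝ) →ₗ.[ℝ] ℝ := ⟨S,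
    { toFun := fun f => (L (T f)).re
      map_add' := fun f g => by
        rw [← Complex.add_re]
        exact congrArg _ (hL.add _ _ _ fun x => Complex.ofReal_add _ _)
      map_smul' := fun c f => by
        rw [RingHom.id_apply, smul_eq_mul, ← Complex.re_ofReal_mul]
        exact congrArg _ (hL.smul _ _ _ fun x => Complex.ofReal_mul _ _) }⟩
  let P : PointedCone ℝ C_c(X, ℝ) :=
    { carrier := {f | ∀ x, 0 ≤ f x}
      zero_mem' := fun x => le_rfl
      add_mem' := fun ha hb x => add_nonneg (ha x) (hb x)
      smul_mem' := fun c a ha x => mul_nonneg c.2 (ha x) }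
  obtain ⟨Λ, hΛ, hΛ0⟩ := riesz_extension P Λ₀
    (fun f hf => (Complex.le_def.1 (hpos (T f) fun x => Complex.zero_le_real.2 (hf x))).1) (by
      intro y
      obtain ⟨χ, h1, h2, h3, -, h4⟩ := exists_cutoff_compact (d := d) y.hasCompactSupport.isCompact
        isOpen_univ (Set.subset_univ _)
      obtain ⟨C, hC⟩ := y.hasCompactSupport.exists_bound_of_continuous y.continuous
      refine ⟨⟨C • ⟨⟨χ, h1.continuous⟩, h3⟩, ContMDiff.mul (f := fun _ => C) contMDiff_const h1⟩, fun x => ?_⟩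
      change 0 ≤ C * χ x + y x
      by_cases hx : x ∈ tsupport y
      · rw [h2.self_of_nhdsSet x hx, mul_one]
        linarith [(abs_le.1 (hC x)).1]
      · rw [image_eq_zero_of_notMem_tsupport hx, add_zero]
        exact mul_nonneg ((norm_nonneg _).trans (hC x)) (h4 x).1)
  -- `L` is real on nonnegative functions, and f = (f + u) - u with both functions nonnegative once
  -- `u` is a large multiple of a cutoff.
  have hreal : ∀ f : S, L (T f) = ((L (T f)).re : ℂ) := by
    intro f
    obtain ⟨χ, h1, h2, h3, -, h4⟩ := exists_cutoff_compact (d := d) f.1.hasCompactSupport.isCompact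
      isOpen_univ (Set.subset_univ _)
    obtain ⟨C, hC⟩ := f.1.hasCompactSupport.exists_bound_of_continuous f.1.continuous
    let u : S := ⟨C • ⟨⟨χ, h1.continuous⟩, h3⟩, ContMDiff.mul (f := fun _ => C) contMDiff_const h1⟩
    have hux : ∀ x, (u.1 : X → ℝ) x = C * χ x := fun x => rfl
    have hu0 : ∀ x, 0 ≤ u.1 x := fun x =>
      mul_nonneg ((norm_nonneg _).trans (hC x)) (h4 x).1
    have huf : ∀ x, 0 ≤ (f + u).1 x := by
      intro x
      change 0 ≤ f.1 x + u.1 x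
      by_cases hx : x ∈ tsupport f.1
      · rw [hux, h2.self_of_nhdsSet x hx, mul_one]
        linarith [(abs_le.1 (hC x)).1]
      · rw [image_eq_zero_of_notMem_tsupport hx, zero_add]
        exact hu0 x
    have e : L (T (f + u)) = L (T f) + L (T u) := hL.add _ _ _ fun x => Complex.ofReal_add _ _
    have e1 := (Complex.le_def.1 (hpos (T (f + u)) fun x => Complex.zero_le_real.2 (huf x))).2
    have e2 := (Complex.le_def.1 (hpos (T u) fun x => Complex.zero_le_real.2 (hu0 x))).2
    refine Complex.ext rfl ?_
    rw [e, Complex.add_im, ← e2] at e1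
    simpa using e1.symm
  let Λ' : C_c(X, ℝ) →ₚ[ℝ] ℝ := .mk₀ Λ hΛ0
  have hint : ∀ f : S, L (T f) = ((∫ x, f.1 x ∂(RealRMK.rieszMeasure Λ') : ℝ) : ℂ) := by
    intro f
    rw [RealRMK.integral_rieszMeasure, hreal f]
    exact congrArg _ (hΛ f).symm
  refine ⟨RealRMK.rieszMeasure Λ', inferInstance, fun f => ?_⟩
  have hc : ∀ l : ℂ →L[ℝ] ℝ, HasCompactSupport fun x => l (f.toFun x) := fun l =>
    f.compact.comp_left (map_zero l)
  let F : (ℂ →L[ℝ] ℝ) → S := fun l =>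
    ⟨⟨⟨fun x => l (f.toFun x), l.continuous.comp f.smooth.continuous⟩, hc l⟩,
      l.contMDiff.comp f.smooth⟩
  let G : TestFun d X := ⟨fun x => Complex.I * ((f.toFun x).im : ℂ),
    contMDiff_complex_mul contMDiff_const (contMDiff_ofReal (contMDiff_im f.smooth)),
    HasCompactSupport.mul_left (f := fun _ => Complex.I) (T (F Complex.imCLM)).compact⟩
  rw [hL.add (T (F Complex.reCLM)) G f fun x => ?_,
    hL.smul Complex.I (T (F Complex.imCLM)) G fun x => rfl, hint, hint]
  · have hfi : Integrable f.toFun (RealRMK.rieszMeasure Λ') :=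
      f.smooth.continuous.integrable_of_hasCompactSupport f.compact
    have := integral_re_add_im hfi
    rw [← this, mul_comm]
    rfl
  · change f.toFun x = ((f.toFun x).re : ℂ) + Complex.I * ((f.toFun x).im : ℂ)
    rw [mul_comm, Complex.re_add_im]

end Functionals


section Measures

/-! ### Functionals given by complex Radon measures -/

theorem isLocallyFiniteMeasure_add {X : Type*} [TopologicalSpace X] [MeasurableSpace X]
    {ν ν' : Measure X} (h : IsLocallyFiniteMeasure ν) (h' : IsLocallyFiniteMeasure ν') :
    IsLocallyFiniteMeasure (ν + ν') := by
  refine ⟨fun x => ?_⟩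
  obtain ⟨s, hs, hs'⟩ := ν.finiteAt_nhds x
  obtain ⟨t, ht, ht'⟩ := ν'.finiteAt_nhds x
  refine ⟨s ∩ t, Filter.inter_mem hs ht, ?_⟩
  rw [Measure.add_apply]
  exact ENNReal.add_lt_top.2 ⟨(measure_mono Set.inter_subset_left).trans_lt hs',
    (measure_mono Set.inter_subset_right).trans_lt ht'⟩

theorem ae_nonneg_of_setIntegral {X : Type*} [MeasurableSpace X] {μ : Measure X} {c : X → ℂ}
    (hc : Integrable c μ) (h : ∀ A, MeasurableSet A → 0 ≤ ∫ x in A, c x ∂μ) :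
    ∀ᵐ x ∂μ, 0 ≤ c x := by
  have h1 : 0 ≤ᵐ[μ] fun x => (c x).re := by
    refine ae_nonneg_of_forall_setIntegral_nonneg hc.re fun A hA _ => ?_
    have := (Complex.le_def.1 (h A hA)).1
    rwa [← RCLike.re_eq_complex_re, ← integral_re hc.integrableOn] at this
  have h2 : (fun x => (c x).im) =ᵐ[μ] 0 := by
    refine hc.im.ae_eq_zero_of_forall_setIntegral_eq_zero fun A hA _ => ?_
    have := (Complex.le_def.1 (h A hA)).2
    rw [← RCLike.im_eq_complex_im, ← integral_im hc.integrableOn] at this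
    exact this.symm.trans Complex.zero_im
  filter_upwards [h1, h2] with x hx hx'
  exact Complex.le_def.2 ⟨hx, hx'.symm⟩

variable {d : ℕ} {X : Type*} [TopologicalSpace X] [ChartedSpace (Model d) X] [MeasurableSpace X]

theorem IsPositiveRadon.isComplexRadon {L : TestFun d X → ℂ} {ν : Measure X}
    (h : IsPositiveRadon L ν) [OpensMeasurableSpace X] : IsComplexRadon L ν fun _ => 1 :=
  have := h.1
  ⟨h.1, locallyIntegrable_const 1, fun f => by simpa using h.2 f⟩

variable [T2Space X] [BorelSpace X]

theorem locallyIntegrable_rnDeriv_smul_iff [LocallyCompactSpace X] {ν m : Measure X}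
    [SigmaFinite ν] [SigmaFinite m] (hac : ν ≪ m) (c : X → ℂ) :
    LocallyIntegrable (fun x => (ν.rnDeriv m x).toReal • c x) m ↔ LocallyIntegrable c ν := by
  rw [locallyIntegrable_iff, locallyIntegrable_iff]
  refine forall₂_congr fun K hK => ?_
  rw [← integrable_indicator_iff hK.measurableSet, ← integrable_indicator_iff hK.measurableSet,
    ← integrable_rnDeriv_smul_iff hac]
  refine Iff.of_eq (congrArg (Integrable · m) (funext fun x => ?_))
  by_cases hx : x ∈ K <;> simp [hx]

variable [SecondCountableTopology X]

theorem isComplexRadon_rnDeriv_smul_iff {L : TestFun d X → ℂ} {ν m : Measure X}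
    [IsLocallyFiniteMeasure ν] [IsLocallyFiniteMeasure m] (hac : ν ≪ m) (c : X → ℂ) :
    IsComplexRadon L m (fun x => (ν.rnDeriv m x).toReal • c x) ↔ IsComplexRadon L ν c := by
  have := ChartedSpace.locallyCompactSpace (Model d) X
  unfold IsComplexRadon
  rw [locallyIntegrable_rnDeriv_smul_iff hac]
  refine and_congr (iff_of_true ‹_› ‹_›) (and_congr Iff.rfl (forall_congr' fun f => ?_))
  rw [← integral_rnDeriv_smul hac]
  simp only [mul_smul_comm]

variable [IsManifold (𝓡 d) ∞ X]

theorem IsComplexRadon.ae_eq {L : TestFun d X → ℂ} {μ : Measure X} {c c' : X → ℂ}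
    (h : IsComplexRadon L μ c) (h' : IsComplexRadon L μ c') : c =ᵐ[μ] c' := by
  obtain ⟨_, _⟩ := sigmaCompactSpace_manifold d X
  refine ae_eq_of_integral_contMDiff_smul_eq (𝓡 d) h.2.1 h'.2.1 fun f hf hfc => ?_
  exact (h.2.2 (.ofReal f hf hfc)).symm.trans (h'.2.2 (.ofReal f hf hfc))

/-- The same functional has many presentations c·ν. Over the common measure ν + ν' the density is
determined almost everywhere by test functions, so integrals over sets depend on `L` alone. Hence
the presentation chosen in `Current.IsMass` is immaterial. -/
theorem IsComplexRadon.setIntegral_eq {L : TestFun d X → ℂ} {ν ν' : Measure X} {c c' : X → ℂ}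
    (h : IsComplexRadon L ν c) (h' : IsComplexRadon L ν' c') (A : Set X) :
    ∫ x in A, c x ∂ν = ∫ x in A, c' x ∂ν' := by
  have := ChartedSpace.locallyCompactSpace (Model d) X
  have := h.1
  have := h'.1
  have hac : ν ≪ ν + ν' := Measure.AbsolutelyContinuous.rfl.add_right ν'
  have := isLocallyFiniteMeasure_add h.1 h'.1
  have hac' : ν' ≪ ν + ν' := by
    rw [add_comm]
    exact Measure.AbsolutelyContinuous.rfl.add_right ν
  have e := ((isComplexRadon_rnDeriv_smul_iff hac c).2 h).ae_eq
    ((isComplexRadon_rnDeriv_smul_iff hac' c').2 h')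
  rw [← setIntegral_rnDeriv_smul' hac, ← setIntegral_rnDeriv_smul' hac']
  exact integral_congr_ae (ae_restrict_of_ae e)

theorem IsComplexRadon.setIntegral_eq_real {L : TestFun d X → ℂ} {μ ν : Measure X} {c : X → ℂ}
    (h : IsComplexRadon L μ c) (h' : IsPositiveRadon L ν) (A : Set X) :
    ∫ x in A, c x ∂μ = ν.real A := by
  rw [h.setIntegral_eq h'.isComplexRadon A]
  simp

theorem ae_of_forall_isCompact [LocallyCompactSpace X] {μ : Measure X} {P : X → Prop}
    (h : ∀ K, IsCompact K → ∀ᵐ x ∂μ.restrict K, P x) : ∀ᵐ x ∂μ, P x := by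
  have h1 : ∀ n, ∀ᵐ x ∂μ, x ∈ compactCovering X n → P x := fun n =>
    (ae_restrict_iff' (isCompact_compactCovering X n).measurableSet).1
      (h _ (isCompact_compactCovering X n))
  filter_upwards [ae_all_iff.2 h1] with x hx
  obtain ⟨n, hn⟩ := exists_mem_compactCovering x
  exact hx n hn

theorem IsComplexRadon.ae_nonneg {L : TestFun d X → ℂ} {μ ν : Measure X} {c : X → ℂ}
    (h : IsComplexRadon L μ c) (h' : IsPositiveRadon L ν) : ∀ᵐ x ∂μ, 0 ≤ c x := by
  have := ChartedSpace.locallyCompactSpace (Model d) X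
  refine ae_of_forall_isCompact fun K hK => ae_nonneg_of_setIntegral
    (h.2.1.integrableOn_isCompact hK) fun A hA => ?_
  rw [Measure.restrict_restrict hA, h.setIntegral_eq_real h']
  exact Complex.zero_le_real.2 measureReal_nonneg

theorem IsComplexRadon.ae_eq_zero_on {L : TestFun d X → ℂ} {μ ν : Measure X} {c : X → ℂ}
    (h : IsComplexRadon L μ c) (h' : IsPositiveRadon L ν) {A : Set X} (hA : MeasurableSet A)
    (hνA : ν A = 0) : ∀ᵐ x ∂μ, x ∈ A → c x = 0 := by
  have := ChartedSpace.locallyCompactSpace (Model d) X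
  refine ae_of_forall_isCompact fun K hK => ?_
  rw [← ae_restrict_iff' hA, Measure.restrict_restrict hA]
  have hint : IntegrableOn c (A ∩ K) μ :=
    (h.2.1.integrableOn_isCompact hK).mono_set Set.inter_subset_right
  refine hint.ae_eq_zero_of_forall_setIntegral_eq_zero fun B hB _ => ?_
  rw [Measure.restrict_restrict hB, h.setIntegral_eq_real h', measureReal_def,
    measure_mono_null (Set.inter_subset_right.trans Set.inter_subset_left) hνA]
  simp

/-- A Radon–Nikodym theorem for functionals on test functions. -/
theorem IsComplexRadon.exists_density {L : TestFun d X → ℂ} {μ ν : Measure X} {c : X → ℂ}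
    [IsLocallyFiniteMeasure μ] (h : IsComplexRadon L ν c)
    (hμ : ∀ A, MeasurableSet A → IsCompact (closure A) → μ A = 0 → ∫ x in A, c x ∂ν = 0) :
    ∃ k : X → ℂ, IsComplexRadon L μ k := by
  have := ChartedSpace.locallyCompactSpace (Model d) X
  have := h.1
  set m := ν + μ with hm
  have : IsLocallyFiniteMeasure m := isLocallyFiniteMeasure_add h.1 ‹_›
  have hac : ν ≪ m := Measure.AbsolutelyContinuous.rfl.add_right μ
  have hac' : μ ≪ m := by
    rw [hm, add_comm]
    exact Measure.AbsolutelyContinuous.rfl.add_right ν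
  set a : X → ℂ := fun x => (ν.rnDeriv m x).toReal • c x with ha
  have hLa : IsComplexRadon L m a := (isComplexRadon_rnDeriv_smul_iff hac c).2 h
  set r : X → ℝ := fun x => (μ.rnDeriv m x).toReal with hr
  have hrm : Measurable r := (Measure.measurable_rnDeriv μ m).ennreal_toReal
  -- On `Z` the measure μ has no mass, so the hypothesis forces the density `a` of `L` to vanish
  -- m-almost everywhere there; off `Z` one may divide `a` by `r`.
  set Z : Set X := {x | r x = 0} with hZ
  have hZm : MeasurableSet Z := hrm (measurableSet_singleton 0)
  have hμZ : μ Z = 0 := by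
    have h1 : ∀ᵐ x ∂μ, 0 < μ.rnDeriv m x := Measure.rnDeriv_pos hac'
    have h2 : ∀ᵐ x ∂μ, μ.rnDeriv m x < ⊤ := hac'.ae_le (Measure.rnDeriv_lt_top μ m)
    have h3 : ∀ᵐ x ∂μ, x ∉ Z := by
      filter_upwards [h1, h2] with x hx hx' hxZ
      exact (ENNReal.toReal_pos hx.ne' hx'.ne).ne' hxZ
    exact measure_eq_zero_iff_ae_notMem.2 h3
  have hzero : ∀ᵐ x ∂m, x ∈ Z → a x = 0 := by
    refine ae_of_forall_isCompact fun K hK => ?_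
    rw [← ae_restrict_iff' hZm, Measure.restrict_restrict hZm]
    have hint : IntegrableOn a (Z ∩ K) m :=
      (hLa.2.1.integrableOn_isCompact hK).mono_set Set.inter_subset_right
    refine hint.ae_eq_zero_of_forall_setIntegral_eq_zero fun B hB _ => ?_
    rw [Measure.restrict_restrict hB, hLa.setIntegral_eq h]
    refine hμ _ (hB.inter (hZm.inter hK.measurableSet)) ?_ (measure_mono_null ?_ hμZ)
    · exact hK.of_isClosed_subset isClosed_closure (closure_minimal
        (Set.inter_subset_right.trans Set.inter_subset_right) hK.isClosed)
    · exact Set.inter_subset_right.trans Set.inter_subset_left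
  refine ⟨fun x => (r x)⁻¹ • a x, (isComplexRadon_rnDeriv_smul_iff hac' _).1 ?_⟩
  have hae : (fun x => (μ.rnDeriv m x).toReal • (r x)⁻¹ • a x) =ᵐ[m] a := by
    filter_upwards [hzero] with x hx
    by_cases h0 : r x = 0
    · rw [hx h0, smul_zero, smul_zero]
    · exact smul_inv_smul₀ h0 _
  refine ⟨hLa.1, hLa.2.1.congr hae.symm, fun f => ?_⟩
  rw [hLa.2.2 f]
  refine integral_congr_ae ?_
  filter_upwards [hae] with x hx
  rw [hx]

theorem IsPositiveRadon.exists_density {L : TestFun d X → ℂ} {μ ν : Measure X}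
    [IsLocallyFiniteMeasure μ] (h : IsPositiveRadon L ν) (hμ : ν ≪ μ) :
    ∃ k : X → ℂ, IsComplexRadon L μ k :=
  h.isComplexRadon.exists_density fun A _ _ hA => by simp [measureReal_def, hμ hA]

/-- Domination of a positive functional by a multiple of another one. -/
theorem IsPositiveRadon.absolutelyContinuous {L₁ L₂ : TestFun d X → ℂ} {μ ν₁ ν₂ : Measure X}
    (h₁ : IsPositiveRadon L₁ ν₁) (h₂ : IsPositiveRadon L₂ ν₂) [IsLocallyFiniteMeasure μ]
    {C : X → ℂ} (hC : Continuous C)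
    (h : ∀ f : TestFun d X, L₁ f + L₂ f = ∫ x, f.toFun x * C x ∂μ) : ν₁ ≪ μ := by
  obtain ⟨_, _⟩ := sigmaCompactSpace_manifold d X
  have := h₁.1
  have := h₂.1
  have := isLocallyFiniteMeasure_add h₁.1 h₂.1
  have hi : ∀ (f : TestFun d X) (ν : Measure X) [IsLocallyFiniteMeasure ν],
      Integrable f.toFun ν := fun f ν _ =>
    f.smooth.continuous.integrable_of_hasCompactSupport f.compact
  -- The sum is represented both by ν₁ + ν₂ and by C·μ, so ν₁ + ν₂, and with it ν₁, vanishes on the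
  -- μ-null sets; compact pieces keep the masses finite.
  have hr1 : IsPositiveRadon (fun f => L₁ f + L₂ f) (ν₁ + ν₂) :=
    ⟨inferInstance, fun f => by
      change L₁ f + L₂ f = _
      rw [h₁.2 f, h₂.2 f, integral_add_measure (hi f ν₁) (hi f ν₂)]⟩
  have hr2 : IsComplexRadon (fun f => L₁ f + L₂ f) μ C :=
    ⟨inferInstance, hC.locallyIntegrable, h⟩
  refine Measure.AbsolutelyContinuous.mk fun A hA hμA => ?_
  have hK : ∀ n, ν₁ (A ∩ compactCovering X n) = 0 := by
    intro n
    have h1 := hr2.setIntegral_eq_real hr1 (A ∩ compactCovering X n)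
    rw [setIntegral_measure_zero _ (measure_mono_null Set.inter_subset_left hμA)] at h1
    have h2 : (ν₁ + ν₂) (A ∩ compactCovering X n) ≠ ⊤ :=
      ((measure_mono Set.inter_subset_right).trans_lt
        (isCompact_compactCovering X n).measure_lt_top).ne
    have h3 := (measureReal_eq_zero_iff h2).1 (Complex.ofReal_eq_zero.1 h1.symm)
    rw [Measure.add_apply, add_eq_zero] at h3
    exact h3.1
  rw [← Set.inter_univ A, ← iUnion_compactCovering X, Set.inter_iUnion]
  exact measure_iUnion_null hK

end Measures


section Expansion

open Topology

/-! ### Global expansions of forms of type `(p, p)` -/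

universe u

variable {n : ℕ} {X : Type u} [TopologicalSpace X] [ChartedSpace (Model (2 * n)) X]
  [IsManifold (𝓡 (2 * n)) ∞ X]

/-- A locally finite expansion of the forms of type `(p, p)` by contractions of `ψ`. -/
structure Expansion (J : ACStructure (2 * n) X) {q p : ℕ} (hN : 2 * q + 2 * p = 2 * n)
    (ψ : RoughForm (2 * n) X (2 * n)) where
  /-- the index set -/
  ι : Type u
  countable : Countable ι
  /-- the vector fields -/
  field : ι → Fin q → VField (2 * n) X
  /-- the frames in which the coefficients are computed -/
  frame : ι → Fin (2 * n) → VField (2 * n) X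
  /-- the weights of the coefficients -/
  weight : ι → (Fin (2 * p) → Fin (2 * n)) → X → ℂ
  weight_smooth : ∀ a s, ContMDiff (𝓡 (2 * n)) 𝓘(ℝ, ℂ) ∞ (weight a s)
  /-- the coefficients -/
  coef : ι → ∀ x : X, AltForm (TangentSpace (𝓡 (2 * n)) x) (2 * p) →ₗ[ℂ] ℂ
  coef_eq : ∀ a x u, coef a x u = ∑ s, weight a s x * u fun i => frame a (s i) x
  coef_rotate : ∀ x a (z : ℂ), z * (starRingEnd ℂ) z = 1 → ∀ u,
    coef a x (pullForm (rotate (J.at x) z) (2 * p) u) = coef a x u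
  locallyFinite : ∀ K : Set X, IsCompact K → ∃ t : Finset ι, ∀ x ∈ K, (∀ a ∉ t, coef a x = 0) ∧
    ∀ u, midProj (J.at x) p u = ∑ a ∈ t, coef a x u • contractField J hN ψ (field a) x

variable {J : ACStructure (2 * n) X} {q p : ℕ} {hN : 2 * q + 2 * p = 2 * n}
  {ψ : RoughForm (2 * n) X (2 * n)}

theorem Expansion.coef_smooth (G : Expansion J hN ψ) (a : G.ι) {φ : RoughForm (2 * n) X (2 * p)}
    (hφ : IsSmoothForm φ) : ContMDiff (𝓡 (2 * n)) 𝓘(ℝ, ℂ) ∞ fun x => G.coef a x (φ x) := by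
  simp only [G.coef_eq]
  exact contMDiff_finsetSum fun s _ => contMDiff_complex_mul (G.weight_smooth a s) (hφ _)

/-- The field of functionals with values `h a` on the forms of the expansion. -/
def Expansion.functional (G : Expansion J hN ψ) (h : G.ι → X → ℂ) (x : X) :
    AltForm (TangentSpace (𝓡 (2 * n)) x) (2 * p) →ₗ[ℂ] ℂ := ∑ᶠ a, h a x • G.coef a x

theorem Expansion.functional_eq (G : Expansion J hN ψ) (h : G.ι → X → ℂ) {x : X} {t : Finset G.ι}
    (ht : ∀ a ∉ t, G.coef a x = 0) (u : AltForm (TangentSpace (𝓡 (2 * n)) x) (2 * p)) :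
    G.functional h x u = ∑ a ∈ t, h a x * G.coef a x u := by
  rw [Expansion.functional, finsum_eq_sum_of_support_subset (s := t), LinearMap.sum_apply]
  · rfl
  · intro a ha
    by_contra hat
    exact ha (by simp [ht a hat])

theorem Expansion.functional_rotate (G : Expansion J hN ψ) (h : G.ι → X → ℂ) (x : X) {z : ℂ}
    (hz : z * (starRingEnd ℂ) z = 1) (u : AltForm (TangentSpace (𝓡 (2 * n)) x) (2 * p)) :
    G.functional h x (pullForm (rotate (J.at x) z) (2 * p) u) = G.functional h x u := by
  obtain ⟨t, ht⟩ := G.locallyFinite {x} isCompact_singleton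
  rw [G.functional_eq h (ht x rfl).1, G.functional_eq h (ht x rfl).1]
  exact Finset.sum_congr rfl fun a _ => by rw [G.coef_rotate x a z hz]

/-- The product of a test function and a coefficient of a smooth form. -/
def Expansion.coefTest (G : Expansion J hN ψ) (a : G.ι) {φ : RoughForm (2 * n) X (2 * p)}
    (hφ : IsSmoothForm φ) (f : TestFun (2 * n) X) : TestFun (2 * n) X := f.mul _ (G.coef_smooth a hφ)

theorem Expansion.wedge_eq (G : Expansion J hN ψ) (hψ : IsSmoothForm ψ)
    {Θ : Current (2 * n) X (2 * p)} (hΘ : Θ.HasBidimension J) {φ : RoughForm (2 * n) X (2 * p)}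
    (hφ : IsSmoothForm φ) (f : TestFun (2 * n) X) {t : Finset G.ι}
    (hmem : ∀ a x, contractField J hN ψ (G.field a) x ∈ formsOfType (J.at x) p p (2 * p))
    (ht : ∀ x ∈ tsupport f.toFun, ∀ u, midProj (J.at x) p u =
      ∑ a ∈ t, G.coef a x u • contractField J hN ψ (G.field a) x) :
    Θ.wedge φ hφ f = ∑ a ∈ t, Θ.wedge (contractField J hN ψ (G.field a))
      (isSmoothForm_contractField hN hψ _) (G.coefTest a hφ f) := by
  refine Θ.wedge_eq_sum_of_midProj hΘ hφ f t _ _ fun x => ?_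
  by_cases hx : x ∈ tsupport f.toFun
  · rw [ht x hx, Finset.smul_sum]
    refine Finset.sum_congr rfl fun a _ => ?_
    rw [midProj_of_mem (hmem a x), smul_smul]
    rfl
  · have h0 : f.toFun x = 0 := image_eq_zero_of_notMem_tsupport hx
    simp [Expansion.coefTest, h0]

/-- Expanding φ turns Θ∧φ into a locally finite sum of the generators Θ∧β_a, with smooth
coefficients. Densities of the generators alone thus produce densities of all Θ∧φ, given pointwise
by one functional on forms. -/
theorem Expansion.isComplexRadon [T2Space X] [SecondCountableTopology X] [MeasurableSpace X]
    [BorelSpace X] (G : Expansion J hN ψ) (hψ : IsSmoothForm ψ)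
    {Θ : Current (2 * n) X (2 * p)} (hΘ : Θ.HasBidimension J)
    (hmem : ∀ a x, contractField J hN ψ (G.field a) x ∈ formsOfType (J.at x) p p (2 * p))
    {μ : Measure X} [IsLocallyFiniteMeasure μ] {h : G.ι → X → ℂ}
    (hh : ∀ a, IsComplexRadon (Θ.wedge (contractField J hN ψ (G.field a))
      (isSmoothForm_contractField hN hψ _)) μ (h a))
    {φ : RoughForm (2 * n) X (2 * p)} (hφ : IsSmoothForm φ) :
    IsComplexRadon (Θ.wedge φ hφ) μ fun x => G.functional h x (φ x) := by
  have := ChartedSpace.locallyCompactSpace (Model (2 * n)) X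
  refine ⟨inferInstance, locallyIntegrable_iff.2 fun K hK => ?_, fun f => ?_⟩
  · obtain ⟨t, ht⟩ := G.locallyFinite K hK
    have h1 : IntegrableOn (fun x => ∑ a ∈ t, h a x * G.coef a x (φ x)) K μ :=
      integrable_finsetSum _ fun a _ => ((hh a).2.1.integrableOn_isCompact hK).mul_continuousOn
        (G.coef_smooth a hφ).continuous.continuousOn hK
    refine h1.congr_fun (fun x hx => ?_) hK.measurableSet
    exact (G.functional_eq h (ht x hx).1 _).symm
  · obtain ⟨t, ht⟩ := G.locallyFinite _ f.compact.isCompact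
    rw [G.wedge_eq hψ hΘ hφ f hmem fun x hx => (ht x hx).2]
    simp only [(hh _).2.2]
    rw [← integral_finsetSum]
    · refine integral_congr_ae (.of_forall fun x => ?_)
      by_cases hx : x ∈ tsupport f.toFun
      · simp only [G.functional_eq h (ht x hx).1, Finset.mul_sum]
        refine Finset.sum_congr rfl fun a _ => ?_
        simp only [Expansion.coefTest, TestFun.mul_toFun]
        ring
      · have h0 : f.toFun x = 0 := image_eq_zero_of_notMem_tsupport hx
        simp [Expansion.coefTest, h0]
    · intro a _
      exact (hh a).2.1.integrable_smul_left_of_hasCompactSupport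
        (G.coefTest a hφ f).smooth.continuous (G.coefTest a hφ f).compact

/-- Local expansions weighted by a partition of unity. A countable subcover keeps the index set
countable, so that exceptional null sets can later be united. -/
theorem exists_expansion [T2Space X] [SecondCountableTopology X] {g : RoughForm (2 * n) X 2}
    (hg : IsMetric J g) (hqp : q + p = n) (hN : 2 * q + 2 * p = 2 * n)
    (hψ : IsVolumeForm J ψ) : Nonempty (Expansion J hN ψ) := by
  classical
  obtain ⟨_, _⟩ := sigmaCompactSpace_manifold (2 * n) X
  let F : ∀ x, LocalExpansion J hN ψ x := fun x => (exists_localExpansion hg hqp hN hψ x).some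
  obtain ⟨s, hs, hsU⟩ := TopologicalSpace.countable_cover_nhds
    fun x => (F x).isOpen.mem_nhds (F x).mem
  obtain ⟨ρ, hρ⟩ := SmoothPartitionOfUnity.exists_isSubordinate (𝓡 (2 * n)) isClosed_univ
    (fun i : s => (F i).U) (fun i => (F i).isOpen) (by rw [← hsU, Set.biUnion_eq_iUnion])
  have hρ0 : ∀ (i : s) x, x ∉ (F i).U → ρ i x = 0 := fun i x hx =>
    image_eq_zero_of_notMem_tsupport fun h => hx (hρ i h)
  have := hs.to_subtype
  refine ⟨{
    ι := Σ i : s, Fin (F i).N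
    countable := inferInstance
    field := fun a => (F a.1).field a.2
    frame := fun a => (F a.1).frame
    weight := fun a v x => (ρ a.1 x : ℂ) * (F a.1).weight a.2 v x
    weight_smooth := fun a v => contMDiff_complex_mul (contMDiff_ofReal (ρ a.1).contMDiff)
      ((F a.1).weight_smooth a.2 v)
    coef := fun a x => (ρ a.1 x : ℂ) • (F a.1).coef a.2 x
    coef_eq := fun a x u => ?_
    coef_rotate := fun x a z hz u => ?_
    locallyFinite := fun K hK => ?_ }⟩
  · rw [LinearMap.smul_apply, (F a.1).coef_eq, smul_eq_mul, Finset.mul_sum]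
    simp only [mul_assoc]
  · rw [LinearMap.smul_apply, LinearMap.smul_apply, (F a.1).coef_rotate x a.2 z hz]
  · have hfin := ρ.locallyFinite.finite_nonempty_inter_compact hK
    have ht : ∀ x ∈ K, ∀ i ∉ hfin.toFinset, ρ i x = 0 := by
      intro x hx i hi
      by_contra h
      exact hi (hfin.mem_toFinset.2 ⟨x, h, hx⟩)
    refine ⟨hfin.toFinset.sigma fun _ => Finset.univ, fun x hx => ⟨fun a ha => ?_, fun u => ?_⟩⟩
    · have h0 : ρ a.1 x = 0 := ht x hx a.1 fun h => ha (Finset.mem_sigma.2 ⟨h, Finset.mem_univ _⟩)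
      simp [h0]
    · have h1 : ∑ i ∈ hfin.toFinset, ρ i x = 1 := by
        rw [← ρ.sum_eq_one (Set.mem_univ x)]
        refine (finsum_eq_sum_of_support_subset _ fun i hi => ?_).symm
        by_contra h
        exact hi (ht x hx i h)
      rw [Finset.sum_sigma]
      calc midProj (J.at x) p u
          = ((∑ i ∈ hfin.toFinset, ρ i x : ℝ) : ℂ) • midProj (J.at x) p u := by
            rw [h1, Complex.ofReal_one, one_smul]
        _ = ∑ i ∈ hfin.toFinset, (ρ i x : ℂ) • midProj (J.at x) p u := by
            rw [Complex.ofReal_sum, Finset.sum_smul]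
        _ = _ := Finset.sum_congr rfl fun i _ => ?_
      by_cases hx : x ∈ (F i).U
      · rw [(F i).midProj_eq x hx, Finset.smul_sum]
        refine Finset.sum_congr rfl fun j _ => ?_
        rw [smul_smul]
        rfl
      · simp [hρ0 i x hx]

end Expansion


section Positivity

open Topology

/-! ### Positivity of currents on strongly positive forms -/

theorem nonneg_of_forall_add_mul {a b : ℂ} (hb : 0 ≤ b) (h : ∀ ε : ℝ, 0 < ε → 0 ≤ a + ε * b) :
    0 ≤ a := by
  have hb' := Complex.le_def.1 hb
  have h' : ∀ ε : ℝ, 0 < ε → 0 ≤ a.re + ε * b.re ∧ 0 = a.im := by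
    intro ε hε
    have := Complex.le_def.1 (h ε hε)
    simpa [← hb'.2] using this
  refine Complex.le_def.2 ⟨?_, (h' 1 one_pos).2⟩
  refine le_of_forall_pos_le_add fun δ hδ => ?_
  have hb0 : 0 ≤ b.re := hb'.1
  have hε : 0 < δ / (b.re + 1) := by positivity
  refine (h' _ hε).1.trans (add_le_add le_rfl ?_)
  rw [div_mul_eq_mul_div, div_le_iff₀ (by positivity)]
  nlinarith

universe u

variable {n : ℕ} {X : Type u} [TopologicalSpace X] [ChartedSpace (Model (2 * n)) X]
  [IsManifold (𝓡 (2 * n)) ∞ X] {J : ACStructure (2 * n) X} {g : RoughForm (2 * n) X 2}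
  {q p : ℕ} {hN : 2 * q + 2 * p = 2 * n} {ψ : RoughForm (2 * n) X (2 * n)}
  {Θ : Current (2 * n) X (2 * p)}

theorem wedge_contractField_nonneg_of_eval (hψ : IsVolumeForm J ψ)
    (ha : ∀ (ξ : Fin q → VField (2 * n) X) (φ : TestForm (2 * n) X (2 * n)),
        (∀ x, IsPositive (J.at x) (φ.1 x)) →
          0 ≤ Θ.eval hN (interleave ξ fun j => J.field (ξ j)) φ)
    (ξ : Fin q → VField (2 * n) X) (f : TestFun (2 * n) X) (hf : ∀ x, 0 ≤ f.toFun x) :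
    0 ≤ Θ.wedge (contractField J hN ψ ξ) (isSmoothForm_contractField hN hψ.1 ξ) f := by
  rw [← Θ.evalMul_interleave hN ξ ψ hψ.1]
  refine ha ξ _ fun x => ⟨Submodule.smul_mem _ _ (hψ.2 x).1.1, fun v => ?_⟩
  exact mul_nonneg (hf x) ((hψ.2 x).1.2 v)

variable [T2Space X] [SecondCountableTopology X]

theorem exists_fields_eq {q : ℕ} (x : X) (v : Fin q → TangentSpace (𝓡 (2 * n)) x) :
    ∃ ξ : Fin q → VField (2 * n) X, (fun i => ξ i x) = v := by
  choose ξ hξ using fun i => exists_field_eq x (v i)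
  exact ⟨ξ, funext hξ⟩

/-- The pointwise decomposition of φ into contractions is not smooth, so positivity is proved for φ
+ ε∑β_j, with β_j spanning near y₀. Near each y this perturbation is a smooth nonnegative
combination of contractions, and ε tends to 0 at the end. -/
theorem wedge_nonneg_of_eval (hg : IsMetric J g) (hqp : q + p = n) (hΘ : Θ.HasBidimension J)
    (hψ : IsVolumeForm J ψ)
    (ha : ∀ (ξ : Fin q → VField (2 * n) X) (φ : TestForm (2 * n) X (2 * n)),
        (∀ x, IsPositive (J.at x) (φ.1 x)) →
          0 ≤ Θ.eval hN (interleave ξ fun j => J.field (ξ j)) φ)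
    {φ : RoughForm (2 * n) X (2 * p)} (hφ : IsSmoothForm φ)
    (hφp : ∀ x, IsStronglyPositive (J.at x) (φ x)) (f : TestFun (2 * n) X)
    (hf : ∀ x, 0 ≤ f.toFun x) : 0 ≤ Θ.wedge φ hφ f := by
  have hβ0 := wedge_contractField_nonneg_of_eval hψ ha
  have hβs : ∀ ξ : Fin q → VField (2 * n) X, IsSmoothForm (contractField J hN ψ ξ) :=
    isSmoothForm_contractField hN hψ.1
  have hβp := hg.isStronglyPositive_contractField hqp hN hψ.isNonnegTop
  have hβm : ∀ (ξ : Fin q → VField (2 * n) X) x,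
      midProj (J.at x) p (contractField J hN ψ ξ x) = contractField J hN ψ ξ x :=
    fun ξ x => midProj_of_mem ((hβp ξ x).mem (J.at_at x))
  have hβr : ∀ (ξ : Fin q → VField (2 * n) X) x, IsRealForm (contractField J hN ψ ξ x) :=
    fun ξ x => ((hψ.isNonnegTop x).isRealForm (hg.isHermForm x) (finrank_tangentSpace x)).contract
      hN _
  refine (Θ.isLinearTest_wedge hφ).nonneg_of_local hf fun y₀ _ => ?_
  obtain ⟨F⟩ := exists_localExpansion hg hqp hN hψ y₀
  refine ⟨F.U, F.isOpen, F.mem, fun k hk hkU _ => ?_⟩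
  refine nonneg_of_forall_add_mul (b := ∑ j, Θ.wedge (contractField J hN ψ (F.field j)) (hβs _) k)
    (Finset.sum_nonneg fun j _ => hβ0 _ k hk) fun ε hε => ?_
  have hΦs : IsSmoothForm fun x => φ x + (ε : ℂ) • ∑ j, contractField J hN ψ (F.field j) x :=
    hφ.add ((IsSmoothForm.sum fun j => hβs _).smul contMDiff_const)
  have hsplit : Θ.wedge _ hΦs k = Θ.wedge φ hφ k +
      ε * ∑ j, Θ.wedge (contractField J hN ψ (F.field j)) (hβs _) k := by
    have h1 := Θ.wedge_eq_sum hΦs k (Finset.univ : Finset (Option (Fin F.N)))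
      (β := fun o => o.elim φ fun j => contractField J hN ψ (F.field j))
      (fun o => by cases o <;> simp only [Option.elim] <;> first | exact hφ | exact hβs _)
      (fun o => o.elim k fun _ => k.mul (fun _ => (ε : ℂ)) contMDiff_const) fun x => by
        simp only [Fintype.sum_option, Option.elim, smul_add, Finset.smul_sum, TestFun.mul_toFun,
          mul_smul]
    rw [h1, Fintype.sum_option, Finset.mul_sum]
    congr 1
    refine Finset.sum_congr rfl fun j _ => ?_
    exact (Θ.isLinearTest_wedge (hβs (F.field j))).smul ε k _ fun x => mul_comm _ _
  rw [← hsplit]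
  refine (Θ.isLinearTest_wedge hΦs).nonneg_of_local hk fun y hy => ?_
  obtain ⟨M, c, v, hc, hcv⟩ := IsStronglyPositive.exists_eq_sum_contract (hg.isHermForm y)
    (finrank_tangentSpace y) hqp hN (hψ.isNonnegTop y) (hψ.2 y).2 (hφp y)
  choose η hη using fun t => exists_fields_eq y (v t)
  have hφy : φ y = ∑ t, (c t : ℂ) • contractField J hN ψ (η t) y := by
    rw [hcv]
    refine Finset.sum_congr rfl fun t _ => ?_
    rw [contractField, ← hη t]
  have hDs : IsSmoothForm fun x => φ x - ∑ t, (c t : ℂ) • contractField J hN ψ (η t) x :=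
    hφ.sub (IsSmoothForm.sum fun t => (hβs _).smul contMDiff_const)
  -- Coordinates of the error made by freezing at `y` the decomposition of φ(y). They are smooth,
  -- real, and zero at `y`, hence greater than -ε nearby.
  set r : Fin F.N → X → ℝ := fun j x =>
    (F.coef j x (φ x - ∑ t, (c t : ℂ) • contractField J hN ψ (η t) x)).re with hr
  have hrs : ∀ j, ContMDiff (𝓡 (2 * n)) 𝓘(ℝ) ∞ (r j) := fun j => contMDiff_re (F.coef_smooth j hDs)
  have hφr : ∀ x, IsRealForm (φ x) := by
    intro x
    obtain ⟨M, c, v, -, hcv⟩ := IsStronglyPositive.exists_eq_sum_contract (hg.isHermForm x)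
      (finrank_tangentSpace x) hqp hN (hψ.isNonnegTop x) (hψ.2 x).2 (hφp x)
    rw [hcv]
    intro w
    rw [altForm_sum_apply, Complex.im_sum]
    refine Finset.sum_eq_zero fun t _ => ?_
    rw [AlternatingMap.smul_apply, smul_eq_mul, Complex.im_ofReal_mul]
    exact mul_eq_zero_of_right _
      (((hψ.isNonnegTop x).isRealForm (hg.isHermForm x) (finrank_tangentSpace x)).contract hN _ w)
  have hrc : ∀ j x, F.coef j x (φ x - ∑ t, (c t : ℂ) • contractField J hN ψ (η t) x) = r j x := by
    intro j x
    refine Complex.ext rfl ?_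
    rw [F.coef_real x j _ fun w => ?_, Complex.ofReal_im]
    rw [AlternatingMap.sub_apply, Complex.sub_im, hφr x w, altForm_sum_apply, Complex.im_sum,
      zero_sub, neg_eq_zero]
    refine Finset.sum_eq_zero fun t _ => ?_
    rw [AlternatingMap.smul_apply, smul_eq_mul, Complex.im_ofReal_mul]
    exact mul_eq_zero_of_right _ (hβr _ x w)
  have hry : ∀ j, r j y = 0 := fun j => by
    rw [hr]
    simp only [← hφy, sub_self, map_zero, Complex.zero_re]
  have hV : IsOpen {x | ∀ j, -ε < r j x} := by
    simp only [Set.ofPred_forall]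
    exact isOpen_iInter_of_finite fun j => isOpen_lt continuous_const (hrs j).continuous
  refine ⟨{x | ∀ j, -ε < r j x}, hV, fun j => by rw [hry]; linarith, fun l hl hlV hlk => ?_⟩
  -- On the support of `l` the perturbed form is ∑ c_t β_{η_t} + ∑ (ε + r_j) β_j, all of whose
  -- coefficients are nonnegative.
  rw [Θ.wedge_eq_sum_of_midProj hΘ hΦs l (Finset.univ : Finset (Fin M ⊕ Fin F.N))
    (β := Sum.elim (fun t => contractField J hN ψ (η t)) fun j => contractField J hN ψ (F.field j))
    (fun o => by cases o <;> exact hβs _)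
    (Sum.elim (fun t => l.mul (fun _ => (c t : ℂ)) contMDiff_const)
      fun j => l.mul (fun x => ((ε + r j x : ℝ) : ℂ))
        (contMDiff_ofReal (contMDiff_const.add (hrs j)))) fun x => ?_]
  · refine Finset.sum_nonneg fun o _ => ?_
    rcases o with t | j
    · exact hβ0 _ _ fun x => mul_nonneg (hl x) (Complex.zero_le_real.2 (hc t))
    · refine hβ0 _ _ fun x => ?_
      change 0 ≤ l.toFun x * _
      by_cases hx : x ∈ tsupport l.toFun
      · exact mul_nonneg (hl x) (Complex.zero_le_real.2 (by linarith [hlV hx j]))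
      · rw [image_eq_zero_of_notMem_tsupport hx, zero_mul]
  · by_cases hx : x ∈ tsupport l.toFun
    · have h1 := F.midProj_eq x (hkU (hlk hx))
        (φ x - ∑ t, (c t : ℂ) • contractField J hN ψ (η t) x)
      simp only [hrc, map_sub, map_sum, map_smul, hβm] at h1
      rw [Fintype.sum_sum_type]
      simp only [Sum.elim_inl, Sum.elim_inr, TestFun.mul_toFun, mul_smul, ← Finset.smul_sum, map_add,
        map_sum, map_smul, hβm, Complex.ofReal_add, add_smul, Finset.sum_add_distrib]
      rw [← smul_add, ← h1]
      congr 1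
      abel
    · have h0 : l.toFun x = 0 := image_eq_zero_of_notMem_tsupport hx
      rw [Fintype.sum_sum_type]
      simp [h0]

variable [MeasurableSpace X] [BorelSpace X]

theorem exists_measure_of_eval (hg : IsMetric J g) (hqp : q + p = n) (hΘ : Θ.HasBidimension J)
    (ha : ∀ (ξ : Fin q → VField (2 * n) X) (φ : TestForm (2 * n) X (2 * n)),
        (∀ x, IsPositive (J.at x) (φ.1 x)) →
          0 ≤ Θ.eval hN (interleave ξ fun j => J.field (ξ j)) φ)
    (φ : RoughForm (2 * n) X (2 * p)) (hφ : IsSmoothForm φ)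
    (hφp : ∀ x, IsStronglyPositive (J.at x) (φ x)) :
    ∃ μ : Measure X, IsPositiveRadon (Θ.wedge φ hφ) μ :=
  (Θ.isLinearTest_wedge hφ).exists_measure
    (wedge_nonneg_of_eval hg hqp hΘ hg.isVolumeForm ha hφ hφp)

-- For a cutoff χ equal to 1 on the support of φ, the value in (a) is the integral of χ for the
-- measure attached to the strongly positive contraction of φ.
omit [BorelSpace X] in
theorem eval_nonneg_of_measure (hg : IsMetric J g) (hqp : q + p = n)
    (hc : ∀ (φ : RoughForm (2 * n) X (2 * p)) (hφ : IsSmoothForm φ),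
        (∀ x, IsStronglyPositive (J.at x) (φ x)) →
          ∃ μ : Measure X, IsPositiveRadon (Θ.wedge φ hφ) μ)
    (ξ : Fin q → VField (2 * n) X) (φ : TestForm (2 * n) X (2 * n))
    (hφ : ∀ x, IsPositive (J.at x) (φ.1 x)) :
    0 ≤ Θ.eval hN (interleave ξ fun j => J.field (ξ j)) φ := by
  obtain ⟨μ, hμ⟩ := hc (contractField J hN φ.1 ξ) (isSmoothForm_contractField hN φ.2.1 ξ)
    (hg.isStronglyPositive_contractField hqp hN (fun x => (hφ x).2) ξ)
  obtain ⟨χ, h1, h2, h3, -, h4⟩ := exists_cutoff_compact (d := 2 * n) φ.2.2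
    isOpen_univ (Set.subset_univ _)
  have h5 := hμ.2 (.ofReal χ h1 h3)
  have h6 : Θ.eval hN (interleave ξ fun j => J.field (ξ j)) φ =
      Θ.wedge (contractField J hN φ.1 ξ) (isSmoothForm_contractField hN φ.2.1 ξ) (.ofReal χ h1 h3) := by
    refine congrArg Θ.toFun (Subtype.ext (funext fun x => ?_))
    change contractForm hN (φ.1 x) (fun a => interleave ξ (fun j => J.field (ξ j)) a x) =
      (χ x : ℂ) • contractField J hN φ.1 ξ x
    rw [interleave_field]
    by_cases hx : x ∈ formSupport φ.1
    · rw [h2.self_of_nhdsSet x hx, Complex.ofReal_one, one_smul]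
      rfl
    · have h0 : φ.1 x = 0 := by
        by_contra h
        exact hx (subset_closure h)
      ext w
      simp [contractField, contractForm, h0]
  rw [h6, h5]
  change 0 ≤ ∫ x, ((χ x : ℝ) : ℂ) ∂μ
  rw [integral_complex_ofReal]
  exact Complex.zero_le_real.2 (integral_nonneg fun x => (h4 x).1)

end Positivity


/-! ### Components of vector fields in a chart. -/

section Charts

open Topology

theorem altForm_apply_sum {V : Type*} [AddCommGroup V] [Module ℝ V] {m d : ℕ} (u : AltForm V m)
    (c : Fin m → Fin d → ℝ) (B : Fin m → Fin d → V) : u (fun a => ∑ k, c a k • B a k) =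
      ∑ r : Fin m → Fin d, (∏ a, c a (r a)) • u fun a => B a (r a) := by
  have h1 := u.toMultilinearMap.map_sum fun a k => c a k • B a k
  exact h1.trans (Finset.sum_congr rfl fun r _ => u.toMultilinearMap.map_smul_univ _ _)

variable {d : ℕ} {X : Type*} [TopologicalSpace X] [ChartedSpace (Model d) X]
  [IsManifold (𝓡 d) ∞ X]

/-- The inverse of the trivialization of the tangent bundle at x₀ is the derivative of the inverse
chart, so the trivialized components are the components in the coordinate fields. -/
theorem exists_chart_coordinates (x₀ : X) (ξ : VField d X) : ∃ a : Fin d → X → ℝ,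
    (∀ i, ContinuousOn (a i) (chartAt (Model d) x₀).source) ∧
    ∀ z ∈ (chartAt (Model d) x₀).target, ξ ((chartAt (Model d) x₀).symm z) =
      ∑ i, a i ((chartAt (Model d) x₀).symm z) •
        mfderiv (𝓡 d) (𝓡 d) (chartAt (Model d) x₀).symm z (EuclideanSpace.single i (1 : ℝ)) := by
  let e := trivializationAt (Model d) (fun x : X => TangentSpace (𝓡 d) x) x₀
  refine ⟨fun i x => (e ⟨x, ξ x⟩).2 i, fun i => ?_, fun z hz => ?_⟩
  · have h1 := (e.contMDiffOn_section_baseSet_iff (IB := 𝓡 d) (n := ∞) (s := fun x => ξ x)).1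
      ξ.contMDiff_toFun.contMDiffOn
    exact (EuclideanSpace.proj (𝕜 := ℝ) i).continuous.comp_continuousOn h1.continuousOn
  · set x := (chartAt (Model d) x₀).symm z with hx
    have hxs : x ∈ (chartAt (Model d) x₀).source := (chartAt (Model d) x₀).map_target hz
    have hzx : extChartAt (𝓡 d) x₀ x = z := by
      simp [hx, (chartAt (Model d) x₀).right_inv hz]
    have h2 := TangentBundle.symmL_trivializationAt (I := 𝓡 d) hxs
    rw [hzx, ModelWithCorners.Boundaryless.range_eq_univ, mfderivWithin_univ] at h2
    have h3 : e.symmL ℝ x (e ⟨x, ξ x⟩).2 = ξ x := by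
      rw [Trivialization.symmL_apply (hb := hxs)]
      exact e.symm_apply_apply_mk hxs _
    have h4 : (e ⟨x, ξ x⟩).2 = ∑ i, (e ⟨x, ξ x⟩).2 i • EuclideanSpace.single i (1 : ℝ) := by
      conv_lhs => rw [← (EuclideanSpace.basisFun (Fin d) ℝ).sum_repr (e ⟨x, ξ x⟩).2]
      simp
    conv_lhs => rw [← h3, h4, map_sum]
    refine Finset.sum_congr rfl fun i _ => ?_
    rw [map_smul]
    congr 1
    exact congrArg (fun l => l (EuclideanSpace.single i (1 : ℝ))) h2

end Charts

/-! ### Local frames, densities from a mass, and (b) ⇒ (a). -/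

section Frames

open Topology

universe u

variable {n : ℕ} {X : Type u} [TopologicalSpace X] [ChartedSpace (Model (2 * n)) X]
  [IsManifold (𝓡 (2 * n)) ∞ X] [T2Space X] [SecondCountableTopology X]
  {J : ACStructure (2 * n) X} {g : RoughForm (2 * n) X 2} {q p : ℕ}
  {hN : 2 * q + 2 * p = 2 * n} {ψ : RoughForm (2 * n) X (2 * n)} {Θ : Current (2 * n) X (2 * p)}

theorem IsVolumeForm.exists_localFrame (hψ : IsVolumeForm J ψ) (x₀ : X) :
    ∃ E : Fin (2 * n) → VField (2 * n) X, ∃ U, IsOpen U ∧ x₀ ∈ U ∧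
      ∀ x ∈ U, (ψ x fun i => E i x) ≠ 0 := by
  let b : Module.Basis (Fin (2 * n)) ℝ (TangentSpace (𝓡 (2 * n)) x₀) :=
    Module.finBasisOfFinrankEq ℝ _ (finrank_tangentSpace x₀)
  obtain ⟨E, hE⟩ := exists_fields_eq x₀ b
  refine ⟨E, {x | (ψ x fun i => E i x) ≠ 0}, isOpen_ne_fun (hψ.1 E).continuous continuous_const,
    fun h0 => (hψ.2 x₀).2 (altForm_top_ext b ?_), fun x hx => hx⟩
  rw [AlternatingMap.zero_apply, ← h0, hE]

theorem eq_sum_of_apply_ne_zero {V : Type*} [AddCommGroup V] [Module ℝ V] {m : ℕ}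
    [FiniteDimensional ℝ V] (hm : Module.finrank ℝ V = m) {φ : AltForm V m} {e : Fin m → V}
    (he : φ e ≠ 0) (v : V) : ∃ c : Fin m → ℝ, v = ∑ k, c k • e k := by
  have hli : LinearIndependent ℝ e := by
    by_contra h
    exact he (φ.map_linearDependent _ h)
  have hspan := hli.span_eq_top_of_card_eq_finrank' (by rw [Fintype.card_fin, hm])
  obtain ⟨c, hc⟩ := (Submodule.mem_span_range_iff_exists_fun ℝ).1
    (hspan ▸ Submodule.mem_top : v ∈ Submodule.span ℝ (Set.range e))
  exact ⟨c, hc.symm⟩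

/-- The quotient of a positive test form of maximal degree by a volume form. -/
theorem exists_testFun_smul_eq (hg : IsMetric J g) (hψ : IsVolumeForm J ψ)
    (φ : TestForm (2 * n) X (2 * n)) (hφ : ∀ x, IsPositive (J.at x) (φ.1 x)) :
    ∃ f : TestFun (2 * n) X, (∀ x, 0 ≤ f.toFun x) ∧ ∀ x, φ.1 x = f.toFun x • ψ x := by
  have hpt : ∀ x, ∃ c : ℝ, 0 ≤ c ∧ φ.1 x = (c : ℂ) • ψ x := by
    intro x
    obtain ⟨e, α, h, -⟩ := exists_unitaryFrame (hg.isHermForm x) (finrank_tangentSpace x) fun _ => 0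
    obtain ⟨b, hb⟩ := h.exists_basis (finrank_tangentSpace x)
    have hψb : 0 ≤ ψ x b := hb ▸ (hψ.2 x).1.2 e
    have hφb : 0 ≤ φ.1 x b := hb ▸ (hφ x).2 e
    have hψ0 : ψ x b ≠ 0 := fun h0 => (hψ.2 x).2 (altForm_top_ext b (by simpa using h0))
    have h1 : ψ x b = ((ψ x b).re : ℂ) :=
      Complex.ext rfl (by simpa using (Complex.le_def.1 hψb).2.symm)
    have h2 : φ.1 x b = ((φ.1 x b).re : ℂ) :=
      Complex.ext rfl (by simpa using (Complex.le_def.1 hφb).2.symm)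
    refine ⟨(φ.1 x b).re / (ψ x b).re,
      div_nonneg (Complex.le_def.1 hφb).1 (Complex.le_def.1 hψb).1, altForm_top_ext b ?_⟩
    rw [AlternatingMap.smul_apply, smul_eq_mul, Complex.ofReal_div, ← h1, ← h2,
      div_mul_cancel₀ _ hψ0]
  choose c hc0 hc using hpt
  -- Locally `c` is the quotient of the values of φ and ψ on one smooth frame, on which ψ does not
  -- vanish.
  have hsm : ContMDiff (𝓡 (2 * n)) 𝓘(ℝ) ∞ c := by
    intro x₀
    obtain ⟨E, U, hU, hx₀, hE⟩ := hψ.exists_localFrame x₀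
    have hreal : ∀ x, (ψ x fun i => E i x) = ((ψ x fun i => E i x).re : ℂ) := fun x =>
      Complex.ext rfl (by
        rw [Complex.ofReal_im]
        exact (hψ.isNonnegTop x).isRealForm (hg.isHermForm x) (finrank_tangentSpace x) _)
    have h0 : ∀ x ∈ U, (ψ x fun i => E i x).re ≠ 0 := fun x hx h =>
      hE x hx (by rw [hreal, h, Complex.ofReal_zero])
    have h1 : ContMDiffAt (𝓡 (2 * n)) 𝓘(ℝ) ∞
        (fun x => (φ.1 x fun i => E i x).re / (ψ x fun i => E i x).re) x₀ :=
      ContMDiffAt.div₀ (contMDiff_re (φ.2.1 E) x₀) (contMDiff_re (hψ.1 E) x₀) (h0 x₀ hx₀)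
    refine h1.congr_of_eventuallyEq ?_
    filter_upwards [hU.mem_nhds hx₀] with x hx
    rw [hc, AlternatingMap.smul_apply, smul_eq_mul, Complex.re_ofReal_mul,
      mul_div_cancel_right₀ _ (h0 x hx)]
  have hcs : HasCompactSupport c := by
    refine φ.2.2.of_isClosed_subset (isClosed_tsupport _) (closure_mono fun x hx h0 => hx ?_)
    rw [hc x] at h0
    simpa [(hψ.2 x).2] using h0
  exact ⟨.ofReal c hsm hcs, fun x => Complex.zero_le_real.2 (hc0 x), hc⟩

variable [MeasurableSpace X] [BorelSpace X]

theorem Current.IsMass.exists_density {μ : Measure X} (hμ : Θ.IsMass J hN μ)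
    (hψ : IsVolumeForm J ψ) (ξ : Fin (2 * q) → VField (2 * n) X) :
    ∃ k : X → ℂ, IsComplexRadon (Θ.evalMul hN ξ ψ hψ.1) μ k := by
  have := hμ.1
  -- Applied to the empty set, the mass condition already gives a presentation as a complex Radon
  -- measure; applied to null sets it gives absolute continuity with respect to μ.
  obtain ⟨ν, c, h, -⟩ := (hμ.2 ψ hψ ∅ .empty (by simp)).1 measure_empty ξ
  refine h.exists_density fun A hA hAc hμA => ?_
  obtain ⟨ν', c', h', h0⟩ := (hμ.2 ψ hψ A hA hAc).1 hμA ξ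
  rw [h.setIntegral_eq h', h0]

/-- A density form is built explicitly: the expansion assembles the densities of the generators into
a functional on (p,p)-forms at each point, and composing it with contraction of ω_n gives θ. The
hypothesis makes θ positive almost everywhere, and φ = f ω_n with f ≥ 0 reduces the evaluation to
the integral of a nonnegative function. -/
theorem eval_nonneg_of_density (hg : IsMetric J g) (hqp : q + p = n) (hΘ : Θ.HasBidimension J)
    {μ : Measure X} (hμ : Θ.IsMass J hN μ)
    (hθ : ∀ θ : RoughForm (2 * n) X (2 * q),
      Θ.IsDensity J hN μ (powForm g n) (isSmoothForm_powForm hg.smooth n) θ →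
        ∀ᵐ x ∂μ, IsPositive (J.at x) (θ x))
    (ξ : Fin q → VField (2 * n) X) (φ : TestForm (2 * n) X (2 * n))
    (hφ : ∀ x, IsPositive (J.at x) (φ.1 x)) :
    0 ≤ Θ.eval hN (interleave ξ fun j => J.field (ξ j)) φ := by
  have := hμ.1
  have hψ := hg.isVolumeForm
  obtain ⟨G⟩ := exists_expansion hg hqp hN hψ
  choose h hh using fun a => hμ.exists_density hψ
    (interleave (G.field a) fun i => J.field (G.field a i))
  simp only [Θ.evalMul_interleave] at hh
  have hmem : ∀ a x, contractField J hN (powForm g n) (G.field a) x ∈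
      formsOfType (J.at x) p p (2 * p) := fun a x =>
    (hg.isStronglyPositive_contractField hqp hN hψ.isNonnegTop _ x).mem (J.at_at x)
  have hdens : Θ.IsDensity J hN μ (powForm g n) (isSmoothForm_powForm hg.smooth n)
      fun x => dualContract hN (powForm g n x) (G.functional h x) := by
    refine ⟨fun x => dualContract_mem (J.at_at x) hN (hψ.2 x).1.1
      fun z hz u => G.functional_rotate h x hz u, fun η => ?_⟩
    rw [Θ.evalMul_eq_wedge]
    exact G.isComplexRadon hψ.1 hΘ hmem hh _
  obtain ⟨f, hf0, hf⟩ := exists_testFun_smul_eq hg hψ φ hφ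
  have h1 : Θ.eval hN (interleave ξ fun j => J.field (ξ j)) φ =
      Θ.evalMul hN (interleave ξ fun j => J.field (ξ j)) (powForm g n) hψ.1 f :=
    congrArg (Θ.eval hN _) (Subtype.ext (funext hf))
  rw [h1, (hdens.2 _).2.2 f]
  refine integral_nonneg_of_ae ?_
  filter_upwards [hθ _ hdens] with x hx
  rw [interleave_field]
  exact mul_nonneg (hf0 x) (hx.2 _)

end Frames


/-! ### Estimates in charts and order zero. -/

section OrderZero

open Topology

universe u

variable {n : ℕ} {X : Type u} [TopologicalSpace X] [ChartedSpace (Model (2 * n)) X]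
  [IsManifold (𝓡 (2 * n)) ∞ X] {J : ACStructure (2 * n) X} {g : RoughForm (2 * n) X 2} {q p : ℕ}
  {hN : 2 * q + 2 * p = 2 * n} {ψ : RoughForm (2 * n) X (2 * n)} {Θ : Current (2 * n) X (2 * p)}

/-- The values of a form on vector fields are bounded by its coefficients in a chart. -/
theorem exists_chart_bound {d k : ℕ} {X : Type*} [TopologicalSpace X] [ChartedSpace (Model d) X]
    [IsManifold (𝓡 d) ∞ X] {x₀ : X} {K : Set X} (hK : IsCompact K)
    (hKs : K ⊆ (chartAt (Model d) x₀).source) (ξ : Fin k → VField d X) :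
    ∃ B : ℝ, 0 ≤ B ∧ ∀ (u : RoughForm d X k) (M : ℝ), 0 ≤ M →
      (∀ i, ∀ z ∈ (chartAt (Model d) x₀).target, ‖chartCoeff x₀ u i z‖ ≤ M) →
      ∀ x ∈ K, ‖u x fun j => ξ j x‖ ≤ B * M := by
  choose a ha hax using fun j => exists_chart_coordinates x₀ (ξ j)
  have hcont : ContinuousOn (fun x => ∑ r : Fin k → Fin d, ∏ j, |a j (r j) x|) K := by
    refine continuousOn_finsetSum _ fun r _ => continuousOn_finsetProd _ fun j _ => ?_
    exact ((ha j (r j)).mono hKs).abs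
  obtain ⟨B, hB⟩ := hK.exists_bound_of_continuousOn hcont
  refine ⟨max B 0, le_max_right _ _, fun u M hM0 hM x hx => ?_⟩
  have hxs := hKs hx
  set z := chartAt (Model d) x₀ x with hz
  have hzt : z ∈ (chartAt (Model d) x₀).target := (chartAt (Model d) x₀).map_source hxs
  have hzx : (chartAt (Model d) x₀).symm z = x := (chartAt (Model d) x₀).left_inv hxs
  have h1 : ‖u x fun j => ξ j x‖ ≤ ∑ r : Fin k → Fin d, (∏ j, |a j (r j) x|) * M := by
    rw [← hzx]
    simp only [hax _ z hzt]
    rw [altForm_apply_sum]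
    refine (norm_sum_le _ _).trans (Finset.sum_le_sum fun r _ => ?_)
    rw [norm_smul, Real.norm_eq_abs, Finset.abs_prod]
    exact mul_le_mul_of_nonneg_left (hM r z hzt) (Finset.prod_nonneg fun j _ => abs_nonneg _)
  rw [← Finset.sum_mul] at h1
  refine h1.trans (mul_le_mul_of_nonneg_right ?_ hM0)
  exact ((le_abs_self _).trans (hB x hx)).trans (le_max_left _ _)

theorem Expansion.exists_coef_bound (G : Expansion J hN ψ) (a : G.ι) {x₀ : X} {K : Set X}
    (hK : IsCompact K) (hKs : K ⊆ (chartAt (Model (2 * n)) x₀).source) :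
    ∃ B : ℝ, 0 ≤ B ∧ ∀ (u : RoughForm (2 * n) X (2 * p)) (M : ℝ), 0 ≤ M →
      (∀ i, ∀ z ∈ (chartAt (Model (2 * n)) x₀).target, ‖chartCoeff x₀ u i z‖ ≤ M) →
      ∀ x ∈ K, ‖G.coef a x (u x)‖ ≤ B * M := by
  choose B hB0 hB using fun s : Fin (2 * p) → Fin (2 * n) =>
    exists_chart_bound hK hKs fun i => G.frame a (s i)
  choose W hW using fun s => hK.exists_bound_of_continuousOn
    (G.weight_smooth a s).continuous.continuousOn
  refine ⟨∑ s, |W s| * B s, Finset.sum_nonneg fun s _ => mul_nonneg (abs_nonneg _) (hB0 s),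
    fun u M hM0 hM x hx => ?_⟩
  rw [G.coef_eq, Finset.sum_mul]
  refine (norm_sum_le _ _).trans (Finset.sum_le_sum fun s _ => ?_)
  rw [norm_mul, mul_assoc]
  exact mul_le_mul ((hW s x hx).trans (le_abs_self _)) (hB s u M hM0 hM x hx) (norm_nonneg _)
    (abs_nonneg _)

variable [T2Space X] [SecondCountableTopology X] [MeasurableSpace X]

/-- On forms supported in `K`, only finitely many generators intervene. Each contributes the
integral over `K` of a coefficient for a positive measure, and the coefficients are bounded by the
components of the form without derivatives. -/
theorem isOrderZero_of_measure (hg : IsMetric J g) (hqp : q + p = n)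
    (hN : 2 * q + 2 * p = 2 * n) (hΘ : Θ.HasBidimension J)
    (hc : ∀ (φ : RoughForm (2 * n) X (2 * p)) (hφ : IsSmoothForm φ),
        (∀ x, IsStronglyPositive (J.at x) (φ x)) →
          ∃ μ : Measure X, IsPositiveRadon (Θ.wedge φ hφ) μ) : Θ.IsOrderZero := by
  have hψ := hg.isVolumeForm
  obtain ⟨G⟩ := exists_expansion hg hqp hN hψ
  have hp := hg.isStronglyPositive_contractField hqp hN hψ.isNonnegTop
  choose ν hν using fun a => hc (contractField J hN (powForm g n) (G.field a))
    (isSmoothForm_contractField hN hψ.1 _) (hp _)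
  intro x₀ K hK hKs
  obtain ⟨χ, h1, h2, h3, -, h4⟩ := exists_cutoff_compact (d := 2 * n) hK isOpen_univ
    (Set.subset_univ _)
  obtain ⟨t, ht⟩ := G.locallyFinite _ (TestFun.ofReal χ h1 h3).compact.isCompact
  choose B hB0 hB using fun a => G.exists_coef_bound a hK hKs
  refine ⟨∑ a ∈ t, B a * (ν a).real K, fun u huK M hM hu => ?_⟩
  have hu' : ∀ i, ∀ z ∈ (chartAt (Model (2 * n)) x₀).target, ‖chartCoeff x₀ u.1 i z‖ ≤ M :=
    fun i z hz => by simpa using hu 0 le_rfl i z hz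
  have hu0 : ∀ x ∉ K, u.1 x = 0 := by
    intro x hx
    by_contra h
    exact hx (huK (subset_closure h))
  have h5 : Θ.toFun u = Θ.wedge u.1 u.2.1 (.ofReal χ h1 h3) := by
    refine congrArg Θ.toFun (Subtype.ext (funext fun x => ?_))
    change u.1 x = (χ x : ℂ) • u.1 x
    by_cases hx : x ∈ K
    · rw [h2.self_of_nhdsSet x hx, Complex.ofReal_one, one_smul]
    · rw [hu0 x hx, smul_zero]
  rw [h5, G.wedge_eq hψ.1 hΘ u.2.1 _ (fun a x => (hp _ x).mem (J.at_at x)) fun x hx => (ht x hx).2,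
    Finset.sum_mul]
  refine (norm_sum_le _ _).trans (Finset.sum_le_sum fun a _ => ?_)
  have := (hν a).1
  rw [(hν a).2, ← setIntegral_eq_integral_of_forall_compl_eq_zero (s := K)]
  · refine (norm_setIntegral_le_of_norm_le_const (C := B a * M) hK.measure_lt_top
      fun x hx => ?_).trans_eq (by ring)
    change ‖(χ x : ℂ) * G.coef a x (u.1 x)‖ ≤ _
    rw [h2.self_of_nhdsSet x hx, Complex.ofReal_one, one_mul]
    exact hB a u.1 M hM hu' x hx
  · intro x hx
    change (χ x : ℂ) * G.coef a x (u.1 x) = 0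
    rw [hu0 x hx, map_zero, mul_zero]

end OrderZero

/-! ### The mass property and positivity of the density. -/

section Mass

open Topology

universe u

variable {n : ℕ} {X : Type u} [TopologicalSpace X] [ChartedSpace (Model (2 * n)) X]
  [IsManifold (𝓡 (2 * n)) ∞ X] [T2Space X] [SecondCountableTopology X] [MeasurableSpace X]
  [BorelSpace X] {J : ACStructure (2 * n) X} {g : RoughForm (2 * n) X 2} {q p : ℕ}
  {hN : 2 * q + 2 * p = 2 * n} {ψ : RoughForm (2 * n) X (2 * n)} {Θ : Current (2 * n) X (2 * p)}
  {μ : Measure X}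

/-- The form C ω_p - β_ξ is strongly positive with C a smooth function, so by (c) it also yields a
positive measure; adding that of β_ξ gives C·μ. -/
theorem absolutelyContinuous_of_dominate (hg : IsMetric J g) (hqp : q + p = n)
    (hN : 2 * q + 2 * p = 2 * n)
    (hc : ∀ (φ : RoughForm (2 * n) X (2 * p)) (hφ : IsSmoothForm φ),
        (∀ x, IsStronglyPositive (J.at x) (φ x)) →
          ∃ μ : Measure X, IsPositiveRadon (Θ.wedge φ hφ) μ)
    (hμ : IsPositiveRadon (Θ.wedge (powForm g p) (isSmoothForm_powForm hg.smooth p)) μ)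
    (ξ : Fin q → VField (2 * n) X) {ν : Measure X}
    (hν : IsPositiveRadon (Θ.wedge (contractField J hN (powForm g n) ξ)
      (isSmoothForm_contractField hN hg.isVolumeForm.1 ξ)) ν) : ν ≪ μ := by
  set C : X → ℂ := fun x => ((p.factorial * topConst n * gramField J g ξ x : ℝ) : ℂ) with hC
  have hCs : ContMDiff (𝓡 (2 * n)) 𝓘(ℝ, ℂ) ∞ C :=
    contMDiff_ofReal (contMDiff_const.mul (contMDiff_gramField hg.smooth ξ))
  have hβ := isSmoothForm_contractField (J := J) hN hg.isVolumeForm.1 ξ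
  have hω := isSmoothForm_powForm hg.smooth p
  obtain ⟨ν', hν'⟩ := hc (fun x => C x • powForm g p x - contractField J hN (powForm g n) ξ x)
    ((hω.smul hCs).sub hβ) fun x => hg.isStronglyPositive_dominate hqp hN ξ x
  have := hμ.1
  refine hν.absolutelyContinuous hν' hCs.continuous fun f => ?_
  refine Eq.trans ?_ (hμ.2 (f.mul C hCs))
  have h1 := Θ.wedge_eq_sum hω (f.mul C hCs) (Finset.univ : Finset Bool)
    (β := fun b => bif b then contractField J hN (powForm g n) ξ else
      fun x => C x • powForm g p x - contractField J hN (powForm g n) ξ x)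
    (fun b => by
      cases b
      · exact (hω.smul hCs).sub hβ
      · exact hβ) (fun _ => f) fun x => by
    rw [Fintype.sum_bool, TestFun.mul_toFun, ← smul_add, mul_smul]
    simp only [cond_true, cond_false]
    rw [add_sub_cancel]
  rw [h1, Fintype.sum_bool]
  rfl

theorem exists_density_of_measure (hg : IsMetric J g) (hqp : q + p = n)
    (hN : 2 * q + 2 * p = 2 * n) (hΘ : Θ.HasBidimension J)
    (hc : ∀ (φ : RoughForm (2 * n) X (2 * p)) (hφ : IsSmoothForm φ),
        (∀ x, IsStronglyPositive (J.at x) (φ x)) →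
          ∃ μ : Measure X, IsPositiveRadon (Θ.wedge φ hφ) μ)
    (hμ : IsPositiveRadon (Θ.wedge (powForm g p) (isSmoothForm_powForm hg.smooth p)) μ)
    {φ : RoughForm (2 * n) X (2 * p)} (hφ : IsSmoothForm φ) :
    ∃ k : X → ℂ, IsComplexRadon (Θ.wedge φ hφ) μ k := by
  have hψ := hg.isVolumeForm
  have := hμ.1
  obtain ⟨G⟩ := exists_expansion hg hqp hN hψ
  have hp := hg.isStronglyPositive_contractField hqp hN hψ.isNonnegTop
  choose ν hν using fun a => hc (contractField J hN (powForm g n) (G.field a))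
    (isSmoothForm_contractField hN hψ.1 _) (hp _)
  choose h hh using fun a => (hν a).exists_density
    (absolutelyContinuous_of_dominate hg hqp hN hc hμ _ (hν a))
  exact ⟨_, G.isComplexRadon hψ.1 hΘ (fun a x => (hp _ x).mem (J.at_at x)) hh hφ⟩

/-- One direction is the existence of densities. For the other, vanishing of the integrals kills the
positive measures Θ∧β_a on `A`, hence their μ-densities almost everywhere on `A`. But ω_p expands in
the β_a and Θ∧ω_p has density 1, so almost no point lies in `A`. -/
theorem isMass_of_measure (hg : IsMetric J g) (hqp : q + p = n)
    (hN : 2 * q + 2 * p = 2 * n) (hΘ : Θ.HasBidimension J)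
    (hc : ∀ (φ : RoughForm (2 * n) X (2 * p)) (hφ : IsSmoothForm φ),
        (∀ x, IsStronglyPositive (J.at x) (φ x)) →
          ∃ μ : Measure X, IsPositiveRadon (Θ.wedge φ hφ) μ)
    (hμ : IsPositiveRadon (Θ.wedge (powForm g p) (isSmoothForm_powForm hg.smooth p)) μ) :
    Θ.IsMass J hN μ := by
  refine ⟨hμ.1, fun ψ hψ A hA hAc => ⟨fun hμA ξ => ?_, fun hξ => ?_⟩⟩
  · obtain ⟨k, hk⟩ := exists_density_of_measure hg hqp hN hΘ hc hμ (hψ.1.contract hN ξ)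
    rw [Θ.evalMul_eq_wedge]
    exact ⟨μ, k, hk, setIntegral_measure_zero _ hμA⟩
  · have := hμ.1
    obtain ⟨G⟩ := exists_expansion hg hqp hN hψ
    have := G.countable
    have hp := hg.isStronglyPositive_contractField hqp hN hψ.isNonnegTop
    choose ν hν using fun a => hc (contractField J hN ψ (G.field a))
      (isSmoothForm_contractField hN hψ.1 _) (hp _)
    choose h hh using fun a => exists_density_of_measure hg hqp hN hΘ hc hμ
      (isSmoothForm_contractField (J := J) hN hψ.1 (G.field a))
    have hνA : ∀ a, ν a A = 0 := by
      intro a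
      obtain ⟨m, c, h1, h2⟩ := hξ (interleave (G.field a) fun i => J.field (G.field a i))
      rw [Θ.evalMul_interleave] at h1
      rw [h1.setIntegral_eq_real (hν a)] at h2
      have := (hν a).1
      exact (measureReal_eq_zero_iff ((measure_mono subset_closure).trans_lt
        hAc.measure_lt_top).ne).1 (Complex.ofReal_eq_zero.1 h2)
    have h0 : ∀ᵐ x ∂μ, ∀ a, x ∈ A → h a x = 0 :=
      ae_all_iff.2 fun a => (hh a).ae_eq_zero_on (hν a) hA (hνA a)
    -- Two densities of Θ∧ω_p with respect to μ: the one assembled from the generators and the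
    -- constant 1.
    have h1 := (G.isComplexRadon hψ.1 hΘ (fun a x => (hp _ x).mem (J.at_at x)) hh
      (isSmoothForm_powForm hg.smooth p)).ae_eq hμ.isComplexRadon
    refine measure_eq_zero_iff_ae_notMem.2 ?_
    filter_upwards [h0, h1] with x hx hx' hxA
    obtain ⟨t, ht⟩ := G.locallyFinite {x} isCompact_singleton
    rw [G.functional_eq h (ht x rfl).1,
      Finset.sum_eq_zero fun a _ => by rw [hx a hxA, zero_mul]] at hx'
    exact zero_ne_one hx'

theorem isClosed_nonneg_complex : IsClosed {z : ℂ | 0 ≤ z} :=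
  have := RCLike.instOrderClosedTopology (K := ℂ)
  isClosed_le continuous_const continuous_id

/-- The value is a polynomial in the coefficients `w`, hence continuous, and the nonnegative reals
are closed in ℂ. -/
theorem nonneg_of_dense {V : Type*} [AddCommGroup V] [Module ℝ V] {J : V →ₗ[ℝ] V} {q m : ℕ}
    (u : AltForm V (2 * q)) (e : Fin m → V) {D : Set (Fin q → Fin m → ℝ)} (hD : Dense D)
    (h : ∀ w ∈ D, 0 ≤ u (interleave (fun i => ∑ k, w i k • e k) fun i => J (∑ k, w i k • e k)))
    (w : Fin q → Fin m → ℝ) :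
    0 ≤ u (interleave (fun i => ∑ k, w i k • e k) fun i => J (∑ k, w i k • e k)) := by
  have h1 : ∀ w : Fin q → Fin m → ℝ,
      u (interleave (fun i => ∑ k, w i k • e k) fun i => J (∑ k, w i k • e k)) =
      u fun a => ∑ k, interleave w w a k •
        interleave (fun _ : Fin q => e) (fun _ k => J (e k)) a k := by
    intro w
    refine congrArg u (funext fun a => ?_)
    by_cases ha : a.val % 2 = 0 <;> simp [interleave, ha]
  have hcont : Continuous fun w : Fin q → Fin m → ℝ =>
      u (interleave (fun i => ∑ k, w i k • e k) fun i => J (∑ k, w i k • e k)) := by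
    simp only [h1, altForm_apply_sum]
    refine continuous_finsetSum _ fun r _ => Continuous.fun_smul
      (continuous_finsetProd _ fun a _ => ?_) continuous_const
    by_cases ha : a.val % 2 = 0
    · simp only [interleave, if_pos ha]
      fun_prop
    · simp only [interleave, if_neg ha]
      fun_prop
  have h2 : closure D ⊆ _ := (isClosed_nonneg_complex.preimage hcont).closure_subset_iff.2 h
  exact h2 (hD.closure_eq ▸ Set.mem_univ w)

/-- For each choice of fields nonnegativity holds off a null set depending on them. Countably many
local frames, with coefficients in a countable dense set, give a single null set; density and the
spanning of the tangent space by a frame then reach all vectors. -/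
theorem ae_isPositive_of_measure (hg : IsMetric J g) (hqp : q + p = n)
    (hc : ∀ (φ : RoughForm (2 * n) X (2 * p)) (hφ : IsSmoothForm φ),
        (∀ x, IsStronglyPositive (J.at x) (φ x)) →
          ∃ μ : Measure X, IsPositiveRadon (Θ.wedge φ hφ) μ)
    {θ : RoughForm (2 * n) X (2 * q)}
    (hθ : Θ.IsDensity J hN μ (powForm g n) (isSmoothForm_powForm hg.smooth n) θ) :
    ∀ᵐ x ∂μ, IsPositive (J.at x) (θ x) := by
  have hψ := hg.isVolumeForm
  have hpos : ∀ ξ : Fin q → VField (2 * n) X, ∀ᵐ x ∂μ,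
      0 ≤ θ x (interleave (fun i => ξ i x) fun i => J.at x (ξ i x)) := by
    intro ξ
    obtain ⟨ν, hν⟩ := hc (contractField J hN (powForm g n) ξ)
      (isSmoothForm_contractField hN hψ.1 _)
      (hg.isStronglyPositive_contractField hqp hN hψ.isNonnegTop ξ)
    have h1 := hθ.2 (interleave ξ fun i => J.field (ξ i))
    rw [Θ.evalMul_interleave] at h1
    filter_upwards [h1.ae_nonneg hν] with x hx
    rwa [interleave_field] at hx
  choose E U hU hxU hE using hψ.exists_localFrame
  obtain ⟨s, hs, hsU⟩ := TopologicalSpace.countable_cover_nhds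
    fun x => (hU x).mem_nhds (hxU x)
  have := hs.to_subtype
  obtain ⟨D, hDc, hD⟩ := TopologicalSpace.exists_countable_dense (Fin q → Fin (2 * n) → ℝ)
  have := hDc.to_subtype
  have hall : ∀ᵐ x ∂μ, ∀ (y : s) (w : D), 0 ≤ θ x (interleave
      (fun i => ∑ k, w.1 i k • E y k x) fun i => J.at x (∑ k, w.1 i k • E y k x)) := by
    refine ae_all_iff.2 fun y => ae_all_iff.2 fun w => ?_
    filter_upwards [hpos fun i => ∑ k, w.1 i k • E y k] with x hx
    have h1 : ∀ i, (∑ k, w.1 i k • E y k : VField (2 * n) X) x = ∑ k, w.1 i k • E y k x := by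
      intro i
      change evalField x (∑ k, w.1 i k • E y k) = _
      rw [map_sum]
      rfl
    simpa only [h1] using hx
  filter_upwards [hall] with x hx
  refine ⟨hθ.1 x, fun v => ?_⟩
  obtain ⟨y, hys, hxy⟩ := Set.mem_iUnion₂.1 (hsU ▸ Set.mem_univ x)
  choose w hw using fun i => eq_sum_of_apply_ne_zero (finrank_tangentSpace x) (hE y x hxy) (v i)
  have h1 := nonneg_of_dense (J := J.at x) (θ x) (fun k => E y k x) hD
    (fun w hw => hx ⟨y, hys⟩ ⟨w, hw⟩) w
  simpa only [← hw] using h1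

end Mass

end AlmostComplex

end

/-! ### Equivalence of the three conditions. -/

theorem mainTheorem6 (n p : ℕ) (hp : p ≤ n)
    (X : Type*) [TopologicalSpace X] [T2Space X] [SecondCountableTopology X]
    [ChartedSpace (Model (2 * n)) X] [IsManifold (𝓡 (2 * n)) ∞ X]
    [MeasurableSpace X] [BorelSpace X]
    (J : ACStructure (2 * n) X)
    (g : RoughForm (2 * n) X 2) (hg : IsMetric J g)
    (Θ : Current (2 * n) X (2 * p)) (hΘ : Θ.HasBidimension J) :
    List.TFAE [
      -- (a)
      ∀ (ξ : Fin (n - p) → VField (2 * n) X) (φ : TestForm (2 * n) X (2 * n)),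
        (∀ x, IsPositive (J.at x) (φ.1 x)) →
          0 ≤ Θ.eval (degree_add hp) (interleave ξ fun j => J.field (ξ j)) φ,
      -- (b)
      Θ.IsOrderZero ∧ ∃ μ : Measure X,
        IsPositiveRadon (Θ.wedge (powForm g p) (isSmoothForm_powForm hg.smooth p)) μ ∧
        Θ.IsMass J (degree_add hp) μ ∧
        ∀ θ : RoughForm (2 * n) X (2 * (n - p)),
          Θ.IsDensity J (degree_add hp) μ (powForm g n) (isSmoothForm_powForm hg.smooth n) θ →
            ∀ᵐ x ∂μ, IsPositive (J.at x) (θ x),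
      -- (c)
      ∀ (φ : RoughForm (2 * n) X (2 * p)) (hφ : IsSmoothForm φ),
        (∀ x, IsStronglyPositive (J.at x) (φ x)) →
          ∃ μ : Measure X, IsPositiveRadon (Θ.wedge φ hφ) μ] := by
  have hqp : n - p + p = n := Nat.sub_add_cancel hp
  tfae_have 1 → 3 := exists_measure_of_eval hg hqp hΘ
  tfae_have 3 → 1 := eval_nonneg_of_measure hg hqp
  tfae_have 3 → 2 := by
    intro hc
    obtain ⟨μ, hμ⟩ := hc _ (isSmoothForm_powForm hg.smooth p) (hg.isStronglyPositive_powForm p)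
    exact ⟨isOrderZero_of_measure hg hqp (degree_add hp) hΘ hc, μ, hμ,
      isMass_of_measure hg hqp (degree_add hp) hΘ hc hμ,
      fun θ hθ => ae_isPositive_of_measure hg hqp hc hθ⟩
  tfae_have 2 → 1 := by
    rintro ⟨-, μ, -, hμ, hθ⟩
    exact eval_nonneg_of_density hg hqp hΘ hμ hθ
  tfae_finish
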